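/- **Sure Screening Property.** Let $(Y,X^{(1)},\dots,X^{(p)})$ be a random vector with $X^{(j)}$ square integrable, $\operatorname{Var}(X^{(j)})>0$, and let $\mathcal M^*=\{j:\operatorname{Cov}(X^{(j)},Y)\neq 0\}$. Write $\|Z\|_r=(\mathbb E|Z|^r)^{1/r}$, $\tilde Z=Z-\mathbb E Z$, $\sigma_Z^2=\operatorname{Var}(Z)$, $\tau_j=\operatorname{Cov}(X^{(j)},Y)/\operatorname{Var}(X^{(j)})$ and $\varepsilon^{(j)}=\tilde Y-\tau_j\tilde X^{(j)}$. Assume that $Y$ and $X^{(j)}$, $j\in\mathcal M^*$, have a finite moment of order $6$, and that $\tilde X^{(j)}\varepsilon^{(j)}$ is not almost surely $0$ for $j\in\mathcal M^*$. Let $(Y_i,X_i^{(1)},\dots,X_i^{(p)})_{1\le i\le n}$, $n\ge1$, be independent copies of $(Y,X^{(1)},\dots,X^{(p)})$, with empirical means $\overline{\mathbf Y},\overline{\mathbf X}^{(j)}$. Let $$\hat\tau_j=\frac{\sum_i (X^{(j)}_i-\overline{\mathbf X}^{(j)})(Y_i-\overline{\mathbf Y})}{\sum_i (X^{(j)}_i-\overline{\mathbf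 X}^{(j)})^2},\quad \hat b_j=\overline{\mathbf Y}-\hat\tau_j\overline{\mathbf X}^{(j)},\quad \hat\varepsilon^{(j)}_i=Y_i-\hat b_j-\hat\tau_jX^{(j)}_i,\quad \hat v_j=\frac{n^{-1}\sum_i (X^{(j)}_i-\overline{\mathbf X}^{(j)})^2(\hat\varepsilon^{(j)}_i)^2}{\bigl(n^{-1}\sum_i (X^{(j)}_i-\overline{\mathbf X}^{(j)})^2\bigr)^2},$$ and, for $q\in(0,1)$ and $\gamma=\Phi^{-1}(1-q/2)$ ($\Phi$ the standard Gaussian distribution function), $\widehat{\mathcal M}=\{j:\sqrt n|\hat\tau_j|/\sqrt{\hat v_j}\ge\gamma\}$, where an undefined quotient counts as $0$. There are a numerical constant $c_{BE}>0$ with $|\mathbb P(\sqrt n\,\overline Z/\sigma_Z\le x)-\Phi(x)|\le c_{BE}\,\mathbb E|Z_1|^3/(\sigma_Z^3\sqrt n)$ for all $x$, $n\ge 1$ and all i.i.d. centered $Z_i$ with finite third moment and $\sigma_Z^2>0$ (Berry–Esseen), and numerical constants $c_1,c_2>0$ with $\|\overline Z\|_4\le c_1\sqrt4\,\sigma_Z/\sqrt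 n+4c_2\,n^{-3/4}\|Z_1\|_4$ for all $n\ge 1$ and all i.i.d. centered $Z_i$ with finite fourth moment (Rosenthal). For any such constants define, for $(X,Y)$ with $\tau=\operatorname{Cov}(X,Y)/\operatorname{Var}(X)$ and $\varepsilon=\tilde Y-\tau\tilde X$, $$K_1=\frac{\sigma_\varepsilon\sigma_X}{\sqrt{2\pi}\|\tilde X\varepsilon\|_2},\qquad K_2=2+c_{BE}\Bigl[\frac{\|\tilde X\varepsilon\|_3^3}{\|\tilde X\varepsilon\|_2^3}+\frac{2\|\varepsilon\|_3^3}{\sigma_\varepsilon^3}+\frac{2\|\tilde X\|_3^3}{\sigma_X^3}\Bigr],$$ $$\begin{aligned}G_1={}&\tfrac{64\|\tilde Y^2\tilde X\|_1\sigma_X}{\|\tilde X\varepsilon\|_2^2}+\tfrac{1120\|\tilde X\|_3^3\sigma_Y^2}{\|\tilde X\varepsilon\|_2^2\sigma_X}+\tfrac{64\sqrt2\|\tilde X\varepsilon\|_3^3}{\|\tilde X\varepsilon\|_2^3}+\tfrac{288\sigma_Y\|\tilde X^2\tilde Y\|_1}{\|\tilde X\varepsilon\|_2^2}+\tfrac{432|\tau|\|\tilde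 X\|_3^3\sigma_Y}{\|\tilde X\varepsilon\|_2^2}+\tfrac{1152\|\tilde X^3\tilde Y\|_1}{\sigma_X^2\|\tilde X\varepsilon\|_2}\\&+\tfrac{1152\|\tilde X\|_4^4\sigma_Y}{\sigma_X^3\|\tilde X\varepsilon\|_2}+\tfrac{576|\tau|\|\tilde X\|_4^4}{\sigma_X^2\|\tilde X\varepsilon\|_2}+\tfrac{576\|\tilde X^2\tilde Y\|_1\sigma_Y}{\|\tilde X\varepsilon\|_2^2\sigma_X}+\tfrac{2\|\tilde X^2\tilde Y\|_2}{\|\tilde X^2\tilde Y\|_1}+\tfrac{2\|\tilde Y^2\tilde X\|_2+\sigma_X\|\tilde Y\|_4^2+4\sigma_Y\|\tilde X\tilde Y\|_2}{2\|\tilde Y^2\tilde X\|_1}\\&+\tfrac{\sigma_Y\|\tilde X\|_4^2}{\|\tilde X^2\tilde Y\|_1}+\tfrac{13\sigma_X\|\tilde X\|_4^2}{4\|\tilde X\|_3^3}+\tfrac{9\|\tilde X\|_6^3}{2\|\tilde X\|_3^3}+\tfrac{6\|\tilde Y\|_4^2}{\sigma_Y^2}+\tfrac{16\|\tilde X\|_4^2}{\sigma_X^2}+\tfrac{2^{7/2}\|\tilde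 X^3\tilde Y\|_{3/2}^{3/2}}{\|\tilde X^3\tilde Y\|_1^{3/2}}+\tfrac{\sigma_Y\|\tilde X\|_6^3}{2\|\tilde X^3\tilde Y\|_1}+\tfrac{8\|\tilde X\|_6^6}{\|\tilde X\|_4^6}+\tfrac{\sigma_X\|\tilde X\|_6^3}{2\|\tilde X\|_4^4},\end{aligned}$$ $$G_2=4+\tfrac{288\|\tilde X^3\tilde Y\|_1\sigma_\varepsilon}{\sigma_X\|\tilde X\varepsilon\|_2^2}+\tfrac{288\sigma_Y\sigma_\varepsilon\|\tilde X\|_4^4}{\|\tilde X\varepsilon\|_2^2\sigma_X^2}+\tfrac{144|\tau|\sigma_\varepsilon\|\tilde X\|_4^4}{\sigma_X\|\tilde X\varepsilon\|_2^2}+\tfrac{c_1^2\sigma_X^3}{\|\tilde X\|_3^3}+\tfrac{2c_1^2\sigma_X\sigma_Y^2}{\|\tilde Y^2\tilde X\|_1},\qquad G_3=16c_2^2\Bigl[\tfrac{\sigma_X\|\tilde X\|_4^2}{\|\tilde X\|_3^3}+\tfrac{2\sigma_X\|\tilde Y\|_4^2}{\|\tilde Y^2\tilde X\|_1}\Bigr].$$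 Let $s_{n,j}=\dfrac{\sqrt n\,\sigma_{X^{(j)}}^2|\tau_j|}{2\sqrt2\,\|\tilde X^{(j)}\varepsilon^{(j)}\|_2}$ and $(t)_+=\max(t,0)$. Then for every $n\ge1$ $$\begin{aligned}\mathbb P(\mathcal M^*\subset\widehat{\mathcal M})\ge{}&1-\sum_{j\in\mathcal M^*}\exp\Bigl(-\tfrac14\bigl(s_{n,j}-\gamma\bigr)_+^2\Bigr)-\frac{\log n}{\sqrt n}|\mathcal M^*|\max_{j\in\mathcal M^*}2K_1(X^{(j)},Y)\\&-\frac{|\mathcal M^*|}{\sqrt n}\max_{j\in\mathcal M^*}\Bigl(2K_2(X^{(j)},Y)+\frac{2\|\tilde X^{(j)}\|_4^2}{\sigma_{X^{(j)}}^2}+G_1(X^{(j)},Y)\Bigr)-\frac{|\mathcal M^*|}{n}\max_{j\in\mathcal M^*}\bigl(4G_2(X^{(j)},Y)+2\bigr)-\frac{|\mathcal M^*|}{n^{3/2}}\max_{j\in\mathcal M^*}G_3(X^{(j)},Y).\end{aligned}$$ In particular, if $s_{n,j}\ge\gamma$ for all $j\in\mathcal M^*$, the inequality holds with $(s_{n,j}-\gamma)^2$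 in place of $(s_{n,j}-\gamma)_+^2$. (Maxima over an empty $\mathcal M^*$ are read as $0$.) Moreover, for a fixed vector, fixed $q$ and an infinite sequence of independent copies, $\mathbb P(\mathcal M^*\subset\widehat{\mathcal M})\to1$ as $n\to\infty$. -/

import Mathlib

open MeasureTheory ProbabilityTheory Filter Topology

noncomputable section

namespace Screening

/-! Probability notation -/

/-- The cumulative distribution function `Φ` of the standard Gaussian law. -/
def stdNormalCDF (x : ℝ) : ℝ := cdf (gaussianReal 0 1) x

/-- The quantile function `Φ⁻¹` (used for levels in `(0, 1)`). -/
def stdNormalQuantile (u : ℝ) : ℝ := sInf {x : ℝ | u ≤ stdNormalCDF x}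

section Population

variable {Ω : Type*} [MeasurableSpace Ω]

/-- The norm `‖Z‖_r = (E |Z|^r)^(1/r)`. -/
def lnorm (P : Measure Ω) (r : ℝ) (Z : Ω → ℝ) : ℝ := (∫ ω, |Z ω| ^ r ∂P) ^ (1 / r)

/-- The centered variable `Z - E Z`. -/
def centered (P : Measure Ω) (Z : Ω → ℝ) : Ω → ℝ := fun ω => Z ω - ∫ ω', Z ω' ∂P

/-- The standard deviation of `Z`. -/
def sd (P : Measure Ω) (Z : Ω → ℝ) : ℝ := √(Var[Z; P])

/-- The slope `τ = Cov(X, Y) / Var(X)`. -/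
def slope (P : Measure Ω) (X Y : Ω → ℝ) : ℝ := cov[X, Y; P] / Var[X; P]

/-- The error `ε = (Y - E Y) - τ (X - E X)`, that is `Y - b - τ X` with `b = E Y - τ E X`. -/
def regError (P : Measure Ω) (X Y : Ω → ℝ) : Ω → ℝ :=
  fun ω => centered P Y ω - slope P X Y * centered P X ω

/-- The constant `K₁(X, Y)`. -/
def K1 (P : Measure Ω) (X Y : Ω → ℝ) : ℝ :=
  let e := regError P X Y
  sd P e * sd P X / (√(2 * Real.pi) * lnorm P 2 (centered P X * e))

/-- The constant `K₂(X, Y)`, with `cBE` the numerical constant of the Berry-Esseen inequality. -/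
def K2 (cBE : ℝ) (P : Measure Ω) (X Y : Ω → ℝ) : ℝ :=
  let x := centered P X
  let e := regError P X Y
  2 + cBE * (lnorm P 3 (x * e) ^ 3 / lnorm P 2 (x * e) ^ 3
    + 2 * lnorm P 3 e ^ 3 / sd P e ^ 3
    + 2 * lnorm P 3 x ^ 3 / sd P X ^ 3)

/-- The Lyapunov ratio `G₁(X, Y)`. -/
def G1 (P : Measure Ω) (X Y : Ω → ℝ) : ℝ :=
  let N := lnorm P
  let x := centered P X
  let y := centered P Y
  let e := regError P X Y
  let sX := sd P X
  let sY := sd P Y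
  let τ := slope P X Y
  64 * N 1 (y ^ 2 * x) * sX / N 2 (x * e) ^ 2
  + 1120 * N 3 x ^ 3 * sY ^ 2 / (N 2 (x * e) ^ 2 * sX)
  + 64 * √2 * N 3 (x * e) ^ 3 / N 2 (x * e) ^ 3
  + 288 * sY * N 1 (x ^ 2 * y) / N 2 (x * e) ^ 2
  + 432 * |τ| * N 3 x ^ 3 * sY / N 2 (x * e) ^ 2
  + 1152 * N 1 (x ^ 3 * y) / (sX ^ 2 * N 2 (x * e))
  + 1152 * N 4 x ^ 4 * sY / (sX ^ 3 * N 2 (x * e))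
  + 576 * |τ| * N 4 x ^ 4 / (sX ^ 2 * N 2 (x * e))
  + 576 * N 1 (x ^ 2 * y) * sY / (N 2 (x * e) ^ 2 * sX)
  + 2 * N 2 (x ^ 2 * y) / N 1 (x ^ 2 * y)
  + 1 / (2 * N 1 (y ^ 2 * x)) *
      (2 * N 2 (y ^ 2 * x) + sX * N 4 y ^ 2 + 4 * sY * N 2 (x * y))
  + sY * N 4 x ^ 2 / N 1 (x ^ 2 * y)
  + 13 * sX * N 4 x ^ 2 / (4 * N 3 x ^ 3)
  + 9 * N 6 x ^ 3 / (2 * N 3 x ^ 3)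
  + 6 * N 4 y ^ 2 / sY ^ 2
  + 16 * N 4 x ^ 2 / sX ^ 2
  + (2 : ℝ) ^ (7 / 2 : ℝ) * N (3 / 2) (x ^ 3 * y) ^ (3 / 2 : ℝ)
      / N 1 (x ^ 3 * y) ^ (3 / 2 : ℝ)
  + sY * N 6 x ^ 3 / (2 * N 1 (x ^ 3 * y))
  + 8 * N 6 x ^ 6 / N 4 x ^ 6
  + sX * N 6 x ^ 3 / (2 * N 4 x ^ 4)

/-- The Lyapunov ratio `G₂(X, Y)`, with `c₁` the first constant of Rosenthal's inequality. -/
def G2 (c₁ : ℝ) (P : Measure Ω) (X Y : Ω → ℝ) : ℝ :=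
  let N := lnorm P
  let x := centered P X
  let y := centered P Y
  let e := regError P X Y
  let sX := sd P X
  let sY := sd P Y
  let se := sd P e
  let τ := slope P X Y
  4 + 288 * N 1 (x ^ 3 * y) * se / (sX * N 2 (x * e) ^ 2)
  + 288 * sY * se * N 4 x ^ 4 / (N 2 (x * e) ^ 2 * sX ^ 2)
  + 144 * |τ| * se * N 4 x ^ 4 / (sX * N 2 (x * e) ^ 2)
  + c₁ ^ 2 * sX ^ 3 / N 3 x ^ 3
  + 2 * c₁ ^ 2 * sX * sY ^ 2 / N 1 (y ^ 2 * x)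

/-- The Lyapunov ratio `G₃(X, Y)`, with `c₂` the second constant of Rosenthal's inequality. -/
def G3 (c₂ : ℝ) (P : Measure Ω) (X Y : Ω → ℝ) : ℝ :=
  let N := lnorm P
  let x := centered P X
  let y := centered P Y
  let sX := sd P X
  16 * c₂ ^ 2 * (sX * N 4 x ^ 2 / N 3 x ^ 3 + 2 * sX * N 4 y ^ 2 / N 1 (y ^ 2 * x))

/-- The set `M*` of the indices `j` for which `X^(j)` is correlated with `Y`. -/
def relevant (P : Measure Ω) {p : ℕ} (X : Fin p → Ω → ℝ) (Y : Ω → ℝ) : Finset (Fin p) :=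
  open scoped Classical in Finset.univ.filter fun j => cov[X j, Y; P] ≠ 0

/-- The signal `√n σ_X² |τ| / (2 √2 ‖(X - E X) ε‖₂)`. -/
def signal (P : Measure Ω) (n : ℕ) (X Y : Ω → ℝ) : ℝ :=
  √n * sd P X ^ 2 * |slope P X Y| / (2 * √2 * lnorm P 2 (centered P X * regError P X Y))

/-- The lower bound: `1`, minus the sum over `M*` of the given exponential terms `E j`, minus the
error terms of order `log n / √n`, `1 / √n`, `1 / n` and `n ^ (-3/2)`. The maxima are over the
finite set `M*` (and read as `0`, with the factor `|M*| = 0`, if it is empty). -/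
def screeningBound (cBE c₁ c₂ : ℝ) (P : Measure Ω) {p : ℕ} (X : Fin p → Ω → ℝ) (Y : Ω → ℝ)
    (n : ℕ) (E : Fin p → ℝ) : ℝ :=
  let M := relevant P X Y
  let m : ℝ := M.card
  1 - ∑ j ∈ M, E j
  - Real.log n / √n * m * (⨆ j : M, 2 * K1 P (X j) Y)
  - 1 / √n * m *
      (⨆ j : M, (2 * K2 cBE P (X j) Y + 2 * lnorm P 4 (centered P (X j)) ^ 2 / sd P (X j) ^ 2
        + G1 P (X j) Y))
  - 1 / n * m * (⨆ j : M, (4 * G2 c₁ P (X j) Y + 2))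
  - 1 / (n : ℝ) ^ (3 / 2 : ℝ) * m * (⨆ j : M, G3 c₂ P (X j) Y)

end Population

/-! The numerical constants. A law on `ℝ` stands for the law of `Z₁`, and its `n`-fold product for
the law of `(Z₁, …, Zₙ)`. -/

/-- `c` is a constant for which the Berry-Esseen inequality holds: for i.i.d. centered
`Z₁, …, Zₙ` with finite third moment and variance `σ² > 0`,
`|P(√n Z̄ / σ ≤ x) - Φ(x)| ≤ c E|Z₁|³ / (σ³ √n)`. -/
def BerryEsseenInequality (c : ℝ) : Prop :=
  ∀ (ν : Measure ℝ) [IsProbabilityMeasure ν], MemLp id 3 ν → ∫ z, z ∂ν = 0 → 0 < Var[id; ν] →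
    ∀ n : ℕ, 1 ≤ n → ∀ x : ℝ,
      |(Measure.pi fun _ : Fin n => ν).real {z | √n * ((∑ i, z i) / n) / sd ν id ≤ x}
          - stdNormalCDF x|
        ≤ c * (∫ z, |z| ^ 3 ∂ν) / (sd ν id ^ 3 * √n)

/-- Rosenthal's inequality at the exponent `r` with constants `C₁, C₂`: for i.i.d. centered
`Z₁, …, Zₙ` with finite `r`-th moment,
`‖Z̄‖_r ≤ C₁ √(Var(Z₁) / n) + C₂ ‖Z₁‖_r / n^((r-1)/r)`. -/
def RosenthalInequality (r C₁ C₂ : ℝ) : Prop :=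
  ∀ (ν : Measure ℝ) [IsProbabilityMeasure ν], MemLp id (ENNReal.ofReal r) ν → ∫ z, z ∂ν = 0 →
    ∀ n : ℕ, 1 ≤ n →
      lnorm (Measure.pi fun _ : Fin n => ν) r (fun z => (∑ i, z i) / n)
        ≤ C₁ * √(Var[id; ν] / n) + C₂ * (1 / (n : ℝ) ^ ((r - 1) / r)) * lnorm ν r id

/-! The sample and the screening rule -/

/-- The empirical mean. -/
def sampleMean {n : ℕ} (x : Fin n → ℝ) : ℝ := (∑ i, x i) / n

/-- The least squares slope `τ̂`. -/
def slopeHat {n : ℕ} (x y : Fin n → ℝ) : ℝ :=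
  (∑ i, (x i - sampleMean x) * (y i - sampleMean y)) / ∑ i, (x i - sampleMean x) ^ 2

/-- The least squares intercept `b̂`. -/
def interceptHat {n : ℕ} (x y : Fin n → ℝ) : ℝ := sampleMean y - slopeHat x y * sampleMean x

/-- The residuals `ε̂ᵢ`. -/
def residual {n : ℕ} (x y : Fin n → ℝ) (i : Fin n) : ℝ :=
  y i - interceptHat x y - slopeHat x y * x i

/-- The variance estimator `v̂`. -/
def vHat {n : ℕ} (x y : Fin n → ℝ) : ℝ :=
  (∑ i, (x i - sampleMean x) ^ 2 * residual x y i ^ 2) / n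
    / ((∑ i, (x i - sampleMean x) ^ 2) / n) ^ 2

/-- The screening set `M̂ = {j | √n |τ̂ⱼ| / √v̂ⱼ ≥ γ}`. An undefined quotient is `0`, so that for
`γ > 0` an index with `v̂ⱼ = 0` or with a constant sample is not selected. -/
def selected {n p : ℕ} (γ : ℝ) (x : Fin p → Fin n → ℝ) (y : Fin n → ℝ) : Set (Fin p) :=
  {j | γ ≤ √n * |slopeHat (x j) y| / √(vHat (x j) y)}

/-- `(Yᵢ, Xᵢ⁽¹⁾, …, Xᵢ⁽ᵖ⁾)`, `i ∈ ι`, are independent copies of `(Y, X⁽¹⁾, …, X⁽ᵖ⁾)`. -/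
def IsIIDCopies {Ω₀ Ω ι : Type*} [MeasurableSpace Ω₀] [MeasurableSpace Ω] {p : ℕ}
    (P₀ : Measure Ω₀) (X : Fin p → Ω₀ → ℝ) (Y : Ω₀ → ℝ)
    (P : Measure Ω) (Xs : ι → Fin p → Ω → ℝ) (Ys : ι → Ω → ℝ) : Prop :=
  iIndepFun (fun i ω => (Ys i ω, fun j => Xs i j ω)) P ∧
  ∀ i, IdentDistrib (fun ω => (Ys i ω, fun j => Xs i j ω)) (fun ω => (Y ω, fun j => X j ω)) P P₀

end Screening

end

open Screening

namespace Screening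

/-! Gaussian estimates -/

/-! By a union bound it is enough to control, for one relevant covariate, the probability that its
statistic stays below `γ`. Let `x` be the centered covariate, `e` the regression error, `r = √n` and
`w = ‖x e‖₂`. Let `S` be the sample variance of `x`, `C` the sample covariance of `x` and `e`, and
`N` the empirical `L²` norm of the estimated scores. The statistic equals `r |τ S + C| / N`, since
the factor `1 / S` of the slope cancels against that of the variance estimator. If `S ≥ σ² / 2` and
`0 < N ≤ √2 w`, a statistic below `γ` therefore forces `r |C| / w > √2 (signal - γ)`
(`lt_of_statistic_lt`). Now `C` is the sample mean of `x e`, which is centered by the choice of `τ`,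
minus a product of two sample means. Off a rare event that product is of order `log n / n`. The
Berry-Esseen inequality and a Gaussian tail bound give the exponential term; moving the Gaussian
threshold by the product gives the `log n / √n` term with `K1`.

It remains to see that `S` and `N` behave. The triangle inequality in the empirical `L²` norm
compares `N` with the norm of the true scores (`abs_empNorm_scoreHat_sub_le`), and `scoreHat_bounds`
turns closeness of a few sample means into the required bounds. The squares of `x e` and of `x²`
have too few moments for Chebyshev's inequality, so their means are handled by truncation
(`measureReal_sampleMean_sq_le`). `MomentData.failure_le` adds up eight exceptional events, each
with error at most of order `log n / √n` apart from the exponential.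

This works once `√n` exceeds a combination of Lyapunov ratios. For smaller `n` the `1 / √n` term
alone makes the bound trivial, and if the signal is below `γ` the exponential term does. In
`failure_prob_le` these ratios are dominated by `K2`, the fourth moment ratio and four summands of
`G1`; of `G2` and `G3` only nonnegativity matters.

The Berry-Esseen constant comes from Stein's method and induction on the sample size
(`berryEsseen_normalized`): the indicator is smoothed to a ramp, and the concentration needed to
control the ramp is the inductive bound for one summand fewer. Rosenthal's inequality at exponent
four follows from expanding the fourth moment of a sum. Sure screening is then a squeeze, as the
signal of a relevant covariate grows like `√n`. -/

theorem stdPDF_eq (x : ℝ) :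
    gaussianPDFReal 0 1 x = (√(2 * Real.pi))⁻¹ * Real.exp (-(x ^ 2) / 2) := by
  simp [gaussianPDFReal]

theorem stdPDF_pos (x : ℝ) : 0 < gaussianPDFReal 0 1 x :=
  gaussianPDFReal_pos 0 1 x one_ne_zero

theorem stdPDF_neg (x : ℝ) : gaussianPDFReal 0 1 (-x) = gaussianPDFReal 0 1 x := by
  simp [stdPDF_eq]

theorem integrable_stdPDF : Integrable (gaussianPDFReal 0 1) := integrable_gaussianPDFReal 0 1

theorem integral_stdPDF : ∫ x, gaussianPDFReal 0 1 x = 1 :=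
  integral_gaussianPDFReal_eq_one 0 one_ne_zero

theorem stdPDF_le (x : ℝ) : gaussianPDFReal 0 1 x ≤ (√(2 * Real.pi))⁻¹ := by
  rw [stdPDF_eq]
  refine mul_le_of_le_one_right (by positivity) (Real.exp_le_one_iff.2 ?_)
  nlinarith [sq_nonneg x]

theorem hasDerivAt_stdPDF (x : ℝ) :
    HasDerivAt (gaussianPDFReal 0 1) (-x * gaussianPDFReal 0 1 x) x := by
  have h1 : HasDerivAt (fun x : ℝ => -(x ^ 2) / 2) (-x) x := by
    exact (((hasDerivAt_pow 2 x).neg).div_const 2).congr_deriv (by norm_num; ring)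
  have h2 := h1.exp.const_mul (√(2 * Real.pi))⁻¹
  have h3 : gaussianPDFReal 0 1 = fun x => (√(2 * Real.pi))⁻¹ * Real.exp (-(x ^ 2) / 2) :=
    funext stdPDF_eq
  rw [h3]
  exact h2.congr_deriv (by ring)

theorem continuous_stdPDF : Continuous (gaussianPDFReal 0 1) :=
  continuous_iff_continuousAt.2 fun x => (hasDerivAt_stdPDF x).continuousAt

theorem stdNormalCDF_eq (x : ℝ) :
    stdNormalCDF x = ∫ t in Set.Iic x, gaussianPDFReal 0 1 t := by
  rw [stdNormalCDF, cdf_eq_real, measureReal_def,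
    gaussianReal_apply_eq_integral 0 one_ne_zero, ENNReal.toReal_ofReal]
  exact integral_nonneg fun t => gaussianPDFReal_nonneg _ _ _

theorem one_sub_stdNormalCDF (x : ℝ) :
    1 - stdNormalCDF x = ∫ t in Set.Ioi x, gaussianPDFReal 0 1 t := by
  have := intervalIntegral.integral_Iic_add_Ioi (b := x) (f := gaussianPDFReal 0 1)
    (μ := volume) integrable_stdPDF.integrableOn integrable_stdPDF.integrableOn
  rw [integral_stdPDF, ← stdNormalCDF_eq] at this
  linarith

theorem stdNormalCDF_neg (x : ℝ) : stdNormalCDF (-x) = 1 - stdNormalCDF x := by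
  rw [one_sub_stdNormalCDF, stdNormalCDF_eq]
  have := integral_comp_neg_Iic (-x) (gaussianPDFReal 0 1)
  simpa [stdPDF_neg] using this

theorem stdNormalCDF_zero : stdNormalCDF 0 = 1 / 2 := by
  have := stdNormalCDF_neg 0
  rw [neg_zero] at this
  linarith

theorem stdNormalCDF_mono : Monotone stdNormalCDF := monotone_cdf _

theorem stdNormalCDF_sub_le {a b : ℝ} (hab : a ≤ b) :
    stdNormalCDF b - stdNormalCDF a ≤ (b - a) * (√(2 * Real.pi))⁻¹ := by
  rw [stdNormalCDF_eq, stdNormalCDF_eq, intervalIntegral.integral_Iic_sub_Iic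
    integrable_stdPDF.integrableOn integrable_stdPDF.integrableOn]
  have := intervalIntegral.integral_mono_on (μ := volume) hab
    integrable_stdPDF.intervalIntegrable
    (intervalIntegrable_const (c := (√(2 * Real.pi))⁻¹)) fun x _ => stdPDF_le x
  rwa [intervalIntegral.integral_const, smul_eq_mul] at this

theorem inv_sqrt_two_pi_le_one : (√(2 * Real.pi))⁻¹ ≤ 1 := by
  refine inv_le_one_of_one_le₀ (Real.one_le_sqrt.2 ?_)
  nlinarith [Real.pi_gt_three]

theorem sqrt_two_pi_le : √(2 * Real.pi) ≤ 4 := by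
  rw [Real.sqrt_le_left (by norm_num)]
  nlinarith [Real.pi_le_four]

theorem stdPDF_add_le {t v : ℝ} (ht : 0 ≤ t) (hv : 0 ≤ v) :
    gaussianPDFReal 0 1 (v + t) ≤ Real.exp (-(t ^ 2) / 2) * gaussianPDFReal 0 1 v := by
  rw [stdPDF_eq, stdPDF_eq, mul_left_comm, ← Real.exp_add]
  gcongr
  nlinarith [mul_nonneg ht hv]

/-- The Gaussian tail bound `1 - Φ t ≤ exp (-t² / 2) / 2`. -/
theorem one_sub_stdNormalCDF_le {t : ℝ} (ht : 0 ≤ t) :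
    1 - stdNormalCDF t ≤ Real.exp (-(t ^ 2) / 2) / 2 := by
  have h0 : ∫ v in Set.Ioi (0 : ℝ), gaussianPDFReal 0 1 v = 1 / 2 := by
    rw [← one_sub_stdNormalCDF, stdNormalCDF_zero]; norm_num
  have h1 : ∫ v in Set.Ioi (0 : ℝ), gaussianPDFReal 0 1 (v + t)
      = ∫ v in Set.Ioi t, gaussianPDFReal 0 1 v := by
    have := (measurePreserving_add_right volume t).setIntegral_preimage_emb
      (MeasurableEquiv.addRight t).measurableEmbedding (gaussianPDFReal 0 1) (Set.Ioi t)
    simpa using this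
  rw [one_sub_stdNormalCDF, ← h1]
  calc _ ≤ ∫ v in Set.Ioi (0 : ℝ), Real.exp (-(t ^ 2) / 2) * gaussianPDFReal 0 1 v := by
        refine setIntegral_mono_on (integrable_stdPDF.comp_add_right t).integrableOn
          (integrable_stdPDF.const_mul _).integrableOn measurableSet_Ioi fun v hv => ?_
        exact stdPDF_add_le ht (le_of_lt hv)
    _ = _ := by rw [integral_const_mul, h0]; ring

/-- The factor `1 / 2` of the tail bound is at most `2 / √(2π)` because `√(2π) ≤ 4`. This makes the
solution of Stein's equation bounded by `2`. -/
theorem one_sub_stdNormalCDF_le_mul_stdPDF {t : ℝ} (ht : 0 ≤ t) :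
    1 - stdNormalCDF t ≤ 2 * gaussianPDFReal 0 1 t := by
  refine (one_sub_stdNormalCDF_le ht).trans ?_
  rw [stdPDF_eq, ← mul_assoc, div_eq_mul_inv, mul_comm]
  refine mul_le_mul_of_nonneg_right ?_ (Real.exp_pos _).le
  have h : 4⁻¹ ≤ (√(2 * Real.pi))⁻¹ :=
    inv_anti₀ (Real.sqrt_pos.2 (by positivity)) sqrt_two_pi_le
  norm_num at h ⊢; linarith

theorem tendsto_stdPDF_atTop : Tendsto (gaussianPDFReal 0 1) atTop (𝓝 0) := by
  have h : Tendsto (fun x : ℝ => (√(2 * Real.pi))⁻¹ * Real.exp (-(x ^ 2) / 2)) atTop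
      (𝓝 ((√(2 * Real.pi))⁻¹ * 0)) := by
    refine Tendsto.const_mul _ (Real.tendsto_exp_atBot.comp ?_)
    simp_rw [neg_div]
    exact tendsto_neg_atTop_atBot.comp
      ((tendsto_pow_atTop two_ne_zero).atTop_div_const (by norm_num))
  rw [mul_zero] at h
  exact h.congr fun x => (stdPDF_eq x).symm

/-- Mills' bound: on `(t, ∞)` the factor `t` is at most the variable, and `x φ(x)` has primitive
`-φ`. -/
theorem mul_one_sub_stdNormalCDF_le {t : ℝ} (ht : 0 ≤ t) :
    t * (1 - stdNormalCDF t) ≤ gaussianPDFReal 0 1 t := by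
  have hd : ∀ x ∈ Set.Ici t, HasDerivAt (fun x => -gaussianPDFReal 0 1 x)
      (x * gaussianPDFReal 0 1 x) x := fun x _ =>
    (hasDerivAt_stdPDF x).neg.congr_deriv (by ring)
  have hl : Tendsto (fun x => -gaussianPDFReal 0 1 x) atTop (𝓝 0) := by
    simpa using tendsto_stdPDF_atTop.neg
  have hpos : ∀ x ∈ Set.Ioi t, 0 ≤ x * gaussianPDFReal 0 1 x := fun x hx =>
    mul_nonneg (ht.trans (le_of_lt hx)) (stdPDF_pos x).le
  have hi := integrableOn_Ioi_deriv_of_nonneg' hd hpos hl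
  have he := integral_Ioi_of_hasDerivAt_of_tendsto' hd hi hl
  rw [one_sub_stdNormalCDF, ← integral_const_mul]
  calc _ ≤ ∫ x in Set.Ioi t, x * gaussianPDFReal 0 1 x := by
        refine setIntegral_mono_on (integrable_stdPDF.const_mul _).integrableOn hi
          measurableSet_Ioi fun x hx => ?_
        exact mul_le_mul_of_nonneg_right (le_of_lt hx) (stdPDF_pos x).le
    _ = _ := by rw [he]; ring

theorem stdNormalQuantile_nonneg {u : ℝ} (hu : 1 / 2 < u) : 0 ≤ stdNormalQuantile u := by
  refine Real.sInf_nonneg fun x hx => ?_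
  by_contra! h
  have := stdNormalCDF_mono h.le
  rw [stdNormalCDF_zero] at this
  exact absurd (hx.out.trans this) (by linarith)

/-! Stein's equation -/

/-- The solution of Stein's equation `f' w - w f w = h w - m`. -/
noncomputable def steinSol (h : ℝ → ℝ) (m : ℝ) (w : ℝ) : ℝ :=
  (gaussianPDFReal 0 1 w)⁻¹ * ∫ t in Set.Iic w, (h t - m) * gaussianPDFReal 0 1 t

section Stein

variable {h : ℝ → ℝ} {m : ℝ}

theorem integrable_stein (hc : Continuous h) (hb : ∀ t, |h t - m| ≤ 1) :
    Integrable fun t => (h t - m) * gaussianPDFReal 0 1 t :=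
  integrable_stdPDF.bdd_mul (by fun_prop) (c := 1) (ae_of_all _ fun t => by simpa using hb t)

theorem hasDerivAt_steinSol (hc : Continuous h) (hb : ∀ t, |h t - m| ≤ 1) (w : ℝ) :
    HasDerivAt (steinSol h m) (w * steinSol h m w + (h w - m)) w := by
  have hi := integrable_stein hc hb
  have hcont : Continuous fun t => (h t - m) * gaussianPDFReal 0 1 t :=
    (hc.sub continuous_const).mul continuous_stdPDF
  have hF : HasDerivAt (fun w => ∫ t in Set.Iic w, (h t - m) * gaussianPDFReal 0 1 t)
      ((h w - m) * gaussianPDFReal 0 1 w) w := by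
    have h1 := intervalIntegral.integral_hasDerivAt_right (a := 0) (b := w)
      hi.intervalIntegrable (hcont.stronglyMeasurableAtFilter _ _) hcont.continuousAt
    have h2 := h1.add_const (∫ t in Set.Iic 0, (h t - m) * gaussianPDFReal 0 1 t)
    refine h2.congr_of_eventuallyEq (Eventually.of_forall fun x => ?_)
    have := intervalIntegral.integral_Iic_sub_Iic (a := 0) (b := x) hi.integrableOn
      hi.integrableOn
    simp only [← this]; ring
  have hG := (hasDerivAt_stdPDF w).inv (stdPDF_pos w).ne'
  refine (hG.mul hF).congr_deriv ?_
  have hp := (stdPDF_pos w).ne'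
  rw [steinSol, Pi.inv_apply]
  field_simp

/-- Since the full integral vanishes, the integral up to `w` is minus the one beyond `w`. Using
whichever side is the thin tail gives a bound that decays in both directions. -/
theorem abs_integral_stein_le (hc : Continuous h) (hb : ∀ t, |h t - m| ≤ 1)
    (hm : ∫ t, (h t - m) * gaussianPDFReal 0 1 t = 0) (w : ℝ) :
    |∫ t in Set.Iic w, (h t - m) * gaussianPDFReal 0 1 t| ≤ 1 - stdNormalCDF |w| := by
  have hi := integrable_stein hc hb
  have key : ∀ s : Set ℝ, |∫ t in s, (h t - m) * gaussianPDFReal 0 1 t|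
      ≤ ∫ t in s, gaussianPDFReal 0 1 t := fun s => by
    refine (abs_integral_le_integral_abs).trans (integral_mono hi.abs.integrableOn
      integrable_stdPDF.integrableOn fun t => ?_)
    simp only [abs_mul, abs_of_pos (stdPDF_pos t)]
    exact mul_le_of_le_one_left (stdPDF_pos t).le (hb t)
  rcases le_total 0 w with hw | hw
  · rw [abs_of_nonneg hw, one_sub_stdNormalCDF]
    have := intervalIntegral.integral_Iic_add_Ioi (b := w) hi.integrableOn hi.integrableOn
    rw [hm] at this
    rw [eq_neg_of_add_eq_zero_left this, abs_neg]
    exact key _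
  · rw [abs_of_nonpos hw, stdNormalCDF_neg, sub_sub_cancel, stdNormalCDF_eq]
    exact key _

theorem abs_steinSol_le (hc : Continuous h) (hb : ∀ t, |h t - m| ≤ 1)
    (hm : ∫ t, (h t - m) * gaussianPDFReal 0 1 t = 0) (w : ℝ) : |steinSol h m w| ≤ 2 := by
  have h1 := (abs_integral_stein_le hc hb hm w).trans
    (one_sub_stdNormalCDF_le_mul_stdPDF (abs_nonneg w))
  have h2 : gaussianPDFReal 0 1 |w| = gaussianPDFReal 0 1 w := by simp [stdPDF_eq]
  rw [h2] at h1
  rw [steinSol, abs_mul, abs_inv, abs_of_pos (stdPDF_pos w), inv_mul_le_iff₀ (stdPDF_pos w),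
    mul_comm]
  exact h1

theorem abs_mul_steinSol_le (hc : Continuous h) (hb : ∀ t, |h t - m| ≤ 1)
    (hm : ∫ t, (h t - m) * gaussianPDFReal 0 1 t = 0) (w : ℝ) : |w * steinSol h m w| ≤ 1 := by
  have h1 := (mul_le_mul_of_nonneg_left (abs_integral_stein_le hc hb hm w) (abs_nonneg w)).trans
    (mul_one_sub_stdNormalCDF_le (abs_nonneg w))
  have h2 : gaussianPDFReal 0 1 |w| = gaussianPDFReal 0 1 w := by simp [stdPDF_eq]
  rw [h2] at h1
  rw [steinSol, mul_left_comm, abs_mul, abs_inv, abs_of_pos (stdPDF_pos w),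
    inv_mul_le_iff₀ (stdPDF_pos w), mul_one, abs_mul]
  exact h1

end Stein

/-! The Berry-Esseen inequality -/

/-- The continuous function that is `1` up to `a`, `0` from `a + ε` on, and affine between. -/
noncomputable def ramp (a ε w : ℝ) : ℝ := max 0 (min 1 ((a + ε - w) / ε))

section Ramp

variable {a ε : ℝ}

theorem continuous_ramp : Continuous (ramp a ε) := by
  unfold ramp; fun_prop

theorem ramp_nonneg (w : ℝ) : 0 ≤ ramp a ε w := le_max_left _ _

theorem ramp_le_one (w : ℝ) : ramp a ε w ≤ 1 := max_le zero_le_one (min_le_left _ _)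

theorem ramp_of_le (hε : 0 < ε) {w : ℝ} (hw : w ≤ a) : ramp a ε w = 1 := by
  have : 1 ≤ (a + ε - w) / ε := by rw [le_div_iff₀ hε]; linarith
  simp [ramp, this]

theorem ramp_of_ge (hε : 0 < ε) {w : ℝ} (hw : a + ε ≤ w) : ramp a ε w = 0 := by
  have : (a + ε - w) / ε ≤ 0 := div_nonpos_of_nonpos_of_nonneg (by linarith) hε.le
  exact max_eq_left ((min_le_right _ _).trans this)

theorem abs_ramp_sub_le (hε : 0 < ε) (v w : ℝ) : |ramp a ε v - ramp a ε w| ≤ |v - w| / ε := by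
  have h1 : |min 1 ((a + ε - v) / ε) - min 1 ((a + ε - w) / ε)| ≤ |v - w| / ε := by
    refine (abs_min_sub_min_le_max _ _ _ _).trans ?_
    rw [← sub_div, abs_div, abs_of_pos hε, abs_sub_comm v w, sub_self, abs_zero]
    refine max_le (by positivity) (le_of_eq ?_)
    congr 2; ring
  refine (abs_max_sub_max_le_max _ _ _ _).trans (max_le ?_ h1)
  rw [sub_self, abs_zero]; positivity

theorem abs_ramp_sub_le_one (v w : ℝ) : |ramp a ε v - ramp a ε w| ≤ 1 := by
  rw [abs_le]
  constructor <;> linarith [ramp_nonneg (a := a) (ε := ε) v, ramp_nonneg (a := a) (ε := ε) w,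
    ramp_le_one (a := a) (ε := ε) v, ramp_le_one (a := a) (ε := ε) w]

/-- A bound for the oscillation of the ramp around `y` at distance at most `|s|`. -/
noncomputable def rampOsc (a ε s y : ℝ) : ℝ :=
  (Set.Ioc (a - 2 * |s|) (a + ε + |s|)).indicator (fun _ => min (|s| / ε) 1) y

theorem rampOsc_nonneg (hε : 0 < ε) (s y : ℝ) : 0 ≤ rampOsc a ε s y :=
  Set.indicator_nonneg (fun _ _ => by positivity) y

theorem rampOsc_le_one (hε : 0 < ε) (s y : ℝ) : rampOsc a ε s y ≤ 1 :=
  (Set.indicator_le_self' (fun _ _ => by positivity) y).trans (min_le_right _ _)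

/-- Outside the interval `y` and `y + u` lie on the same flat piece of the ramp. Inside, both the
Lipschitz and the trivial bound are kept: the Lipschitz bound alone would, after averaging, leave a
term in `|s| ^ 2` and hence a fourth moment. -/
theorem abs_ramp_add_sub_le (hε : 0 < ε) {s u : ℝ} (hu : |u| ≤ |s|) (y : ℝ) :
    |ramp a ε (y + u) - ramp a ε y| ≤ rampOsc a ε s y := by
  have hu' := abs_le.1 hu
  by_cases hy : y ∈ Set.Ioc (a - 2 * |s|) (a + ε + |s|)
  · rw [rampOsc, Set.indicator_of_mem hy]
    refine le_min ((abs_ramp_sub_le hε _ _).trans ?_) (abs_ramp_sub_le_one _ _)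
    rw [add_sub_cancel_left]
    gcongr
  · rw [rampOsc, Set.indicator_of_notMem hy]
    rw [Set.mem_Ioc, not_and_or, not_lt, not_le] at hy
    rcases hy with hy | hy
    · rw [ramp_of_le hε (by linarith [abs_nonneg s]), ramp_of_le hε (by linarith [abs_nonneg s])]
      simp
    · rw [ramp_of_ge hε (by linarith [abs_nonneg s]), ramp_of_ge hε (by linarith [abs_nonneg s])]
      simp

theorem measurable_rampOsc_comp {α : Type*} [MeasurableSpace α] {S Y : α → ℝ}
    (hS : Measurable S) (hY : Measurable Y) : Measurable fun p => rampOsc a ε (S p) (Y p) := by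
  have hset : MeasurableSet {p | a - 2 * |S p| < Y p ∧ Y p ≤ a + ε + |S p|} :=
    (measurableSet_lt (by fun_prop) hY).inter (measurableSet_le hY (by fun_prop))
  have := Measurable.indicator (f := fun p => min (|S p| / ε) 1) (by fun_prop) hset
  exact this

/-- The Gaussian mean of the ramp. -/
noncomputable def rampMean (a ε : ℝ) : ℝ := ∫ t, ramp a ε t * gaussianPDFReal 0 1 t

theorem integrable_ramp_mul : Integrable fun t => ramp a ε t * gaussianPDFReal 0 1 t :=
  integrable_stdPDF.bdd_mul continuous_ramp.aestronglyMeasurable (c := 1)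
    (ae_of_all _ fun t => by
      rw [Real.norm_eq_abs, abs_of_nonneg (ramp_nonneg t)]; exact ramp_le_one t)

theorem rampMean_le (hε : 0 < ε) : rampMean a ε ≤ stdNormalCDF (a + ε) := by
  rw [stdNormalCDF_eq, ← integral_indicator measurableSet_Iic]
  refine integral_mono integrable_ramp_mul (integrable_stdPDF.indicator measurableSet_Iic)
    fun t => ?_
  by_cases ht : t ≤ a + ε
  · rw [Set.indicator_of_mem (Set.mem_Iic.2 ht)]
    exact mul_le_of_le_one_left (stdPDF_pos t).le (ramp_le_one t)
  · rw [Set.indicator_of_notMem (by simpa using ht), ramp_of_ge hε (not_le.1 ht).le, zero_mul]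

theorem le_rampMean (hε : 0 < ε) : stdNormalCDF a ≤ rampMean a ε := by
  rw [stdNormalCDF_eq, ← integral_indicator measurableSet_Iic]
  refine integral_mono (integrable_stdPDF.indicator measurableSet_Iic) integrable_ramp_mul
    fun t => ?_
  by_cases ht : t ≤ a
  · rw [Set.indicator_of_mem (Set.mem_Iic.2 ht), ramp_of_le hε ht, one_mul]
  · rw [Set.indicator_of_notMem (by simpa using ht)]
    exact mul_nonneg (ramp_nonneg t) (stdPDF_pos t).le

theorem abs_ramp_sub_rampMean_le (hε : 0 < ε) (t : ℝ) : |ramp a ε t - rampMean a ε| ≤ 1 := by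
  have h1 : rampMean a ε ≤ 1 := (rampMean_le hε).trans (cdf_le_one _ _)
  have h0 : 0 ≤ rampMean a ε := (cdf_nonneg _ _).trans (le_rampMean hε)
  rw [abs_le]
  constructor <;> linarith [ramp_nonneg (a := a) (ε := ε) t, ramp_le_one (a := a) (ε := ε) t]

theorem integral_ramp_sub_rampMean :
    ∫ t, (ramp a ε t - rampMean a ε) * gaussianPDFReal 0 1 t = 0 := by
  simp_rw [sub_mul]
  rw [integral_sub integrable_ramp_mul (integrable_stdPDF.const_mul _), integral_const_mul,
    integral_stdPDF, rampMean]
  ring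

/-- The solution of Stein's equation for the ramp. -/
noncomputable def rampSol (a ε : ℝ) : ℝ → ℝ := steinSol (ramp a ε) (rampMean a ε)

/-- The derivative of the solution of Stein's equation for the ramp. -/
noncomputable def rampSolDeriv (a ε w : ℝ) : ℝ :=
  w * rampSol a ε w + (ramp a ε w - rampMean a ε)

theorem hasDerivAt_rampSol (hε : 0 < ε) (w : ℝ) :
    HasDerivAt (rampSol a ε) (rampSolDeriv a ε w) w :=
  hasDerivAt_steinSol continuous_ramp (abs_ramp_sub_rampMean_le hε) w

theorem abs_rampSol_le (hε : 0 < ε) (w : ℝ) : |rampSol a ε w| ≤ 2 :=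
  abs_steinSol_le continuous_ramp (abs_ramp_sub_rampMean_le hε) integral_ramp_sub_rampMean w

theorem abs_rampSolDeriv_le (hε : 0 < ε) (w : ℝ) : |rampSolDeriv a ε w| ≤ 2 := by
  have h1 := abs_mul_steinSol_le (h := ramp a ε) continuous_ramp (abs_ramp_sub_rampMean_le hε)
    integral_ramp_sub_rampMean w
  have h2 := abs_ramp_sub_rampMean_le (a := a) hε w
  exact (abs_add_le _ _).trans ((add_le_add h1 h2).trans (by norm_num))

theorem continuous_rampSol (hε : 0 < ε) : Continuous (rampSol a ε) :=
  continuous_iff_continuousAt.2 fun w => (hasDerivAt_rampSol hε w).continuousAt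

theorem continuous_rampSolDeriv (hε : 0 < ε) : Continuous (rampSolDeriv a ε) :=
  (continuous_id.mul (continuous_rampSol hε)).add (continuous_ramp.sub continuous_const)

theorem abs_rampSol_sub_le (hε : 0 < ε) (y u : ℝ) :
    |rampSol a ε (y + u) - rampSol a ε y| ≤ 2 * |u| := by
  have := convex_univ.norm_image_sub_le_of_norm_hasDerivWithin_le
    (fun x _ => (hasDerivAt_rampSol (a := a) hε x).hasDerivWithinAt)
    (fun x _ => abs_rampSolDeriv_le hε x) (Set.mem_univ y) (Set.mem_univ (y + u))
  simpa using this

/-- A bound for the oscillation of the derivative of the solution around `y`. -/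
noncomputable def solOsc (a ε s y : ℝ) : ℝ := 2 * |s| * (1 + |y|) + rampOsc a ε s y

theorem abs_rampSolDeriv_sub_le (hε : 0 < ε) {s u : ℝ} (hu : |u| ≤ |s|) (y : ℝ) :
    |rampSolDeriv a ε (y + u) - rampSolDeriv a ε y| ≤ solOsc a ε s y := by
  have h1 := abs_rampSol_sub_le (a := a) hε y u
  have h2 := abs_ramp_add_sub_le (a := a) hε hu y
  have h3 := abs_rampSol_le (a := a) hε (y + u)
  have e : rampSolDeriv a ε (y + u) - rampSolDeriv a ε y
      = u * rampSol a ε (y + u) + y * (rampSol a ε (y + u) - rampSol a ε y)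
        + (ramp a ε (y + u) - ramp a ε y) := by
    unfold rampSolDeriv; ring
  rw [e, solOsc]
  refine (abs_add_le _ _).trans (add_le_add ((abs_add_le _ _).trans ?_) h2)
  rw [abs_mul, abs_mul]
  have h4 : |u| * |rampSol a ε (y + u)| ≤ |s| * 2 := by gcongr
  have h5 : |y| * |rampSol a ε (y + u) - rampSol a ε y| ≤ |y| * (2 * |s|) := by
    gcongr; exact h1.trans (by gcongr)
  linarith

/-- Mean value inequality for `u ↦ f (y + u) - u f' y` between `0` and `s`; `solOsc` bounds its
derivative uniformly there. -/
theorem abs_rampSol_taylor_le (hε : 0 < ε) (s y : ℝ) :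
    |rampSol a ε (y + s) - rampSol a ε y - s * rampSolDeriv a ε y| ≤ |s| * solOsc a ε s y := by
  have hd : ∀ u ∈ Set.uIcc 0 s, HasDerivWithinAt
      (fun u => rampSol a ε (y + u) - u * rampSolDeriv a ε y)
      (rampSolDeriv a ε (y + u) - rampSolDeriv a ε y) (Set.uIcc 0 s) u := fun u _ => by
    have h1 : HasDerivAt (fun u => rampSol a ε (y + u)) (rampSolDeriv a ε (y + u)) u :=
      (hasDerivAt_rampSol hε (y + u)).comp_const_add y u
    have h2 := (hasDerivAt_id u).mul_const (rampSolDeriv a ε y)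
    exact ((h1.sub h2).congr_deriv (by rw [one_mul])).hasDerivWithinAt
  have := (convex_uIcc 0 s).norm_image_sub_le_of_norm_hasDerivWithin_le hd
    (C := solOsc a ε s y) (fun u hu => abs_rampSolDeriv_sub_le hε
      (by simpa using Set.abs_sub_left_of_mem_uIcc hu) y)
    Set.left_mem_uIcc Set.right_mem_uIcc
  simp only [Real.norm_eq_abs, add_zero, zero_mul, sub_zero] at this
  rw [mul_comm |s|, sub_right_comm]
  exact this

end Ramp

/-! ### One step of Stein's method under a concentration hypothesis. -/

section SteinStep

variable {ν μ : Measure ℝ} [IsProbabilityMeasure ν] [IsProbabilityMeasure μ] {a ε δ ρ η : ℝ}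

/-- The interval in `rampOsc` has length `3 |s| + ε`, so its mass is at most `6 |s| + 2 ε + 2 δ`.
The part proportional to `|s|` is paired with the bound `1` of the minimum and the rest with `|s| /
ε`, so the result is linear in `|s|`. -/
theorem integral_solOsc_le (hε : 0 < ε) (hδ : 0 ≤ δ) (hμ : Integrable (fun y => |y|) μ)
    (hμ1 : ∫ y, |y| ∂μ ≤ 1)
    (hconc : ∀ c d, c ≤ d → μ.real (Set.Ioc c d) ≤ 2 * (d - c) + 2 * δ) (s : ℝ) :
    ∫ y, solOsc a ε s y ∂μ ≤ |s| * (12 + 2 * δ / ε) := by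
  have h1 : ∫ y, rampOsc a ε s y ∂μ
      = μ.real (Set.Ioc (a - 2 * |s|) (a + ε + |s|)) * min (|s| / ε) 1 := by
    simp only [rampOsc]
    rw [integral_indicator measurableSet_Ioc, setIntegral_const, smul_eq_mul]
  have h2 := hconc (a - 2 * |s|) (a + ε + |s|) (by linarith [abs_nonneg s])
  have hr : Integrable (fun y => rampOsc a ε s y) μ :=
    (integrable_const (min (|s| / ε) 1)).indicator measurableSet_Ioc
  have h3 : ∫ y, solOsc a ε s y ∂μ
      = 2 * |s| * (1 + ∫ y, |y| ∂μ) + ∫ y, rampOsc a ε s y ∂μ := by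
    simp only [solOsc]
    have hμ' : Integrable (fun y : ℝ => 1 + |y|) μ := (integrable_const _).add hμ
    rw [integral_add (hμ'.const_mul _) hr, integral_const_mul,
      integral_add (integrable_const _) hμ]
    simp
  have h4 : (6 * |s| + 2 * ε + 2 * δ) * min (|s| / ε) 1 ≤ |s| * (8 + 2 * δ / ε) := by
    have a1 : |s| * min (|s| / ε) 1 ≤ |s| * 1 := by gcongr; exact min_le_right _ _
    have a2 : (2 * ε + 2 * δ) * min (|s| / ε) 1 ≤ (2 * ε + 2 * δ) * (|s| / ε) := by
      gcongr; exact min_le_left _ _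
    have a3 : (2 * ε + 2 * δ) * (|s| / ε) = |s| * (2 + 2 * δ / ε) := by field_simp
    nlinarith
  have h5 : μ.real (Set.Ioc (a - 2 * |s|) (a + ε + |s|)) * min (|s| / ε) 1
      ≤ (6 * |s| + 2 * ε + 2 * δ) * min (|s| / ε) 1 := by
    refine mul_le_mul_of_nonneg_right (h2.trans (by linarith)) (by positivity)
  have h6 : |s| * ∫ y, |y| ∂μ ≤ |s| * 1 := by gcongr
  rw [h3, h1]
  linarith

/-- The main estimate of Stein's method: a law `μ` is convolved with a small multiple of `ν`. -/
theorem abs_integral_stein_step_le (hε : 0 < ε) (hδ : 0 ≤ δ) (hη : 0 < η)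
    (hν2 : MemLp id 3 ν) (hν0 : ∫ x, x ∂ν = 0) (hν1 : ∫ x, x ^ 2 ∂ν = 1)
    (hρ : ∫ x, |x| ^ 3 ∂ν = ρ)
    (hμ : Integrable (fun y => |y|) μ) (hμ1 : ∫ y, |y| ∂μ ≤ 1)
    (hconc : ∀ c d, c ≤ d → μ.real (Set.Ioc c d) ≤ 2 * (d - c) + 2 * δ) :
    |∫ p, (rampSolDeriv a ε (p.2 + η * p.1) - η⁻¹ * (p.1 * rampSol a ε (p.2 + η * p.1)))
      ∂(ν.prod μ)| ≤ 2 * η * ρ * (12 + 2 * δ / ε) := by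
  have i1 : Integrable (fun x : ℝ => x) ν := hν2.integrable (by norm_num)
  have i2 : Integrable (fun x : ℝ => x ^ 2) ν :=
    (hν2.mono_exponent (by norm_num : (2 : ENNReal) ≤ 3)).integrable_sq
  have i3 : Integrable (fun x : ℝ => |x| ^ 3) ν := by
    simpa using hν2.integrable_norm_pow (p := 3) (by norm_num)
  have iD : Integrable (fun y => rampSolDeriv a ε y) μ :=
    Integrable.of_bound (continuous_rampSolDeriv hε).aestronglyMeasurable 2
      (ae_of_all _ fun y => abs_rampSolDeriv_le hε y)
  have iF : Integrable (fun y => rampSol a ε y) μ :=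
    Integrable.of_bound (continuous_rampSol hε).aestronglyMeasurable 2
      (ae_of_all _ fun y => abs_rampSol_le hε y)
  -- Two mean-zero counterterms, from unit variance, zero mean and independence. Subtracting them
  -- leaves an increment of `f'` and a first-order Taylor remainder of `f`, both small in `η`.
  have z1 : ∫ p, (1 - p.1 ^ 2) * rampSolDeriv a ε p.2 ∂(ν.prod μ) = 0 := by
    rw [integral_prod_mul (fun x : ℝ => 1 - x ^ 2), integral_sub (integrable_const _) i2, hν1]
    simp
  have z2 : ∫ p, p.1 * rampSol a ε p.2 ∂(ν.prod μ) = 0 := by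
    rw [integral_prod_mul (fun x : ℝ => x), hν0, zero_mul]
  have j1 : Integrable (fun p : ℝ × ℝ => (1 - p.1 ^ 2) * rampSolDeriv a ε p.2) (ν.prod μ) :=
    ((integrable_const 1).sub i2).mul_prod iD
  have j2 : Integrable (fun p : ℝ × ℝ => p.1 * rampSol a ε p.2) (ν.prod μ) := i1.mul_prod iF
  have cont1 : Continuous fun p : ℝ × ℝ => rampSol a ε (p.2 + η * p.1) :=
    (continuous_rampSol hε).comp (by fun_prop)
  have cont2 : Continuous fun p : ℝ × ℝ => rampSolDeriv a ε (p.2 + η * p.1) :=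
    (continuous_rampSolDeriv hε).comp (by fun_prop)
  have j3 : Integrable (fun p : ℝ × ℝ => p.1 * rampSol a ε (p.2 + η * p.1)) (ν.prod μ) := by
    have := i1.comp_fst μ
    exact this.mul_bdd (c := 2) cont1.aestronglyMeasurable
      (ae_of_all _ fun p => abs_rampSol_le hε _)
  have j4 : Integrable (fun p : ℝ × ℝ => rampSolDeriv a ε (p.2 + η * p.1)) (ν.prod μ) :=
    Integrable.of_bound cont2.aestronglyMeasurable 2
      (ae_of_all _ fun y => abs_rampSolDeriv_le hε _)
  have jO : Integrable (fun p : ℝ × ℝ => (1 + p.1 ^ 2) * solOsc a ε (η * p.1) p.2)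
      (ν.prod μ) := by
    have k1 : Integrable (fun p : ℝ × ℝ => (2 * η) * ((|p.1| + |p.1| ^ 3) * (1 + |p.2|)))
        (ν.prod μ) := ((i1.abs.add i3).mul_prod ((integrable_const 1).add hμ)).const_mul _
    have k2 : Integrable (fun p : ℝ × ℝ => (1 + p.1 ^ 2) * rampOsc a ε (η * p.1) p.2)
        (ν.prod μ) := by
      have k3 : Integrable (fun p : ℝ × ℝ => 1 + p.1 ^ 2) (ν.prod μ) :=
        ((integrable_const 1).add i2).comp_fst μ
      refine k3.mul_bdd (c := 1)
        (measurable_rampOsc_comp (by fun_prop) measurable_snd).aestronglyMeasurable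
        (ae_of_all _ fun p => ?_)
      rw [Real.norm_eq_abs, abs_of_nonneg (rampOsc_nonneg hε _ _)]
      exact rampOsc_le_one hε _ _
    refine (k1.add k2).congr (ae_of_all _ fun p => ?_)
    have e : |p.1| ^ 3 = |p.1| * p.1 ^ 2 := by rw [← sq_abs p.1]; ring
    simp only [solOsc, abs_mul, abs_of_pos hη, Pi.add_apply, e]
    ring
  have hsplit : ∫ p, (rampSolDeriv a ε (p.2 + η * p.1)
        - η⁻¹ * (p.1 * rampSol a ε (p.2 + η * p.1))) ∂(ν.prod μ)
      = ∫ p, (rampSolDeriv a ε (p.2 + η * p.1) - η⁻¹ * (p.1 * rampSol a ε (p.2 + η * p.1))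
        - ((1 - p.1 ^ 2) * rampSolDeriv a ε p.2 - η⁻¹ * (p.1 * rampSol a ε p.2)))
        ∂(ν.prod μ) := by
    have q1 : Integrable (fun p : ℝ × ℝ => rampSolDeriv a ε (p.2 + η * p.1)
        - η⁻¹ * (p.1 * rampSol a ε (p.2 + η * p.1))) (ν.prod μ) := j4.sub (j3.const_mul _)
    have q2 : Integrable (fun p : ℝ × ℝ => (1 - p.1 ^ 2) * rampSolDeriv a ε p.2
        - η⁻¹ * (p.1 * rampSol a ε p.2)) (ν.prod μ) := j1.sub (j2.const_mul _)
    rw [integral_sub q1 q2,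
      integral_sub j1 (j2.const_mul _), integral_const_mul, z1, z2]
    simp
  rw [hsplit]
  have hpt : ∀ p : ℝ × ℝ, |rampSolDeriv a ε (p.2 + η * p.1)
      - η⁻¹ * (p.1 * rampSol a ε (p.2 + η * p.1))
      - ((1 - p.1 ^ 2) * rampSolDeriv a ε p.2 - η⁻¹ * (p.1 * rampSol a ε p.2))|
      ≤ (1 + p.1 ^ 2) * solOsc a ε (η * p.1) p.2 := fun p => by
    have h1 := abs_rampSolDeriv_sub_le (a := a) hε (le_refl |η * p.1|) p.2
    have h2 := abs_rampSol_taylor_le (a := a) hε (η * p.1) p.2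
    have e : rampSolDeriv a ε (p.2 + η * p.1) - η⁻¹ * (p.1 * rampSol a ε (p.2 + η * p.1))
        - ((1 - p.1 ^ 2) * rampSolDeriv a ε p.2 - η⁻¹ * (p.1 * rampSol a ε p.2))
        = (rampSolDeriv a ε (p.2 + η * p.1) - rampSolDeriv a ε p.2)
          - η⁻¹ * p.1 * (rampSol a ε (p.2 + η * p.1) - rampSol a ε p.2
            - η * p.1 * rampSolDeriv a ε p.2) := by
      field_simp; ring
    rw [e]
    refine (abs_sub _ _).trans ?_
    rw [abs_mul]
    have h3 : |η⁻¹ * p.1| * (|η * p.1| * solOsc a ε (η * p.1) p.2)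
        = p.1 ^ 2 * solOsc a ε (η * p.1) p.2 := by
      rw [← mul_assoc, ← abs_mul]
      congr 1
      rw [show η⁻¹ * p.1 * (η * p.1) = p.1 ^ 2 by field_simp, abs_of_nonneg (sq_nonneg _)]
    have h4 := mul_le_mul_of_nonneg_left h2 (abs_nonneg (η⁻¹ * p.1))
    rw [h3] at h4
    linarith
  refine (abs_integral_le_integral_abs).trans ((integral_mono_of_nonneg
    (ae_of_all _ fun p => abs_nonneg _) jO (ae_of_all _ hpt)).trans ?_)
  rw [integral_prod _ jO]
  have hin : ∀ x : ℝ, ∫ y, (1 + x ^ 2) * solOsc a ε (η * x) y ∂μ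
      ≤ (|x| + |x| ^ 3) * (η * (12 + 2 * δ / ε)) := fun x => by
    rw [integral_const_mul]
    have := mul_le_mul_of_nonneg_left
      (integral_solOsc_le (a := a) hε hδ hμ hμ1 hconc (η * x)) (by positivity : 0 ≤ 1 + x ^ 2)
    refine this.trans (le_of_eq ?_)
    have e : |x| ^ 3 = |x| * x ^ 2 := by rw [← sq_abs x]; ring
    rw [abs_mul, abs_of_pos hη, e]
    ring
  refine (integral_mono jO.integral_prod_left ((i1.abs.add i3).mul_const _) hin).trans ?_
  rw [integral_mul_const]
  have e1 : ∫ x, (|x| + |x| ^ 3) ∂ν = (∫ x, |x| ∂ν) + ρ := by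
    rw [integral_add i1.abs i3, hρ]
  -- For `t = |x|`, `t ^ 3 + 1 - t ^ 2 - t = (t - 1) ^ 2 * (t + 1) ≥ 0`, and the second moment is
  -- one.
  have e2 : ∫ x, |x| ∂ν ≤ ρ := by
    have i4 : Integrable (fun x : ℝ => 1 - x ^ 2) ν := (integrable_const _).sub i2
    have h1 : ∫ x, |x| ∂ν ≤ ∫ x, (|x| ^ 3 + (1 - x ^ 2)) ∂ν := by
      refine integral_mono i1.abs (i3.add i4) fun x => ?_
      have := abs_nonneg x
      simp only
      rw [← sq_abs x]
      nlinarith [mul_nonneg this (sq_nonneg (|x| - 1)), sq_nonneg (|x| - 1)]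
    rw [integral_add i3 i4, hρ, integral_sub (integrable_const _) i2, hν1] at h1
    simpa using h1
  have e3 : 0 ≤ η * (12 + 2 * δ / ε) := by positivity
  change (∫ x, (|x| + |x| ^ 3) ∂ν) * _ ≤ _
  rw [e1]
  nlinarith [mul_le_mul_of_nonneg_right e2 e3]

end SteinStep

/-- The law of `η (z₁ + ⋯ + zₙ)` for i.i.d. `zᵢ` with law `ν`. -/
noncomputable def sumLaw (ν : Measure ℝ) (n : ℕ) (η : ℝ) : Measure ℝ :=
  (Measure.pi fun _ : Fin n => ν).map fun z => η * ∑ i, z i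

/-! ### Sums of independent copies and the induction for the Berry-Esseen bound. -/

section IID

theorem measureReal_scaledSum_Iic {ν : Measure ℝ} {n : ℕ} {η x : ℝ} :
    (sumLaw ν n η).real (Set.Iic x)
      = (Measure.pi fun _ : Fin n => ν).real {z | η * ∑ i, z i ≤ x} := by
  rw [sumLaw, map_measureReal_apply (by fun_prop) measurableSet_Iic]
  rfl

theorem measurePreserving_scaledSum (ν : Measure ℝ) (n : ℕ) (η : ℝ) :
    MeasurePreserving (fun z : Fin n → ℝ => η * ∑ i, z i) (Measure.pi fun _ => ν)
      (sumLaw ν n η) := ⟨by fun_prop, rfl⟩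

variable (ν : Measure ℝ) [IsProbabilityMeasure ν]

theorem measurable_scaledSum (n : ℕ) (η : ℝ) :
    Measurable fun z : Fin n → ℝ => η * ∑ i, z i := by fun_prop

instance (n : ℕ) (η : ℝ) : IsProbabilityMeasure (sumLaw ν n η) :=
  Measure.isProbabilityMeasure_map (measurable_scaledSum n η).aemeasurable

/-- The joint law of one summand and the scaled sum of the others is a product that does not depend
on `i`. Hence all summands contribute equally in Stein's identity. -/
theorem measurePreserving_split (n : ℕ) (η : ℝ) (i : Fin (n + 1)) :
    MeasurePreserving (fun z : Fin (n + 1) → ℝ => (z i, η * ∑ j, z (i.succAbove j)))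
      (Measure.pi fun _ => ν) (ν.prod (sumLaw ν n η)) :=
  ((MeasurePreserving.id ν).prod (measurePreserving_scaledSum ν n η)).comp
    (measurePreserving_piFinSuccAbove (fun _ => ν) i)

theorem integral_split (n : ℕ) (η : ℝ) (i : Fin (n + 1)) {F : ℝ × ℝ → ℝ}
    (hF : AEStronglyMeasurable F (ν.prod (sumLaw ν n η))) :
    ∫ z, F (z i, η * ∑ j, z (i.succAbove j)) ∂(Measure.pi fun _ : Fin (n + 1) => ν)
      = ∫ p, F p ∂(ν.prod (sumLaw ν n η)) := by
  have h := measurePreserving_split ν n η i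
  rw [← h.map_eq] at hF ⊢
  rw [integral_map h.measurable.aemeasurable hF]

variable {ν}

theorem memLp_coord {n : ℕ} {r : ENNReal} (h : MemLp id r ν) (i : Fin n) :
    MemLp (fun z : Fin n → ℝ => z i) r (Measure.pi fun _ => ν) :=
  h.comp_measurePreserving (measurePreserving_eval (fun _ => ν) i)

theorem memLp_coord_sum {n : ℕ} {r : ENNReal} (h : MemLp id r ν) :
    MemLp (fun z : Fin n → ℝ => ∑ i, z i) r (Measure.pi fun _ => ν) :=
  memLp_finsetSum _ fun i _ => memLp_coord h i

theorem integral_coord_sum {n : ℕ} (h : MemLp id 1 ν) (h0 : ∫ x, x ∂ν = 0) :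
    ∫ z, ∑ i, z i ∂(Measure.pi fun _ : Fin n => ν) = 0 := by
  rw [integral_finsetSum _ fun i _ => (memLp_coord h i).integrable le_rfl]
  refine Finset.sum_eq_zero fun i _ => ?_
  have := integral_comp_eval (μ := fun _ : Fin n => ν) (i := i) (f := fun x : ℝ => x)
    h.aestronglyMeasurable
  exact this.trans h0

theorem integral_coord_sum_sq {n : ℕ} (h : MemLp id 2 ν) (h0 : ∫ x, x ∂ν = 0) :
    ∫ z, (∑ i, z i) ^ 2 ∂(Measure.pi fun _ : Fin n => ν) = n * ∫ x, x ^ 2 ∂ν := by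
  have h1 := variance_sum_pi (ι := Fin n) (μ := fun _ => ν) (X := fun _ => id) fun _ => h
  have e : (∑ i : Fin n, fun z : Fin n → ℝ => id (z i)) = fun z => ∑ i, z i := by
    ext z; simp
  rw [e, variance_of_integral_eq_zero (memLp_coord_sum h).aestronglyMeasurable.aemeasurable
    (integral_coord_sum (h.mono_exponent (by norm_num)) h0),
    Finset.sum_const, variance_of_integral_eq_zero h.aestronglyMeasurable.aemeasurable h0] at h1
  simpa using h1

theorem one_le_integral_abs_cube (h : MemLp id 3 ν) (h1 : ∫ x, x ^ 2 ∂ν = 1) :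
    1 ≤ ∫ x, |x| ^ 3 ∂ν := by
  have i2 : Integrable (fun x : ℝ => x ^ 2) ν :=
    (h.mono_exponent (by norm_num : (2 : ENNReal) ≤ 3)).integrable_sq
  have i3 : Integrable (fun x : ℝ => |x| ^ 3) ν := by
    simpa using h.integrable_norm_pow (p := 3) (by norm_num)
  have i4 : Integrable (fun x : ℝ => 3 / 2 * x ^ 2 - 1 / 2) ν :=
    (i2.const_mul _).sub (integrable_const _)
  have : ∫ x, (3 / 2 * x ^ 2 - 1 / 2) ∂ν ≤ ∫ x, |x| ^ 3 ∂ν := by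
    refine integral_mono i4 i3 fun x => ?_
    have := abs_nonneg x
    simp only
    rw [← sq_abs x]
    nlinarith [mul_nonneg this (sq_nonneg (|x| - 1)), sq_nonneg (|x| - 1)]
  rw [integral_sub (i2.const_mul _) (integrable_const _), integral_const_mul, h1] at this
  norm_num at this
  linarith

theorem integrable_abs_sumLaw {n : ℕ} {η : ℝ} (h : MemLp id 2 ν) :
    Integrable (fun y => |y|) (sumLaw ν n η) := by
  refine Integrable.abs ?_
  have hs : Integrable (fun z : Fin n → ℝ => η * ∑ i, z i) (Measure.pi fun _ => ν) :=
    ((memLp_coord_sum h).integrable (by norm_num)).const_mul η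
  exact (integrable_map_measure aestronglyMeasurable_id
    (measurable_scaledSum n η).aemeasurable).2 hs

/-- Averages `|t| ≤ (1 + t ^ 2) / 2` over a law with second moment at most one. -/
theorem integral_abs_sumLaw_le {n : ℕ} {η : ℝ} (h : MemLp id 2 ν) (h0 : ∫ x, x ∂ν = 0)
    (h1 : ∫ x, x ^ 2 ∂ν = 1) (hη : n * η ^ 2 ≤ 1) :
    ∫ y, |y| ∂(sumLaw ν n η) ≤ 1 := by
  rw [sumLaw, integral_map (measurable_scaledSum n η).aemeasurable
    continuous_abs.aestronglyMeasurable]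
  have i1 : Integrable (fun z : Fin n → ℝ => |η * ∑ i, z i|) (Measure.pi fun _ => ν) :=
    (((memLp_coord_sum h).integrable (by norm_num)).const_mul η).abs
  have i2 : Integrable (fun z : Fin n → ℝ => (∑ i, z i) ^ 2) (Measure.pi fun _ => ν) :=
    (memLp_coord_sum h).integrable_sq
  have i3 : Integrable (fun z : Fin n → ℝ => 1 / 2 + η ^ 2 / 2 * (∑ i, z i) ^ 2)
    (Measure.pi fun _ => ν) := (integrable_const _).add (i2.const_mul _)
  have : ∫ z, |η * ∑ i, z i| ∂(Measure.pi fun _ : Fin n => ν)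
      ≤ ∫ z, (1 / 2 + η ^ 2 / 2 * (∑ i, z i) ^ 2) ∂(Measure.pi fun _ : Fin n => ν) := by
    refine integral_mono i1 i3 fun z => ?_
    have := sq_abs (η * ∑ i, z i)
    simp only
    nlinarith [sq_nonneg (|η * ∑ i, z i| - 1)]
  rw [integral_add (integrable_const _) (i2.const_mul _), integral_const_mul,
    integral_coord_sum_sq h h0, h1] at this
  rw [integral_const, probReal_univ, one_smul] at this
  linarith

/-- Stein's method for the normalized sum of `n + 1` variables. -/
theorem abs_integral_ramp_sub_le {n : ℕ} {a ε δ ρ η : ℝ} (hε : 0 < ε) (hδ : 0 ≤ δ) (hη : 0 < η)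
    (hηn : (n + 1 : ℝ) * η ^ 2 = 1)
    (hν2 : MemLp id 3 ν) (hν0 : ∫ x, x ∂ν = 0) (hν1 : ∫ x, x ^ 2 ∂ν = 1)
    (hρ : ∫ x, |x| ^ 3 ∂ν = ρ)
    (hconc : ∀ c d, c ≤ d → (sumLaw ν n η).real (Set.Ioc c d) ≤ 2 * (d - c) + 2 * δ) :
    |(∫ z, ramp a ε (η * ∑ i, z i) ∂(Measure.pi fun _ : Fin (n + 1) => ν)) - rampMean a ε|
      ≤ 2 * η * ρ * (12 + 2 * δ / ε) := by
  have h2 : MemLp id 2 ν := hν2.mono_exponent (by norm_num : (2 : ENNReal) ≤ 3)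
  have hstep := abs_integral_stein_step_le (a := a) (μ := sumLaw ν n η) hε hδ hη hν2 hν0 hν1 hρ
    (integrable_abs_sumLaw h2)
    (integral_abs_sumLaw_le h2 hν0 hν1 (by nlinarith [sq_nonneg η])) hconc
  have cont1 : Continuous fun p : ℝ × ℝ => rampSol a ε (p.2 + η * p.1) :=
    (continuous_rampSol hε).comp (by fun_prop)
  have cont2 : Continuous fun p : ℝ × ℝ => rampSolDeriv a ε (p.2 + η * p.1) :=
    (continuous_rampSolDeriv hε).comp (by fun_prop)
  have hsum : ∀ (z : Fin (n + 1) → ℝ) (i : Fin (n + 1)),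
      η * ∑ j, z (i.succAbove j) + η * z i = η * ∑ j, z j := fun z i => by
    rw [Fin.sum_univ_succAbove _ i]; ring
  have iS : Integrable (fun z : Fin (n + 1) → ℝ => rampSolDeriv a ε (η * ∑ i, z i))
      (Measure.pi fun _ => ν) :=
    Integrable.of_bound ((continuous_rampSolDeriv hε).comp (by fun_prop)).aestronglyMeasurable 2
      (ae_of_all _ fun y => abs_rampSolDeriv_le hε _)
  have iT : ∀ i, Integrable (fun z : Fin (n + 1) → ℝ => z i * rampSol a ε (η * ∑ i, z i))
      (Measure.pi fun _ => ν) := fun i =>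
    ((memLp_coord h2 i).integrable (by norm_num)).mul_bdd (c := 2)
      ((continuous_rampSol hε).comp (by fun_prop)).aestronglyMeasurable
      (ae_of_all _ fun y => abs_rampSol_le hε _)
  have e1 : ∫ z, rampSolDeriv a ε (η * ∑ i, z i) ∂(Measure.pi fun _ : Fin (n + 1) => ν)
      = ∫ p, rampSolDeriv a ε (p.2 + η * p.1) ∂(ν.prod (sumLaw ν n η)) := by
    rw [← integral_split ν n η 0 cont2.aestronglyMeasurable]
    simp only [hsum]
  have e2 : ∀ i, ∫ z, z i * rampSol a ε (η * ∑ i, z i) ∂(Measure.pi fun _ : Fin (n + 1) => ν)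
      = ∫ p, p.1 * rampSol a ε (p.2 + η * p.1) ∂(ν.prod (sumLaw ν n η)) := fun i => by
    have cont3 : Continuous fun p : ℝ × ℝ => p.1 * rampSol a ε (p.2 + η * p.1) :=
      continuous_fst.mul cont1
    rw [← integral_split ν n η i cont3.aestronglyMeasurable]
    simp only [hsum]
  have j4 : Integrable (fun p : ℝ × ℝ => rampSolDeriv a ε (p.2 + η * p.1))
      (ν.prod (sumLaw ν n η)) :=
    Integrable.of_bound cont2.aestronglyMeasurable 2
      (ae_of_all _ fun y => abs_rampSolDeriv_le hε _)
  have j3 : Integrable (fun p : ℝ × ℝ => p.1 * rampSol a ε (p.2 + η * p.1))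
      (ν.prod (sumLaw ν n η)) := by
    have i1 : Integrable (fun x : ℝ => x) ν := h2.integrable (by norm_num)
    exact (i1.comp_fst (sumLaw ν n η)).mul_bdd (c := 2) cont1.aestronglyMeasurable
      (ae_of_all _ fun p => abs_rampSol_le hε _)
  have iR : Integrable (fun z : Fin (n + 1) → ℝ => ramp a ε (η * ∑ i, z i))
      (Measure.pi fun _ => ν) :=
    Integrable.of_bound (continuous_ramp.comp (by fun_prop)).aestronglyMeasurable 1
      (ae_of_all _ fun y => by
        rw [Real.norm_eq_abs, abs_of_nonneg (ramp_nonneg _)]; exact ramp_le_one _)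
  have e3 : (∫ z, ramp a ε (η * ∑ i, z i) ∂(Measure.pi fun _ : Fin (n + 1) => ν))
        - rampMean a ε
      = ∫ z, (rampSolDeriv a ε (η * ∑ i, z i)
        - ∑ i, η * (z i * rampSol a ε (η * ∑ i, z i)))
        ∂(Measure.pi fun _ : Fin (n + 1) => ν) := by
    have : (∫ z, ramp a ε (η * ∑ i, z i) ∂(Measure.pi fun _ : Fin (n + 1) => ν))
        - rampMean a ε = ∫ z, (ramp a ε (η * ∑ i, z i) - rampMean a ε)
          ∂(Measure.pi fun _ : Fin (n + 1) => ν) := by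
      rw [integral_sub iR (integrable_const _)]; simp
    rw [this]
    congr with z
    rw [← Finset.mul_sum, ← Finset.sum_mul, rampSolDeriv]
    ring
  rw [e3, integral_sub iS (integrable_finsetSum _ fun i _ => (iT i).const_mul η), e1,
    integral_finsetSum _ fun i _ => (iT i).const_mul η]
  simp_rw [integral_const_mul, e2]
  rw [integral_sub j4 (j3.const_mul _), integral_const_mul] at hstep
  convert hstep using 3
  -- The normalization gives `(n + 1) * η = η⁻¹`, the coefficient in the one-step estimate.
  rw [Finset.sum_const, Finset.card_univ, Fintype.card_fin, nsmul_eq_mul, ← mul_assoc]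
  congr 1
  push_cast
  field_simp
  linarith

/-- The Berry-Esseen inequality for a law with variance one. -/
theorem berryEsseen_normalized (hν2 : MemLp id 3 ν) (hν0 : ∫ x, x ∂ν = 0)
    (hν1 : ∫ x, x ^ 2 ∂ν = 1) (n : ℕ) (x : ℝ) :
    |(sumLaw ν (n + 1) (√(n + 1 : ℝ))⁻¹).real (Set.Iic x) - stdNormalCDF x|
      ≤ 72 * (∫ x, |x| ^ 3 ∂ν) * (√(n + 1 : ℝ))⁻¹ := by
  set ρ := ∫ x, |x| ^ 3 ∂ν with hρ
  have hρ1 : 1 ≤ ρ := one_le_integral_abs_cube hν2 hν1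
  -- The level must be free: the hypothesis is used at the two rescaled endpoints of an arbitrary
  -- interval. The base case is trivial, since a difference of probabilities is at most `1 ≤ 72 ρ`.
  induction n generalizing x with
  | zero =>
    have h1 : (sumLaw ν (0 + 1) (√((0 : ℕ) + 1 : ℝ))⁻¹).real (Set.Iic x) ≤ 1 :=
      measureReal_le_one
    have h2 : 0 ≤ (sumLaw ν (0 + 1) (√((0 : ℕ) + 1 : ℝ))⁻¹).real (Set.Iic x) :=
      measureReal_nonneg
    have h3 : stdNormalCDF x ≤ 1 := cdf_le_one _ _
    have h4 : 0 ≤ stdNormalCDF x := cdf_nonneg _ _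
    refine (abs_le.2 ⟨by linarith, by linarith⟩ : _ ≤ (1 : ℝ)).trans ?_
    norm_num
    linarith
  | succ n ih =>
    push_cast
    have hn1 : (0 : ℝ) < n + 1 := by positivity
    have hn2 : (0 : ℝ) < n + 1 + 1 := by positivity
    set κ := (√(n + 1 : ℝ))⁻¹ with hκ
    set η := (√(n + 1 + 1 : ℝ))⁻¹ with hη
    have hκ0 : 0 < κ := by positivity
    have hη0 : 0 < η := by positivity
    have hκsq : κ ^ 2 = (n + 1 : ℝ)⁻¹ := by rw [hκ, inv_pow, Real.sq_sqrt hn1.le]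
    have hηsq : η ^ 2 = (n + 1 + 1 : ℝ)⁻¹ := by rw [hη, inv_pow, Real.sq_sqrt hn2.le]
    -- `κ² / η² = (n + 2) / (n + 1) ≤ 2 ≤ (3 / 2) ^ 2`. Rescaling from `κ` to `η` thus costs at most
    -- `3 / 2`, within the factor `2` allowed in the concentration bound.
    have hκη : κ ≤ 3 / 2 * η := by
      refine le_of_sq_le_sq ?_ (by positivity)
      rw [mul_pow, hκsq, hηsq, inv_le_iff_one_le_mul₀ hn1]
      have : (1 : ℝ) / 2 ≤ (n + 1 + 1 : ℝ)⁻¹ * (n + 1) := by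
        rw [inv_mul_eq_div, div_le_div_iff₀ (by norm_num) hn2]
        nlinarith [(Nat.cast_nonneg n : (0 : ℝ) ≤ n)]
      nlinarith
    have hδ : 0 ≤ 72 * ρ * κ := by positivity
    have hIic : ∀ c, (sumLaw ν (n + 1) η).real (Set.Iic c)
        = (sumLaw ν (n + 1) κ).real (Set.Iic (κ / η * c)) := fun c => by
      rw [measureReal_scaledSum_Iic, measureReal_scaledSum_Iic]
      congr 1
      ext z
      simp only [Set.mem_ofPred_eq]
      rw [div_mul_eq_mul_div, le_div_iff₀ hη0, mul_assoc, mul_le_mul_iff_right₀ hκ0,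
        mul_comm η]
    have hconc : ∀ c d, c ≤ d → (sumLaw ν (n + 1) η).real (Set.Ioc c d)
        ≤ 2 * (d - c) + 2 * (72 * ρ * κ) := fun c d hcd => by
      have e : (sumLaw ν (n + 1) η).real (Set.Ioc c d)
          = (sumLaw ν (n + 1) η).real (Set.Iic d) - (sumLaw ν (n + 1) η).real (Set.Iic c) := by
        have : Set.Ioc c d = Set.Iic d \ Set.Iic c := by ext t; simp [and_comm]
        rw [this, measureReal_sdiff (Set.Iic_subset_Iic.2 hcd) measurableSet_Iic]
      have hq : κ / η ≤ 3 / 2 := by rw [div_le_iff₀ hη0]; exact hκη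
      have hd := abs_le.1 (ih (κ / η * d))
      have hc := abs_le.1 (ih (κ / η * c))
      have hle : κ / η * c ≤ κ / η * d := by gcongr
      have hL := stdNormalCDF_sub_le hle
      have hL' : (κ / η * d - κ / η * c) * (√(2 * Real.pi))⁻¹ ≤ 3 / 2 * (d - c) * 1 := by
        have hdc := sub_nonneg.2 hcd
        rw [← mul_sub]
        exact mul_le_mul (mul_le_mul_of_nonneg_right hq hdc) inv_sqrt_two_pi_le_one
          (by positivity) (by positivity)
      rw [e, hIic, hIic]
      linarith [hd.2, hc.1]
    -- This width closes the induction: `2 δ / ε = 12 κ / η ≤ 18`, so the Stein error is `2 η ρ (12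
    -- + 18) = 60 η ρ`. Smoothing costs at most `ε = 12 η ρ`, and the total is again `72 η ρ`.
    set ε := 12 * η * ρ with hεdef
    have hε : 0 < ε := by positivity
    have hηn : ((n + 1 : ℕ) + 1 : ℝ) * η ^ 2 = 1 := by
      rw [hηsq]; push_cast; field_simp
    have hkey : ∀ a, |(∫ z, ramp a ε (η * ∑ i, z i)
        ∂(Measure.pi fun _ : Fin (n + 1 + 1) => ν)) - rampMean a ε| ≤ 60 * η * ρ := fun a => by
      refine (abs_integral_ramp_sub_le (a := a) hε hδ hη0 hηn hν2 hν0 hν1 hρ.symm hconc).trans ?_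
      have : 2 * (72 * ρ * κ) / ε ≤ 18 := by
        rw [div_le_iff₀ hε, hεdef]
        nlinarith [mul_le_mul_of_nonneg_left hκη (by positivity : 0 ≤ ρ)]
      calc 2 * η * ρ * (12 + 2 * (72 * ρ * κ) / ε) ≤ 2 * η * ρ * (12 + 18) := by gcongr
        _ = 60 * η * ρ := by ring
    have iR : ∀ a, Integrable (fun z : Fin (n + 1 + 1) → ℝ => ramp a ε (η * ∑ i, z i))
        (Measure.pi fun _ => ν) := fun a =>
      Integrable.of_bound (continuous_ramp.comp (by fun_prop)).aestronglyMeasurable 1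
        (ae_of_all _ fun y => by
          rw [Real.norm_eq_abs, abs_of_nonneg (ramp_nonneg _)]; exact ramp_le_one _)
    have hms : MeasurableSet {z : Fin (n + 1 + 1) → ℝ | η * ∑ i, z i ≤ x} :=
      measurableSet_le (measurable_scaledSum _ _) measurable_const
    have hprob : (sumLaw ν (n + 1 + 1) η).real (Set.Iic x)
        = ∫ z, {z : Fin (n + 1 + 1) → ℝ | η * ∑ i, z i ≤ x}.indicator (fun _ => (1 : ℝ)) z
          ∂(Measure.pi fun _ : Fin (n + 1 + 1) => ν) := by
      rw [measureReal_scaledSum_Iic, integral_indicator hms]; simp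
    have iI : Integrable ({z : Fin (n + 1 + 1) → ℝ | η * ∑ i, z i ≤ x}.indicator
        (fun _ => (1 : ℝ))) (Measure.pi fun _ : Fin (n + 1 + 1) => ν) :=
      (integrable_const _).indicator hms
    have hup : (sumLaw ν (n + 1 + 1) η).real (Set.Iic x)
        ≤ ∫ z, ramp x ε (η * ∑ i, z i) ∂(Measure.pi fun _ : Fin (n + 1 + 1) => ν) := by
      rw [hprob]
      refine integral_mono iI (iR x) fun z => ?_
      by_cases hz : η * ∑ i, z i ≤ x
      · rw [Set.indicator_of_mem (by exact hz)]; exact (ramp_of_le hε hz).ge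
      · rw [Set.indicator_of_notMem (by exact hz)]; exact ramp_nonneg _
    have hlo : (∫ z, ramp (x - ε) ε (η * ∑ i, z i) ∂(Measure.pi fun _ : Fin (n + 1 + 1) => ν))
        ≤ (sumLaw ν (n + 1 + 1) η).real (Set.Iic x) := by
      rw [hprob]
      refine integral_mono (iR _) iI fun z => ?_
      by_cases hz : η * ∑ i, z i ≤ x
      · rw [Set.indicator_of_mem (by exact hz)]; exact ramp_le_one _
      · rw [Set.indicator_of_notMem (by exact hz)]
        exact (ramp_of_ge hε (by linarith)).le
    have k1 := abs_le.1 (hkey x)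
    have k2 := abs_le.1 (hkey (x - ε))
    have m1 : rampMean x ε ≤ stdNormalCDF (x + ε) := rampMean_le hε
    have m2 : stdNormalCDF (x - ε) ≤ rampMean (x - ε) ε := le_rampMean hε
    have l1 := stdNormalCDF_sub_le (by linarith : x ≤ x + ε)
    have l2 := stdNormalCDF_sub_le (by linarith : x - ε ≤ x)
    have l3 : ε * (√(2 * Real.pi))⁻¹ ≤ ε * 1 := by gcongr; exact inv_sqrt_two_pi_le_one
    rw [add_sub_cancel_left] at l1
    rw [sub_sub_cancel] at l2
    rw [abs_le]
    constructor <;> linarith [k1.1, k1.2, k2.1, k2.2]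

end IID

theorem exists_berryEsseenInequality : ∃ c : ℝ, 0 < c ∧ BerryEsseenInequality c := by
  refine ⟨72, by norm_num, fun ν _ hν2 hν0 hvar n hn x => ?_⟩
  obtain ⟨n, rfl⟩ : ∃ m, n = m + 1 := ⟨n - 1, by omega⟩
  set s := sd ν id with hs
  have hs0 : 0 < s := Real.sqrt_pos.2 hvar
  have hmeas : Measurable fun x : ℝ => s⁻¹ * x := by fun_prop
  set ν' := ν.map fun x => s⁻¹ * x with hν'
  have hp : IsProbabilityMeasure ν' := Measure.isProbabilityMeasure_map hmeas.aemeasurable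
  have hmp : MeasurePreserving (fun x => s⁻¹ * x) ν ν' := ⟨hmeas, rfl⟩
  have g2 : MemLp id 3 ν' := by
    rw [hν', memLp_map_measure_iff aestronglyMeasurable_id hmeas.aemeasurable]
    exact hν2.const_mul s⁻¹
  have g0 : ∫ x, x ∂ν' = 0 := by
    rw [hν', integral_map hmeas.aemeasurable (by fun_prop), integral_const_mul, hν0,
      mul_zero]
  have hv : ∫ x, x ^ 2 ∂ν = s ^ 2 := by
    rw [hs, sd, Real.sq_sqrt hvar.le, variance_of_integral_eq_zero aemeasurable_id hν0]; rfl
  have g1 : ∫ x, x ^ 2 ∂ν' = 1 := by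
    rw [hν', integral_map hmeas.aemeasurable (by fun_prop)]
    simp_rw [mul_pow]
    rw [integral_const_mul, hv]
    field_simp
  have g3 : ∫ x, |x| ^ 3 ∂ν' = (∫ x, |x| ^ 3 ∂ν) / s ^ 3 := by
    rw [hν', integral_map hmeas.aemeasurable (by fun_prop)]
    simp_rw [abs_mul, mul_pow]
    rw [integral_const_mul, abs_of_pos (by positivity : 0 < s⁻¹)]
    field_simp
  have hpi := measurePreserving_pi (fun _ : Fin (n + 1) => ν) (fun _ => ν') fun _ => hmp
  have hset : MeasurableSet {z : Fin (n + 1) → ℝ | (√(n + 1 : ℝ))⁻¹ * ∑ i, z i ≤ x} :=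
    measurableSet_le (measurable_scaledSum _ _) measurable_const
  have hN : (0 : ℝ) < n + 1 := by positivity
  have e : (Measure.pi fun _ : Fin (n + 1) => ν).real
      {z | √((n + 1 : ℕ) : ℝ) * ((∑ i, z i) / ((n + 1 : ℕ) : ℝ)) / s ≤ x}
      = (sumLaw ν' (n + 1) (√(n + 1 : ℝ))⁻¹).real (Set.Iic x) := by
    rw [measureReal_scaledSum_Iic, ← hpi.measureReal_preimage hset.nullMeasurableSet]
    congr 1
    ext z
    simp only [Set.mem_ofPred_eq, Set.mem_preimage]
    rw [← Finset.mul_sum]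
    push_cast
    have : √(n + 1 : ℝ) * ((∑ i, z i) / (n + 1 : ℝ)) / s
        = (√(n + 1 : ℝ))⁻¹ * (s⁻¹ * ∑ i, z i) := by
      have h1 := Real.mul_self_sqrt hN.le
      have h2 := Real.sqrt_pos.2 hN
      field_simp
      rw [sq, h1]
    rw [this]
  rw [e]
  have := berryEsseen_normalized g2 g0 g1 n x
  rw [g3] at this
  refine this.trans (le_of_eq ?_)
  push_cast
  field_simp

/-! Rosenthal's inequality with exponent four -/

section FourthMoment

variable {ν : Measure ℝ} [IsProbabilityMeasure ν]

theorem integrable_pow_of_memLp_four {Ω : Type*} [MeasurableSpace Ω] {P : Measure Ω}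
    [IsFiniteMeasure P] {Z : Ω → ℝ} (h : MemLp Z 4 P) {k : ℕ} (hk : k ≤ 4) :
    Integrable (fun ω => Z ω ^ k) P := by
  have hk' : (k : ENNReal) ≤ 4 := by exact_mod_cast hk
  have := (h.mono_exponent hk').integrable_norm_pow'
  refine this.mono' (h.aestronglyMeasurable.pow k) (ae_of_all _ fun ω => ?_)
  rw [norm_pow]

theorem integral_add_pow_four {Ω : Type*} [MeasurableSpace Ω] {P : Measure Ω}
    [IsProbabilityMeasure P] {Z : Ω → ℝ} (hν : MemLp id 4 ν) (hν0 : ∫ x, x ∂ν = 0)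
    (hZ : MemLp Z 4 P) (hZ0 : ∫ ω, Z ω ∂P = 0) :
    ∫ p, (p.1 + Z p.2) ^ 4 ∂(ν.prod P)
      = (∫ x, x ^ 4 ∂ν) + 6 * ((∫ x, x ^ 2 ∂ν) * ∫ ω, Z ω ^ 2 ∂P) + ∫ ω, Z ω ^ 4 ∂P := by
  have ix : ∀ k ≤ 4, Integrable (fun x : ℝ => x ^ k) ν := fun k hk =>
    integrable_pow_of_memLp_four hν hk
  have iz : ∀ k ≤ 4, Integrable (fun ω => Z ω ^ k) P := fun k hk =>
    integrable_pow_of_memLp_four hZ hk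
  have ixz : ∀ k ≤ 4, ∀ l ≤ 4, Integrable (fun p : ℝ × Ω => p.1 ^ k * Z p.2 ^ l) (ν.prod P) :=
    fun k hk l hl => (ix k hk).mul_prod (iz l hl)
  have e : ∀ k l : ℕ, ∫ p, p.1 ^ k * Z p.2 ^ l ∂(ν.prod P)
      = (∫ x, x ^ k ∂ν) * ∫ ω, Z ω ^ l ∂P := fun k l =>
    integral_prod_mul (fun x : ℝ => x ^ k) fun ω => Z ω ^ l
  have hexp : ∀ p : ℝ × Ω, (p.1 + Z p.2) ^ 4 = p.1 ^ 4 * Z p.2 ^ 0 + 4 * (p.1 ^ 3 * Z p.2 ^ 1)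
      + 6 * (p.1 ^ 2 * Z p.2 ^ 2) + 4 * (p.1 ^ 1 * Z p.2 ^ 3) + p.1 ^ 0 * Z p.2 ^ 4 :=
    fun p => by ring
  simp_rw [hexp]
  have i40 := ixz 4 le_rfl 0 (by norm_num)
  have i31 := (ixz 3 (by norm_num) 1 (by norm_num)).const_mul 4
  have i22 := (ixz 2 (by norm_num) 2 (by norm_num)).const_mul 6
  have i13 := (ixz 1 (by norm_num) 3 (by norm_num)).const_mul 4
  have i04 := ixz 0 (by norm_num) 4 le_rfl
  rw [integral_add (((i40.fun_add i31).fun_add i22).fun_add i13) i04,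
    integral_add ((i40.fun_add i31).fun_add i22) i13, integral_add (i40.fun_add i31) i22,
    integral_add i40 i31, integral_const_mul, integral_const_mul, integral_const_mul]
  simp only [e]
  simp [hν0, hZ0]

/-- Adding one independent centered summand kills the odd cross terms and adds `6 n v²` for the
second moment `v`; the induction closes because `3 n² + 6 n ≤ 3 (n + 1)²`. -/
theorem integral_coord_sum_pow_four_le (hν : MemLp id 4 ν) (hν0 : ∫ x, x ∂ν = 0) (n : ℕ) :
    ∫ z, (∑ i, z i) ^ 4 ∂(Measure.pi fun _ : Fin n => ν)
      ≤ n * (∫ x, x ^ 4 ∂ν) + 3 * n ^ 2 * (∫ x, x ^ 2 ∂ν) ^ 2 := by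
  have h2 : MemLp id 2 ν := hν.mono_exponent (by norm_num)
  have h1 : MemLp id 1 ν := hν.mono_exponent (by norm_num)
  induction n with
  | zero => simp
  | succ n ih =>
    have hmp := measurePreserving_piFinSuccAbove (fun _ : Fin (n + 1) => ν) 0
    have e : ∫ z, (∑ i, z i) ^ 4 ∂(Measure.pi fun _ : Fin (n + 1) => ν)
        = ∫ p, (p.1 + ∑ i, p.2 i) ^ 4 ∂(ν.prod (Measure.pi fun _ : Fin n => ν)) := by
      rw [← hmp.integral_comp' fun p : ℝ × (Fin n → ℝ) => (p.1 + ∑ i, p.2 i) ^ 4]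
      congr with z
      rw [Fin.sum_univ_succAbove _ 0]
      rfl
    rw [e, integral_add_pow_four (Z := fun z : Fin n → ℝ => ∑ i, z i) hν hν0
      (memLp_coord_sum hν) (integral_coord_sum h1 hν0), integral_coord_sum_sq h2 hν0]
    push_cast
    nlinarith [sq_nonneg (∫ x, x ^ 2 ∂ν)]

end FourthMoment

theorem lnorm_nonneg {Ω : Type*} [MeasurableSpace Ω] (P : Measure Ω) (r : ℝ) (Z : Ω → ℝ) :
    0 ≤ lnorm P r Z :=
  Real.rpow_nonneg (integral_nonneg fun _ => Real.rpow_nonneg (abs_nonneg _) _) _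

/-- Powers of the norm with a natural exponent. -/
theorem lnorm_pow {Ω : Type*} [MeasurableSpace Ω] (P : Measure Ω) (k : ℕ) (hk : k ≠ 0)
    (Z : Ω → ℝ) : lnorm P k Z ^ k = ∫ ω, |Z ω| ^ k ∂P := by
  have : 0 ≤ ∫ ω, |Z ω| ^ (k : ℝ) ∂P :=
    integral_nonneg fun _ => Real.rpow_nonneg (abs_nonneg _) _
  rw [lnorm, one_div, Real.rpow_inv_natCast_pow this hk]
  simp_rw [Real.rpow_natCast]

/-- The two right-hand terms have fourth powers `16 v² / n²` and `256 m₄ / n³`, which dominate the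
fourth-moment bound; the fourth power of their sum is larger still. -/
theorem rosenthalInequality_four : RosenthalInequality 4 (1 * √4) (1 * 4) := by
  intro ν _ hν hν0 n hn
  have h4 : MemLp id 4 ν := by simpa using hν
  have hn0 : (0 : ℝ) < n := by exact_mod_cast hn
  set m4 := ∫ x, x ^ 4 ∂ν with hm4
  set v := ∫ x, x ^ 2 ∂ν with hv
  have hm40 : 0 ≤ m4 := integral_nonneg fun x => by positivity
  have hv0 : 0 ≤ v := integral_nonneg fun x => by positivity
  have hvar : Var[id; ν] = v := by
    rw [variance_of_integral_eq_zero aemeasurable_id hν0]; rfl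
  have hN : lnorm ν 4 id ^ 4 = m4 := by
    have := lnorm_pow ν 4 (by norm_num) id
    norm_num at this
    rw [this, hm4]
    simp [Even.pow_abs (show Even 4 by decide)]
  have hL : lnorm (Measure.pi fun _ : Fin n => ν) 4 (fun z => (∑ i, z i) / n) ^ 4
      ≤ m4 / n ^ 3 + 3 * v ^ 2 / n ^ 2 := by
    have := lnorm_pow (Measure.pi fun _ : Fin n => ν) 4 (by norm_num) fun z => (∑ i, z i) / n
    norm_num at this
    rw [this]
    simp_rw [Even.pow_abs (show Even 4 by decide), div_pow]
    rw [integral_div, div_le_iff₀ (by positivity)]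
    refine (integral_coord_sum_pow_four_le h4 hν0 n).trans (le_of_eq ?_)
    rw [← hm4, ← hv]
    field_simp
  rw [hvar]
  set u := 1 * √4 * √(v / n) with hu
  set w := 1 * 4 * (1 / (n : ℝ) ^ (((4 : ℝ) - 1) / 4)) * lnorm ν 4 id with hw
  have hu0 : 0 ≤ u := by positivity
  have hw0 : 0 ≤ w := mul_nonneg (by positivity) (lnorm_nonneg _ _ _)
  have hu4 : u ^ 4 = 16 * (v ^ 2 / n ^ 2) := by
    have e1 : √(v / n) ^ 4 = (v / n) ^ 2 := by
      rw [show 4 = 2 * 2 by norm_num, pow_mul, Real.sq_sqrt (by positivity)]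
    have e2 : √(4 : ℝ) ^ 4 = 16 := by
      rw [show 4 = 2 * 2 by norm_num, pow_mul, Real.sq_sqrt (by positivity)]; norm_num
    rw [hu, one_mul, mul_pow, e1, e2, div_pow]
  have hw4 : w ^ 4 = 256 * (m4 / n ^ 3) := by
    have e1 : ((n : ℝ) ^ (((4 : ℝ) - 1) / 4)) ^ 4 = n ^ 3 := by
      rw [← Real.rpow_natCast, ← Real.rpow_mul hn0.le]
      norm_num
    rw [hw, mul_pow, mul_pow, hN, div_pow, e1]
    ring
  refine le_of_pow_le_pow_left₀ four_ne_zero (by positivity) (hL.trans ?_)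
  have h5 : u ^ 4 + w ^ 4 ≤ (u + w) ^ 4 := by
    have : (u + w) ^ 4 = u ^ 4 + w ^ 4 + (4 * (u ^ 3 * w) + 6 * (u ^ 2 * w ^ 2)
      + 4 * (u * w ^ 3)) := by ring
    rw [this]
    linarith [show 0 ≤ 4 * (u ^ 3 * w) + 6 * (u ^ 2 * w ^ 2) + 4 * (u * w ^ 3) by positivity]
  refine le_trans ?_ h5
  rw [hu4, hw4]
  have a1 : 0 ≤ m4 / (n : ℝ) ^ 3 := by positivity
  have a2 : 0 ≤ v ^ 2 / (n : ℝ) ^ 2 := by positivity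
  rw [mul_div_assoc]
  linarith

/-! Deviation inequalities for sample means -/

section SampleMean

set_option linter.unusedSectionVars false

variable {Ω₀ Ω : Type*} [MeasurableSpace Ω₀] [MeasurableSpace Ω] {P₀ : Measure Ω₀}
  [IsProbabilityMeasure P₀] {P : Measure Ω} [IsProbabilityMeasure P] {n : ℕ}
  {W : Fin n → Ω → ℝ} {W₀ : Ω₀ → ℝ}

theorem sampleMean_eq (x : Fin n → ℝ) : sampleMean x = (n : ℝ)⁻¹ * ∑ i, x i := by
  rw [sampleMean, div_eq_inv_mul]

theorem integral_sampleMean (hn : 0 < n) (hD : ∀ i, IdentDistrib (W i) W₀ P P₀)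
    (h : Integrable W₀ P₀) :
    Integrable (fun ω => sampleMean fun i => W i ω) P ∧
      ∫ ω, sampleMean (fun i => W i ω) ∂P = ∫ ω, W₀ ω ∂P₀ := by
  have hi : ∀ i, Integrable (W i) P := fun i => (hD i).integrable_iff.2 h
  have hn' : (n : ℝ) ≠ 0 := by exact_mod_cast hn.ne'
  simp_rw [sampleMean]
  refine ⟨(integrable_finsetSum _ fun i _ => hi i).div_const _, ?_⟩
  rw [integral_div, integral_finsetSum _ fun i _ => hi i,
    Finset.sum_congr rfl fun i _ => (hD i).integral_eq]
  simp [hn']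

theorem variance_sampleMean (hn : 0 < n) (hI : iIndepFun W P)
    (hD : ∀ i, IdentDistrib (W i) W₀ P P₀) (h : MemLp W₀ 2 P₀) :
    MemLp (fun ω => sampleMean fun i => W i ω) 2 P ∧
      Var[fun ω => sampleMean fun i => W i ω; P] = Var[W₀; P₀] / n := by
  have hi : ∀ i, MemLp (W i) 2 P := fun i => (hD i).memLp_iff.2 h
  have hn' : (n : ℝ) ≠ 0 := by exact_mod_cast hn.ne'
  have e : (fun ω => sampleMean fun i => W i ω) = fun ω => (n : ℝ)⁻¹ * (∑ i, W i) ω := by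
    ext ω; rw [sampleMean_eq, Finset.sum_apply]
  rw [e]
  refine ⟨(memLp_finsetSum' _ fun i _ => hi i).const_mul _, ?_⟩
  rw [variance_const_mul, IndepFun.variance_sum (fun i _ => hi i)
    (fun i _ j _ hij => hI.indepFun hij), Finset.sum_congr rfl fun i _ => (hD i).variance_eq]
  simp only [Finset.sum_const, Finset.card_univ, Fintype.card_fin, nsmul_eq_mul]
  field_simp

/-- Chebyshev's inequality for a sample mean. -/
theorem measureReal_sampleMean_sub_ge_le (hn : 0 < n) (hI : iIndepFun W P)
    (hD : ∀ i, IdentDistrib (W i) W₀ P P₀) (h : MemLp W₀ 2 P₀) {a : ℝ} (ha : 0 < a) :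
    P.real {ω | a ≤ |sampleMean (fun i => W i ω) - ∫ ω, W₀ ω ∂P₀|} ≤ Var[W₀; P₀] / (n * a ^ 2) := by
  obtain ⟨h1, h2⟩ := variance_sampleMean hn hI hD h
  have h3 := (integral_sampleMean hn hD (h.integrable (by norm_num))).2
  have := meas_ge_le_variance_div_sq h1 ha
  rw [h3, h2] at this
  have := ENNReal.toReal_mono ENNReal.ofReal_ne_top this
  rw [ENNReal.toReal_ofReal (div_nonneg (div_nonneg (variance_nonneg _ _) n.cast_nonneg)
    (sq_nonneg a)), div_div] at this
  exact this

/-- Markov's inequality for a sample mean. -/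
theorem measureReal_sampleMean_ge_le (hn : 0 < n) (hD : ∀ i, IdentDistrib (W i) W₀ P P₀)
    (h : Integrable W₀ P₀) (hpos : ∀ i ω, 0 ≤ W i ω) {K : ℝ} (hK : 0 < K) :
    P.real {ω | K ≤ sampleMean fun i => W i ω} ≤ (∫ ω, W₀ ω ∂P₀) / K := by
  obtain ⟨h1, h2⟩ := integral_sampleMean hn hD h
  have h3 : ∀ ω, 0 ≤ sampleMean fun i => W i ω := fun ω =>
    div_nonneg (Finset.sum_nonneg fun i _ => hpos i ω) n.cast_nonneg
  have := mul_meas_ge_le_integral_of_nonneg (ae_of_all _ h3) h1 K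
  rw [h2] at this
  rw [le_div_iff₀ hK, mul_comm]
  exact this

/-- The Berry-Esseen inequality for a sample. -/
theorem berryEsseen_sampleMean {c : ℝ} (hc : BerryEsseenInequality c) (hn : 0 < n)
    (hI : iIndepFun W P) (hD : ∀ i, IdentDistrib (W i) W₀ P P₀) (h : MemLp W₀ 3 P₀)
    (h0 : ∫ ω, W₀ ω ∂P₀ = 0) (hv : 0 < Var[W₀; P₀]) (t : ℝ) :
    |P.real {ω | √n * sampleMean (fun i => W i ω) / sd P₀ W₀ ≤ t} - stdNormalCDF t|
      ≤ c * (∫ ω, |W₀ ω| ^ 3 ∂P₀) / (sd P₀ W₀ ^ 3 * √n) := by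
  have hm : AEMeasurable W₀ P₀ := h.aestronglyMeasurable.aemeasurable
  have hmi : ∀ i, AEMeasurable (W i) P := fun i => (hD i).aemeasurable_fst
  have hp : IsProbabilityMeasure (P₀.map W₀) := Measure.isProbabilityMeasure_map hm
  have e0 : ∫ z, z ∂(P₀.map W₀) = 0 := by rw [integral_map hm (by fun_prop), h0]
  have e1 : Var[id; P₀.map W₀] = Var[W₀; P₀] := by
    rw [variance_map aemeasurable_id hm]; rfl
  have e2 : sd (P₀.map W₀) id = sd P₀ W₀ := by rw [sd, sd, e1]
  have e3 : ∫ z, |z| ^ 3 ∂(P₀.map W₀) = ∫ ω, |W₀ ω| ^ 3 ∂P₀ := by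
    rw [integral_map hm (by fun_prop)]
  have e4 : MemLp id 3 (P₀.map W₀) := (memLp_map_measure_iff aestronglyMeasurable_id hm).2 h
  have key := hc (P₀.map W₀) e4 e0 (by rw [e1]; exact hv) n hn t
  rw [e2, e3] at key
  have hmap : P.map (fun ω i => W i ω) = Measure.pi fun _ : Fin n => P₀.map W₀ := by
    rw [(iIndepFun_iff_map_fun_eq_pi_map hmi).1 hI]
    congr 1
    ext1 i
    exact (hD i).map_eq
  rw [← hmap, map_measureReal_apply_of_aemeasurable (aemeasurable_pi_lambda _ hmi)
    (measurableSet_le (by fun_prop) measurable_const)] at key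
  exact key

/-- A two-sided tail bound for a sample mean. -/
theorem measureReal_abs_sampleMean_gt_le {c : ℝ} (hc : BerryEsseenInequality c) (hn : 0 < n)
    (hI : iIndepFun W P) (hD : ∀ i, IdentDistrib (W i) W₀ P P₀) (h : MemLp W₀ 3 P₀)
    (h0 : ∫ ω, W₀ ω ∂P₀ = 0) (hv : 0 < Var[W₀; P₀]) (t : ℝ) :
    P.real {ω | t < √n * |sampleMean fun i => W i ω| / sd P₀ W₀}
      ≤ 2 * (1 - stdNormalCDF t)
        + 2 * (c * (∫ ω, |W₀ ω| ^ 3 ∂P₀) / (sd P₀ W₀ ^ 3 * √n)) := by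
  have hs : 0 < sd P₀ W₀ := Real.sqrt_pos.2 hv
  have k1 := abs_le.1 (berryEsseen_sampleMean hc hn hI hD h h0 hv t)
  have k2 := abs_le.1 (berryEsseen_sampleMean hc hn hI hD h h0 hv (-t))
  rw [stdNormalCDF_neg] at k2
  set S := {ω | √n * sampleMean (fun i => W i ω) / sd P₀ W₀ ≤ t}
  set S' := {ω | √n * sampleMean (fun i => W i ω) / sd P₀ W₀ ≤ -t}
  have hmeas : AEMeasurable (fun ω => √n * sampleMean (fun i => W i ω) / sd P₀ W₀) P := by
    have := fun i => (hD i).aemeasurable_fst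
    unfold sampleMean
    fun_prop
  have hS : NullMeasurableSet S P := nullMeasurableSet_le hmeas aemeasurable_const
  have hsub : {ω | t < √n * |sampleMean fun i => W i ω| / sd P₀ W₀} ⊆ Sᶜ ∪ S' := by
    intro ω hω
    have hω : t < √n * |sampleMean fun i => W i ω| / sd P₀ W₀ := hω
    rcases le_total 0 (sampleMean fun i => W i ω) with hm | hm
    · rw [abs_of_nonneg hm] at hω
      exact Or.inl (not_le.2 hω)
    · rw [abs_of_nonpos hm, mul_neg, neg_div] at hω
      have : √n * sampleMean (fun i => W i ω) / sd P₀ W₀ ≤ -t := by linarith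
      exact Or.inr this
  have := (measureReal_mono (μ := P) hsub).trans (measureReal_union_le Sᶜ S')
  rw [probReal_compl_eq_one_sub₀ hS] at this
  linarith [k1.1, k2.2]

variable {V : Fin n → Ω → ℝ} {V₀ : Ω₀ → ℝ}

/-- A deviation inequality for the sample mean of squares, under a third moment. -/
theorem measureReal_sampleMean_sq_le (hn : 0 < n) (hI : iIndepFun V P)
    (hD : ∀ i, IdentDistrib (V i) V₀ P P₀) (h : MemLp V₀ 3 P₀) {w L a : ℝ} (hw : 0 < w)
    (hw2 : ∫ ω, V₀ ω ^ 2 ∂P₀ = w ^ 2) (hL : ∫ ω, |V₀ ω| ^ 3 ∂P₀ = L * w ^ 3) (ha : 0 < a) :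
    P.real {ω | ¬ ((1 - a - L / √n) * w ^ 2 ≤ sampleMean (fun i => V i ω ^ 2) ∧
        sampleMean (fun i => V i ω ^ 2) ≤ (1 + a) * w ^ 2)} ≤ (1 + 1 / a ^ 2) * (L / √n) := by
  have hn' : (0 : ℝ) < n := by exact_mod_cast hn
  set r := √(n : ℝ) with hr
  have hr0 : 0 < r := Real.sqrt_pos.2 hn'
  have hrn : r ^ 2 = n := Real.sq_sqrt hn'.le
  -- At the level `R = √n w` all errors are of order `L / √n`: truncation lowers the mean by at most
  -- `E|V|³ / R`, the truncated square has variance at most `R E|V|³`, and some `|Vᵢ|` reaches `R`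
  -- with probability at most `n E|V|³ / R³`. Truncation only lowers the mean, so the upper
  -- deviation has no `L / √n`.
  set R := r * w with hR
  have hR0 : 0 < R := by positivity
  let g : ℝ → ℝ := (Set.Icc (-R) R).indicator fun v => v ^ 2
  have hg : Measurable g := Measurable.indicator (by fun_prop) measurableSet_Icc
  have hg_in : ∀ v, |v| ≤ R → g v = v ^ 2 := fun v hv =>
    Set.indicator_of_mem (Set.mem_Icc.2 (abs_le.1 hv)) _
  have hg_out : ∀ v, ¬ |v| ≤ R → g v = 0 := fun v hv =>
    Set.indicator_of_notMem (fun hm => hv (abs_le.2 (Set.mem_Icc.1 hm))) _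
  have hgle : ∀ v, g v ≤ v ^ 2 := fun v =>
    Set.indicator_le_self' (fun _ _ => sq_nonneg v) v
  have hg0 : ∀ v, 0 ≤ g v := fun v => Set.indicator_nonneg (fun _ _ => sq_nonneg _) v
  have hgR : ∀ v, g v ≤ R ^ 2 := fun v => by
    by_cases hv : |v| ≤ R
    · rw [hg_in v hv, ← sq_abs]; gcongr
    · rw [hg_out v hv]; positivity
  have hDg : ∀ i, IdentDistrib (fun ω => g (V i ω)) (fun ω => g (V₀ ω)) P P₀ :=
    fun i => (hD i).comp hg
  have hIg : iIndepFun (fun i ω => g (V i ω)) P := hI.comp (fun _ => g) fun _ => hg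
  have hm : AEMeasurable V₀ P₀ := h.aestronglyMeasurable.aemeasurable
  have i3 : Integrable (fun ω => |V₀ ω| ^ 3) P₀ := by
    simpa using h.integrable_norm_pow (p := 3) (by norm_num)
  have i2 : Integrable (fun ω => V₀ ω ^ 2) P₀ :=
    (h.mono_exponent (by norm_num : (2 : ENNReal) ≤ 3)).integrable_sq
  have hgL : MemLp (fun ω => g (V₀ ω)) 2 P₀ :=
    MemLp.of_bound (hg.comp_aemeasurable hm).aestronglyMeasurable (R ^ 2)
      (ae_of_all _ fun ω => by rw [Real.norm_eq_abs, abs_of_nonneg (hg0 _)]; exact hgR _)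
  have ig : Integrable (fun ω => g (V₀ ω)) P₀ := hgL.integrable (by norm_num)
  -- the truncated mean
  have mean_le : ∫ ω, g (V₀ ω) ∂P₀ ≤ w ^ 2 := by
    rw [← hw2]; exact integral_mono ig i2 fun ω => hgle _
  have mean_ge : (1 - L / r) * w ^ 2 ≤ ∫ ω, g (V₀ ω) ∂P₀ := by
    have : ∫ ω, (V₀ ω ^ 2 - |V₀ ω| ^ 3 / R) ∂P₀ ≤ ∫ ω, g (V₀ ω) ∂P₀ := by
      refine integral_mono (i2.sub (i3.div_const _)) ig fun ω => ?_
      simp only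
      by_cases hv : |V₀ ω| ≤ R
      · rw [hg_in _ hv]
        have : 0 ≤ |V₀ ω| ^ 3 / R := by positivity
        linarith
      · rw [hg_out _ hv, sub_nonpos, le_div_iff₀ hR0, ← sq_abs, pow_succ _ 2]
        gcongr
        exact (not_le.1 hv).le
    rw [integral_sub i2 (i3.div_const _), integral_div, hw2, hL] at this
    refine le_trans (le_of_eq ?_) this
    rw [hR]; field_simp
  -- the truncated variance
  have var_le : Var[fun ω => g (V₀ ω); P₀] ≤ R * (L * w ^ 3) := by
    refine (variance_le_expectation_sq (hg.comp_aemeasurable hm).aestronglyMeasurable).trans ?_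
    rw [← hL, ← integral_const_mul]
    refine integral_mono_of_nonneg (ae_of_all _ fun ω => sq_nonneg _) (i3.const_mul _)
      (ae_of_all _ fun ω => ?_)
    change g (V₀ ω) ^ 2 ≤ R * |V₀ ω| ^ 3
    by_cases hv : |V₀ ω| ≤ R
    · rw [hg_in _ hv, ← sq_abs (V₀ ω), ← pow_mul, show 2 * 2 = 3 + 1 by norm_num, pow_succ,
        mul_comm]
      gcongr
    · rw [hg_out _ hv, zero_pow two_ne_zero]; positivity
  have cheb := measureReal_sampleMean_sub_ge_le hn hIg hDg hgL (a := a * w ^ 2) (by positivity)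
  have cheb' : Var[fun ω => g (V₀ ω); P₀] / (n * (a * w ^ 2) ^ 2) ≤ 1 / a ^ 2 * (L / r) := by
    rw [← hrn, div_le_iff₀ (by positivity)]
    refine var_le.trans (le_of_eq ?_)
    rw [hR]; field_simp
  -- exceedances
  have exc : ∀ i, P.real {ω | R ≤ |V i ω|} ≤ L / r / n := fun i => by
    have e : P.real {ω | R ≤ |V i ω|} = P₀.real {ω | R ≤ |V₀ ω|} := by
      have := (hD i).measure_mem_eq (s := {v | R ≤ |v|}) (measurableSet_le (by fun_prop)
        (by fun_prop))
      rw [measureReal_def, measureReal_def]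
      exact congrArg ENNReal.toReal this
    have hmk := mul_meas_ge_le_integral_of_nonneg (ae_of_all P₀ fun ω =>
      (by positivity : 0 ≤ |V₀ ω| ^ 3)) i3 (R ^ 3)
    have hset : {ω | R ^ 3 ≤ |V₀ ω| ^ 3} = {ω | R ≤ |V₀ ω|} := by
      ext ω
      exact pow_le_pow_iff_left₀ hR0.le (abs_nonneg _) (by norm_num)
    rw [hset, hL] at hmk
    rw [e, ← hrn, div_div, le_div_iff₀ (by positivity)]
    have e2 : R ^ 3 = r * r ^ 2 * w ^ 3 := by rw [hR]; ring
    rw [e2] at hmk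
    have hw3 : 0 < w ^ 3 := by positivity
    refine le_of_mul_le_mul_right ?_ hw3
    linarith
  have exc' : P.real (⋃ i, {ω | R ≤ |V i ω|}) ≤ L / r := by
    refine (measureReal_iUnion_fintype_le _).trans
      ((Finset.sum_le_sum fun i _ => exc i).trans (le_of_eq ?_))
    rw [Finset.sum_const, Finset.card_univ, Fintype.card_fin, nsmul_eq_mul]
    field_simp
  have hsub : {ω | ¬ ((1 - a - L / r) * w ^ 2 ≤ sampleMean (fun i => V i ω ^ 2) ∧
      sampleMean (fun i => V i ω ^ 2) ≤ (1 + a) * w ^ 2)}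
      ⊆ (⋃ i, {ω | R ≤ |V i ω|}) ∪
        {ω | a * w ^ 2 ≤ |sampleMean (fun i => g (V i ω)) - ∫ ω, g (V₀ ω) ∂P₀|} := by
    intro ω hω
    by_contra hcon
    rw [Set.mem_union, not_or, Set.mem_iUnion, not_exists] at hcon
    obtain ⟨h1, h2⟩ := hcon
    have h1 : ∀ i, |V i ω| ≤ R := fun i => (not_le.1 (h1 i)).le
    have h2 : ¬ a * w ^ 2 ≤ |sampleMean (fun i => g (V i ω)) - ∫ ω, g (V₀ ω) ∂P₀| := h2
    have h2 := abs_lt.1 (not_le.1 h2)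
    have e : (fun i => g (V i ω)) = fun i => V i ω ^ 2 := funext fun i => hg_in _ (h1 i)
    rw [e] at h2
    refine hω ⟨?_, ?_⟩ <;> linarith [h2.1, h2.2]
  refine (measureReal_mono hsub).trans ((measureReal_union_le _ _).trans ?_)
  linarith [cheb.trans cheb']

end SampleMean

/-! Deterministic estimates for the least squares fit -/

section Empirical

variable {n : ℕ}

/-- The empirical `L²` norm. -/
noncomputable def empNorm (a : Fin n → ℝ) : ℝ := √(sampleMean fun i => a i ^ 2)

theorem empNorm_eq (a : Fin n → ℝ) : empNorm a = ‖WithLp.toLp 2 a‖ / √n := by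
  rw [empNorm, sampleMean, Real.sqrt_div' _ n.cast_nonneg, EuclideanSpace.norm_eq]
  simp

theorem empNorm_nonneg (a : Fin n → ℝ) : 0 ≤ empNorm a := Real.sqrt_nonneg _

theorem empNorm_sq (a : Fin n → ℝ) : empNorm a ^ 2 = sampleMean fun i => a i ^ 2 :=
  Real.sq_sqrt (div_nonneg (Finset.sum_nonneg fun _ _ => sq_nonneg _) n.cast_nonneg)

theorem empNorm_add_le (a b : Fin n → ℝ) : empNorm (a + b) ≤ empNorm a + empNorm b := by
  rw [empNorm_eq, empNorm_eq, empNorm_eq, ← add_div, WithLp.toLp_add]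
  gcongr
  exact norm_add_le _ _

theorem empNorm_smul (c : ℝ) (a : Fin n → ℝ) : empNorm (c • a) = |c| * empNorm a := by
  rw [empNorm_eq, empNorm_eq, WithLp.toLp_smul, norm_smul, Real.norm_eq_abs, mul_div_assoc]

theorem sampleMean_const (hn : 0 < n) (c : ℝ) : sampleMean (fun _ : Fin n => c) = c := by
  have : (n : ℝ) ≠ 0 := by exact_mod_cast hn.ne'
  simp [sampleMean, this]

theorem sampleMean_add (a b : Fin n → ℝ) :
    sampleMean (fun i => a i + b i) = sampleMean a + sampleMean b := by
  simp [sampleMean, Finset.sum_add_distrib, add_div]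

theorem sampleMean_const_mul (c : ℝ) (a : Fin n → ℝ) :
    sampleMean (fun i => c * a i) = c * sampleMean a := by
  simp [sampleMean, ← Finset.mul_sum, mul_div_assoc]

theorem empNorm_const (hn : 0 < n) (c : ℝ) : empNorm (fun _ : Fin n => c) = |c| := by
  rw [empNorm, sampleMean_const hn, Real.sqrt_sq_eq_abs]

/-- The empirical covariance of two samples. -/
noncomputable def sampleCov (x e : Fin n → ℝ) : ℝ :=
  sampleMean fun i => (x i - sampleMean x) * (e i - sampleMean e)

theorem sampleCov_eq (hn : 0 < n) (x e : Fin n → ℝ) :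
    sampleCov x e = sampleMean (fun i => x i * e i) - sampleMean x * sampleMean e := by
  have h : (fun i => (x i - sampleMean x) * (e i - sampleMean e)) = fun i =>
      (x i * e i + (-sampleMean x) * e i) + ((-sampleMean e) * x i
        + sampleMean x * sampleMean e) := by ext i; ring
  rw [sampleCov, h, sampleMean_add (fun i => x i * e i + (-sampleMean x) * e i),
    sampleMean_add (fun i => x i * e i), sampleMean_add (fun i => -sampleMean e * x i),
    sampleMean_const_mul, sampleMean_const_mul, sampleMean_const hn]
  ring

theorem sum_eq_mul_sampleCov (hn : 0 < n) (x e : Fin n → ℝ) :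
    ∑ i, (x i - sampleMean x) * (e i - sampleMean e) = n * sampleCov x e := by
  have : (n : ℝ) ≠ 0 := by exact_mod_cast hn.ne'
  rw [sampleCov]
  conv_rhs => rw [sampleMean]
  rw [mul_div_cancel₀ _ this]

variable {x e : Fin n → ℝ} {a b τ : ℝ}

theorem sampleMean_linear (hn : 0 < n) :
    sampleMean (fun i => b + τ * x i + e i) = b + τ * sampleMean x + sampleMean e := by
  rw [sampleMean_add (fun i => b + τ * x i), sampleMean_add (fun _ => b), sampleMean_const hn,
    sampleMean_const_mul]

theorem sampleMean_shift (hn : 0 < n) :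
    sampleMean (fun i => a + x i) = a + sampleMean x := by
  rw [sampleMean_add (fun _ => a), sampleMean_const hn]

/-- The least squares slope in the model `Yᵢ = b + τ xᵢ + eᵢ`, `Xᵢ = a + xᵢ`. -/
theorem slopeHat_linear (hn : 0 < n) (hS : sampleCov x x ≠ 0) :
    slopeHat (fun i => a + x i) (fun i => b + τ * x i + e i)
      = τ + sampleCov x e / sampleCov x x := by
  have hn' : (n : ℝ) ≠ 0 := by exact_mod_cast hn.ne'
  have h1 : ∑ i, (a + x i - sampleMean fun i => a + x i) ^ 2 = n * sampleCov x x := by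
    rw [← sum_eq_mul_sampleCov hn, sampleMean_shift hn]
    exact Finset.sum_congr rfl fun i _ => by ring
  have h2 : ∑ i, (a + x i - sampleMean fun i => a + x i)
      * (b + τ * x i + e i - sampleMean fun i => b + τ * x i + e i)
      = n * (τ * sampleCov x x + sampleCov x e) := by
    rw [mul_add, mul_left_comm, ← sum_eq_mul_sampleCov hn, ← sum_eq_mul_sampleCov hn,
      sampleMean_shift hn, sampleMean_linear hn, Finset.mul_sum, ← Finset.sum_add_distrib]
    exact Finset.sum_congr rfl fun i _ => by ring
  rw [slopeHat, h1, h2]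
  field_simp

theorem residual_linear (hn : 0 < n) (hS : sampleCov x x ≠ 0) (i : Fin n) :
    residual (fun i => a + x i) (fun i => b + τ * x i + e i) i
      = (e i - sampleMean e) - sampleCov x e / sampleCov x x * (x i - sampleMean x) := by
  rw [residual, interceptHat, slopeHat_linear hn hS, sampleMean_shift hn, sampleMean_linear hn]
  ring

/-- The terms of the variance estimator. -/
noncomputable def scoreHat (x e : Fin n → ℝ) (i : Fin n) : ℝ :=
  (x i - sampleMean x)
    * ((e i - sampleMean e) - sampleCov x e / sampleCov x x * (x i - sampleMean x))

theorem vHat_linear (hn : 0 < n) (hS : sampleCov x x ≠ 0) :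
    vHat (fun i => a + x i) (fun i => b + τ * x i + e i)
      = empNorm (scoreHat x e) ^ 2 / sampleCov x x ^ 2 := by
  have hn' : (n : ℝ) ≠ 0 := by exact_mod_cast hn.ne'
  have h1 : ∑ i, (a + x i - (a + sampleMean x)) ^ 2 = n * sampleCov x x := by
    rw [← sum_eq_mul_sampleCov hn]
    exact Finset.sum_congr rfl fun i _ => by ring
  rw [vHat, empNorm_sq, sampleMean_shift hn, h1, mul_div_cancel_left₀ _ hn']
  congr 1
  conv_rhs => rw [sampleMean]
  congr 1
  refine Finset.sum_congr rfl fun i _ => ?_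
  rw [residual_linear hn hS, scoreHat]
  ring

/-- The difference between the estimated and the true scores. -/
theorem scoreHat_eq (x e : Fin n → ℝ) :
    scoreHat x e = (fun i => x i * e i) + ((-sampleMean x) • e + ((-sampleMean e) • x
      + ((fun _ => sampleMean x * sampleMean e)
        + (-(sampleCov x e / sampleCov x x)) • ((fun i => x i ^ 2)
          + ((-2 * sampleMean x) • x + fun _ => sampleMean x ^ 2))))) := by
  ext i
  simp only [scoreHat, Pi.add_apply, Pi.smul_apply, smul_eq_mul]
  ring

/-- The triangle inequality, in both directions, for the decomposition of the estimated score into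
the true score and a remainder. Every summand of the remainder has a factor that tends to zero: a
sample mean or the error of the slope. -/
theorem abs_empNorm_scoreHat_sub_le (hn : 0 < n) (x e : Fin n → ℝ) :
    |empNorm (scoreHat x e) - empNorm fun i => x i * e i|
      ≤ |sampleMean x| * empNorm e + |sampleMean e| * empNorm x
        + |sampleMean x * sampleMean e|
        + |sampleCov x e / sampleCov x x| * ((empNorm fun i => x i ^ 2)
          + 2 * |sampleMean x| * empNorm x + sampleMean x ^ 2) := by
  set R := (-sampleMean x) • e + ((-sampleMean e) • x
      + ((fun _ => sampleMean x * sampleMean e)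
        + (-(sampleCov x e / sampleCov x x)) • ((fun i => x i ^ 2)
          + ((-2 * sampleMean x) • x + fun _ => sampleMean x ^ 2)))) with hR
  have hs : scoreHat x e = (fun i => x i * e i) + R := scoreHat_eq x e
  have hs' : (fun i => x i * e i) = scoreHat x e + (-1 : ℝ) • R := by rw [hs]; simp
  have h1 : empNorm (scoreHat x e) ≤ (empNorm fun i => x i * e i) + empNorm R := by
    rw [hs]; exact empNorm_add_le _ _
  have h2 : (empNorm fun i => x i * e i) ≤ empNorm (scoreHat x e) + empNorm R := by
    rw [hs']
    refine (empNorm_add_le _ _).trans ?_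
    rw [empNorm_smul]; simp
  have h3 : empNorm R ≤ |sampleMean x| * empNorm e + (|sampleMean e| * empNorm x
        + (|sampleMean x * sampleMean e|
        + |sampleCov x e / sampleCov x x| * ((empNorm fun i => x i ^ 2)
          + (2 * |sampleMean x| * empNorm x + sampleMean x ^ 2)))) := by
    rw [hR]
    refine (empNorm_add_le _ _).trans (add_le_add (by rw [empNorm_smul, abs_neg]) ?_)
    refine (empNorm_add_le _ _).trans (add_le_add (by rw [empNorm_smul, abs_neg]) ?_)
    refine (empNorm_add_le _ _).trans (add_le_add (by rw [empNorm_const hn]) ?_)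
    rw [empNorm_smul, abs_neg]
    gcongr
    refine (empNorm_add_le _ _).trans (add_le_add le_rfl ?_)
    refine (empNorm_add_le _ _).trans (add_le_add ?_ ?_)
    · rw [empNorm_smul, abs_mul]; norm_num
    · rw [empNorm_const hn, abs_of_nonneg (sq_nonneg _)]
  rw [abs_le]
  constructor <;> linarith

theorem sq_le_of_mul_abs_div_le {r q σ X : ℝ} (hr : 0 < r) (hq : 0 ≤ q) (hσ : 0 < σ)
    (h : r * |X| / σ ≤ √q) : X ^ 2 ≤ σ ^ 2 * q / r ^ 2 := by
  have : r * |X| ≤ √q * σ := (div_le_iff₀ hσ).1 h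
  have h := pow_le_pow_left₀ (by positivity) this 2
  rw [mul_pow, mul_pow, Real.sq_sqrt hq, sq_abs] at h
  rw [le_div_iff₀ (by positivity)]
  linarith

/-- Here `r = √n`, `q = log n`, and `X`, `E` are the sample means of `x` and `e`. The constants are
`0.08 / 120 = 1 / 1500` and `16 / 1120 ≤ 0.12 ^ 2`. -/
theorem mean_bounds {r q σ s w X E : ℝ} (hr : 120 ≤ r) (hq0 : 0 < q) (hq1 : q ≤ 0.08 * r)
    (hq2 : q ^ 2 ≤ 16 * r) (hσ : 0 < σ) (hs : 0 < s) (hw : 0 < w)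
    (hD : 1120 * (σ ^ 2 * s ^ 2) ≤ w ^ 2 * r)
    (hX : X ^ 2 ≤ σ ^ 2 * q / r ^ 2) (hE : E ^ 2 ≤ s ^ 2 * q / r ^ 2) :
    X ^ 2 ≤ σ ^ 2 / 1500 ∧ |X| ≤ σ / 30 ∧ |X * E| ≤ q * (σ * s) / r ^ 2
      ∧ |X * E| ≤ 0.12 * w / r := by
  have hr0 : 0 < r := by linarith
  have hX2 : X ^ 2 ≤ σ ^ 2 / 1500 := by
    refine hX.trans ?_
    rw [div_le_div_iff₀ (by positivity) (by norm_num), mul_assoc]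
    refine mul_le_mul_of_nonneg_left ?_ (sq_nonneg σ)
    have : 120 * r ≤ r ^ 2 := by rw [sq]; gcongr
    linarith
  have hXE : |X * E| ≤ q * (σ * s) / r ^ 2 := by
    refine abs_le_of_sq_le_sq ?_ (by positivity)
    rw [mul_pow]
    refine (mul_le_mul hX hE (sq_nonneg _) (by positivity)).trans (le_of_eq ?_)
    field_simp
  refine ⟨hX2, abs_le_of_sq_le_sq ?_ (by positivity), hXE, hXE.trans ?_⟩
  · rw [div_pow]; linarith [sq_nonneg σ]
  · rw [div_le_div_iff₀ (by positivity) hr0]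
    have h : q * (σ * s) ≤ 0.12 * w * r := by
      refine le_of_sq_le_sq ?_ (by positivity)
      have a1 : q ^ 2 * (σ ^ 2 * s ^ 2) ≤ 16 * r * (w ^ 2 * r / 1120) := by
        gcongr; linarith
      have : 0 ≤ w ^ 2 * r ^ 2 := by positivity
      have e1 : (q * (σ * s)) ^ 2 = q ^ 2 * (σ ^ 2 * s ^ 2) := by ring
      have e2 : (0.12 * w * r) ^ 2 = 0.0144 * (w ^ 2 * r ^ 2) := by ring
      have e3 : 16 * r * (w ^ 2 * r / 1120) = 16 / 1120 * (w ^ 2 * r ^ 2) := by ring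
      rw [e1, e2]
      rw [e3] at a1
      linarith
    calc q * (σ * s) * r ≤ 0.12 * w * r * r := by gcongr
      _ = _ := by ring

/-- `a` and `b` are the empirical norms of `e` and `x`. The threshold for `a ^ 2` is the one that
makes the first product come out at `0.02 w`, as `0.0004 = 0.02 ^ 2`. -/
theorem cross_bounds {r q σ s w X E a b : ℝ} (hr : 0 < r) (hq0 : 0 < q) (hq1 : q ≤ 0.08 * r)
    (hσ : 0 < σ) (hw : 0 < w) (hD : 1120 * (σ ^ 2 * s ^ 2) ≤ w ^ 2 * r)
    (hX : X ^ 2 ≤ σ ^ 2 * q / r ^ 2) (hE : E ^ 2 ≤ s ^ 2 * q / r ^ 2)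
    (ha : a ^ 2 ≤ 0.0004 * r ^ 2 * w ^ 2 / (q * σ ^ 2)) (hb0 : 0 ≤ b) (hb : b ≤ 1.12 * σ) :
    |X| * a ≤ 0.02 * w ∧ |E| * b ≤ 0.01 * w := by
  constructor
  · refine le_of_sq_le_sq ?_ (by positivity)
    rw [mul_pow, sq_abs]
    refine (mul_le_mul hX ha (sq_nonneg _) (by positivity)).trans (le_of_eq ?_)
    field_simp
    norm_num
  · refine le_of_sq_le_sq ?_ (by positivity)
    rw [mul_pow, sq_abs]
    have a1 : b ^ 2 ≤ (1.12 * σ) ^ 2 := pow_le_pow_left₀ hb0 hb 2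
    refine (mul_le_mul hE a1 (sq_nonneg _) (by positivity)).trans ?_
    rw [div_mul_eq_mul_div, div_le_iff₀ (by positivity)]
    have a2 : s ^ 2 * q * (1.12 * σ) ^ 2 = 1.2544 * ((σ ^ 2 * s ^ 2) * q) := by ring
    have a3 : (σ ^ 2 * s ^ 2) * q ≤ (w ^ 2 * r / 1120) * (0.08 * r) := by
      gcongr; linarith
    have : 0 ≤ w ^ 2 * r ^ 2 := by positivity
    have e2 : (0.01 * w) ^ 2 * r ^ 2 = 0.0001 * (w ^ 2 * r ^ 2) := by ring
    have e3 : (w ^ 2 * r / 1120) * (0.08 * r) = 0.08 / 1120 * (w ^ 2 * r ^ 2) := by ring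
    rw [a2, e2]
    rw [e3] at a3
    linarith

/-- The covariance is needed small even after multiplication by `B`, because the slope error
multiplies the norm of `x²`, of order `B σ²`. Hence the threshold `w / (10 B)` for the mean of `x
e`; the product of means adds only `0.12 / 18`. -/
theorem mul_cov_bound {r w B A C Z : ℝ} (hr : 0 < r) (hw : 0 < w) (hB : 1 ≤ B)
    (hBr : 18 * B ≤ r) (hC : |C| ≤ |A| + |Z|) (hA : |A| < w / (10 * B))
    (hZ : |Z| ≤ 0.12 * w / r) : B * |C| ≤ 0.107 * w := by
  have hB0 : 0 < B := by linarith
  have a1 : B * |A| ≤ 0.1 * w := by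
    rw [lt_div_iff₀ (by positivity)] at hA; linarith
  have a2 : B * |Z| ≤ (r / 18) * (0.12 * w / r) := by
    gcongr; linarith
  have e : (r / 18) * (0.12 * w / r) = 0.12 / 18 * w := by field_simp
  rw [e] at a2
  have a3 : B * |C| ≤ B * |A| + B * |Z| := by
    rw [← mul_add]; gcongr
  linarith

/-- The contribution of the slope error. The bracket is at most `(1.225 + 2.24 / 30 + 1 / 1500) B σ²
≤ 1.31 B σ²`, and `0.107 * 1.31 / 0.74 ≤ 0.19`. -/
theorem remainder_bound {σ w B C S X N b : ℝ} (hσ : 0 < σ) (hw : 0 < w) (hB : 1 ≤ B)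
    (hS : 0.74 * σ ^ 2 ≤ S) (hC : B * |C| ≤ 0.107 * w) (hX2 : X ^ 2 ≤ σ ^ 2 / 1500)
    (hX : |X| ≤ σ / 30) (hN : N ≤ 1.225 * (B * σ ^ 2)) (hb0 : 0 ≤ b) (hb : b ≤ 1.12 * σ) :
    |C / S| * (N + 2 * |X| * b + X ^ 2) ≤ 0.19 * w := by
  have hS0 : 0 < S := lt_of_lt_of_le (by positivity) hS
  have hM : N + 2 * |X| * b + X ^ 2 ≤ 1.31 * (B * σ ^ 2) := by
    have a1 : |X| * b ≤ (σ / 30) * (1.12 * σ) := mul_le_mul hX hb hb0 (by positivity)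
    have a2 : σ ^ 2 ≤ B * σ ^ 2 := le_mul_of_one_le_left (sq_nonneg _) hB
    have e : (σ / 30) * (1.12 * σ) = 1.12 / 30 * σ ^ 2 := by ring
    rw [e] at a1
    linarith [sq_nonneg σ]
  rw [abs_div, abs_of_pos hS0, div_mul_eq_mul_div, div_le_iff₀ hS0]
  have a1 : |C| * (N + 2 * |X| * b + X ^ 2) ≤ |C| * (1.31 * (B * σ ^ 2)) := by gcongr
  have a2 : |C| * (1.31 * (B * σ ^ 2)) = 1.31 * ((B * |C|) * σ ^ 2) := by ring
  have a3 : (B * |C|) * σ ^ 2 ≤ (0.107 * w) * σ ^ 2 := by gcongr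
  have a4 : w * (0.74 * σ ^ 2) ≤ w * S := by gcongr
  have : 0 ≤ w * σ ^ 2 := by positivity
  linarith

/-- On the event described by the hypotheses, the empirical variances are close to the true ones. -/
theorem scoreHat_bounds (hn : 0 < n) {r q σ s w B L : ℝ} (hr : 120 ≤ r)
    (hq0 : 0 < q) (hq1 : q ≤ 0.08 * r) (hq2 : q ^ 2 ≤ 16 * r) (hσ : 0 < σ) (hs : 0 < s)
    (hw : 0 < w) (hB : 1 ≤ B) (hBr : 18 * B ≤ r) (hLr : 90 * L ≤ r)
    (hD : 1120 * (σ ^ 2 * s ^ 2) ≤ w ^ 2 * r)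
    (h1 : r * |sampleMean x| / σ ≤ √q) (h2 : r * |sampleMean e| / s ≤ √q)
    (h3 : (1 - 1 / 8 - L / r) * w ^ 2 ≤ sampleMean fun i => (x i * e i) ^ 2)
    (h3' : (sampleMean fun i => (x i * e i) ^ 2) ≤ (1 + 1 / 8) * w ^ 2)
    (h4 : (sampleMean fun i => (x i ^ 2) ^ 2) ≤ (1 + 1 / 2) * (B * σ ^ 2) ^ 2)
    (h5 : |(sampleMean fun i => x i ^ 2) - σ ^ 2| < σ ^ 2 / 4)
    (h6 : |sampleMean fun i => x i * e i| < w / (10 * B))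
    (h7 : (sampleMean fun i => e i ^ 2) < 0.0004 * r ^ 2 * w ^ 2 / (q * σ ^ 2)) :
    σ ^ 2 / 2 ≤ sampleCov x x ∧ 0 < empNorm (scoreHat x e) ∧
      empNorm (scoreHat x e) ≤ √2 * w ∧
      r * |sampleCov x e| / w
        ≤ r * |sampleMean fun i => x i * e i| / w + q * (σ * s) / (r * w) := by
  have hr0 : 0 < r := by linarith
  have hX := sq_le_of_mul_abs_div_le hr0 hq0.le hσ h1
  have hE := sq_le_of_mul_abs_div_le hr0 hq0.le hs h2
  obtain ⟨hX2, hXa, hXE, hXE2⟩ := mean_bounds hr hq0 hq1 hq2 hσ hs hw hD hX hE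
  have hx2 := abs_lt.1 h5
  have hσ2 : 0 < σ ^ 2 := by positivity
  have hw2 : 0 < w ^ 2 := by positivity
  have hS : 0.74 * σ ^ 2 ≤ sampleCov x x := by
    rw [sampleCov_eq hn]
    have : (fun i => x i * x i) = fun i => x i ^ 2 := by ext i; ring
    rw [this, ← sq]
    linarith [hx2.1]
  have hxn : empNorm x ≤ 1.12 * σ := by
    refine le_of_sq_le_sq ?_ (by positivity)
    rw [empNorm_sq, mul_pow]; linarith [hx2.2]
  obtain ⟨hb, hc⟩ := cross_bounds (a := empNorm e) hr0 hq0 hq1 hσ hw hD hX hE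
    (by rw [empNorm_sq]; exact h7.le) (empNorm_nonneg x) hxn
  have hd : |sampleMean x * sampleMean e| ≤ 0.001 * w := by
    refine hXE2.trans ?_
    rw [div_le_iff₀ hr0]
    have := mul_le_mul_of_nonneg_left hr hw.le
    linarith
  have hcov : |sampleCov x e|
      ≤ |sampleMean fun i => x i * e i| + |sampleMean x * sampleMean e| := by
    rw [sampleCov_eq hn]; exact abs_sub _ _
  have hBcov := mul_cov_bound hr0 hw hB hBr hcov h6 hXE2
  have hx4 : (empNorm fun i => x i ^ 2) ≤ 1.225 * (B * σ ^ 2) := by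
    refine le_of_sq_le_sq ?_ (by positivity)
    rw [empNorm_sq, mul_pow 1.225]
    refine h4.trans ?_
    gcongr
    norm_num
  have ht := remainder_bound hσ hw hB hS hBcov hX2 hXa hx4 (empNorm_nonneg x) hxn
  have hdiff := abs_le.1 (abs_empNorm_scoreHat_sub_le hn x e)
  have hup : (empNorm fun i => x i * e i) ≤ 1.07 * w := by
    refine le_of_sq_le_sq ?_ (by positivity)
    rw [empNorm_sq, mul_pow]; linarith
  have hlo : 0.9 * w ≤ empNorm fun i => x i * e i := by
    refine le_of_sq_le_sq ?_ (empNorm_nonneg _)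
    rw [empNorm_sq, mul_pow]
    have : L / r ≤ 1 / 90 := by rw [div_le_div_iff₀ hr0 (by norm_num)]; linarith
    linarith [mul_le_mul_of_nonneg_right this hw2.le]
  have hsqrt : 1.4 * w ≤ √(2 : ℝ) * w := by
    gcongr; exact Real.le_sqrt_of_sq_le (by norm_num)
  -- The four remainders add up to `0.02 + 0.01 + 0.001 + 0.19 = 0.221` times `w`. So the norm is at
  -- least `(0.9 - 0.221) w > 0` and at most `(1.07 + 0.221) w ≤ 1.4 w`. Positivity matters because
  -- a vanishing variance estimate counts as no selection.
  refine ⟨by linarith, by linarith [hdiff.1], by linarith [hdiff.2], ?_⟩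
  have a1 : r * |sampleMean x * sampleMean e| / w ≤ q * (σ * s) / (r * w) := by
    have : r * |sampleMean x * sampleMean e| / w ≤ r * (q * (σ * s) / r ^ 2) / w := by gcongr
    refine this.trans (le_of_eq ?_)
    field_simp
  calc r * |sampleCov x e| / w
      ≤ r * (|sampleMean fun i => x i * e i| + |sampleMean x * sampleMean e|) / w := by gcongr
    _ = r * |sampleMean fun i => x i * e i| / w + r * |sampleMean x * sampleMean e| / w := by
      ring
    _ ≤ _ := by linarith

/-- If the test statistic is small although the variance estimator is not large, then the
empirical covariance of `x` and `e` is large. -/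
theorem lt_of_statistic_lt (hn : 0 < n) {r σ w γ : ℝ} (hr : r = √n) (hσ : 0 < σ) (hw : 0 < w)
    (hγ : 0 ≤ γ) (hS : σ ^ 2 / 2 ≤ sampleCov x x) (h0 : 0 < empNorm (scoreHat x e))
    (h1 : empNorm (scoreHat x e) ≤ √2 * w)
    (hT : √n * |slopeHat (fun i => a + x i) (fun i => b + τ * x i + e i)|
      / √(vHat (fun i => a + x i) (fun i => b + τ * x i + e i)) < γ) :
    √2 * (r * σ ^ 2 * |τ| / (2 * √2 * w) - γ) < r * |sampleCov x e| / w := by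
  have hS0 : 0 < sampleCov x x := lt_of_lt_of_le (by positivity) hS
  have hr0 : 0 < r := by rw [hr]; exact Real.sqrt_pos.2 (by exact_mod_cast hn)
  have h2 : 0 < √(2 : ℝ) := Real.sqrt_pos.2 (by norm_num)
  -- After clearing denominators both sides carry the same factor `1 / sampleCov x x`. Only its
  -- lower bound in `|τ| * sampleCov x x` is used afterwards.
  rw [vHat_linear hn hS0.ne', slopeHat_linear hn hS0.ne', ← hr, ← div_pow,
    Real.sqrt_sq (by positivity), div_lt_iff₀ (by positivity)] at hT
  have e1 : τ + sampleCov x e / sampleCov x x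
      = (τ * sampleCov x x + sampleCov x e) / sampleCov x x := by field_simp
  rw [e1, abs_div, abs_of_pos hS0, ← mul_div_assoc, ← mul_div_assoc,
    div_lt_div_iff_of_pos_right hS0] at hT
  have h3 : |τ| * sampleCov x x - |sampleCov x e| ≤ |τ * sampleCov x x + sampleCov x e| := by
    have := abs_sub_abs_le_abs_sub (τ * sampleCov x x) (-sampleCov x e)
    rw [abs_mul, abs_of_pos hS0, abs_neg, sub_neg_eq_add] at this
    exact this
  have h4 : |τ| * (σ ^ 2 / 2) ≤ |τ| * sampleCov x x := by gcongr
  have h5 : γ * empNorm (scoreHat x e) ≤ γ * (√2 * w) := by gcongr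
  have h6 : r * (|τ| * (σ ^ 2 / 2) - |sampleCov x e|) < γ * (√2 * w) :=
    lt_of_le_of_lt (by gcongr; linarith) (hT.trans_le h5)
  rw [lt_div_iff₀ hw]
  have e2 : √2 * (r * σ ^ 2 * |τ| / (2 * √2 * w) - γ) * w
      = r * (|τ| * (σ ^ 2 / 2)) - γ * (√2 * w) := by field_simp
  rw [e2]
  linarith

end Empirical

/-! The error probability for a single covariate -/

/-- The tangent line of the logarithm at `128 = 2 ^ 7`, close to the endpoint `120`, where the
inequality is nearly tight. -/
theorem log_le_of_large {r : ℝ} (hr : 120 ≤ r) : 2 * Real.log r ≤ 0.08 * r := by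
  have h0 : 0 < r := by linarith
  have h1 := Real.log_le_sub_one_of_pos (by positivity : 0 < r / 128)
  have h2 : Real.log (r / 128) = Real.log r - 7 * Real.log 2 := by
    rw [Real.log_div h0.ne' (by norm_num), show (128 : ℝ) = 2 ^ 7 by norm_num, Real.log_pow]
    norm_num
  rw [h2] at h1
  linarith [Real.log_two_lt_d9]

theorem log_sq_le {r : ℝ} (hr : 1 ≤ r) : (2 * Real.log r) ^ 2 ≤ 16 * r := by
  have h0 : 0 < r := by linarith
  have h1 := Real.log_le_sub_one_of_pos (Real.sqrt_pos.2 h0)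
  rw [Real.log_sqrt h0.le] at h1
  have h2 : 0 ≤ Real.log r := Real.log_nonneg hr
  have h3 : 2 * Real.log r ≤ 4 * √r := by linarith
  calc (2 * Real.log r) ^ 2 ≤ (4 * √r) ^ 2 := by gcongr
    _ = 16 * r := by rw [mul_pow, Real.sq_sqrt h0.le]; norm_num

section Moments

variable {Ω₀ : Type*} [MeasurableSpace Ω₀] {P₀ : Measure Ω₀} [IsProbabilityMeasure P₀]

/-- Lyapunov's inequality between the second and the third moment. -/
theorem one_le_of_third_moment {V : Ω₀ → ℝ} (h : MemLp V 3 P₀) {w L : ℝ} (hw : 0 < w)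
    (hw2 : ∫ ω, V ω ^ 2 ∂P₀ = w ^ 2) (hL : ∫ ω, |V ω| ^ 3 ∂P₀ = L * w ^ 3) : 1 ≤ L := by
  have i2 : Integrable (fun ω => V ω ^ 2) P₀ :=
    (h.mono_exponent (by norm_num : (2 : ENNReal) ≤ 3)).integrable_sq
  have i3 : Integrable (fun ω => |V ω| ^ 3) P₀ := by
    simpa using h.integrable_norm_pow (p := 3) (by norm_num)
  have i4 : Integrable (fun ω => 3 / 2 * w * V ω ^ 2 - w ^ 3 / 2) P₀ :=
    (i2.const_mul _).sub (integrable_const _)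
  -- The tangent line of `t ↦ t ^ (3 / 2)` at `w ^ 2`, evaluated at `t = V ^ 2`.
  have : ∫ ω, (3 / 2 * w * V ω ^ 2 - w ^ 3 / 2) ∂P₀ ≤ ∫ ω, |V ω| ^ 3 ∂P₀ := by
    refine integral_mono i4 i3 fun ω => ?_
    have := abs_nonneg (V ω)
    simp only
    rw [← sq_abs (V ω)]
    nlinarith [mul_nonneg this (sq_nonneg (|V ω| - w)), mul_nonneg hw.le (sq_nonneg (|V ω| - w))]
  rw [integral_sub (i2.const_mul _) (integrable_const _), integral_const_mul, hw2, hL,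
    integral_const, probReal_univ, one_smul] at this
  have hw3 : 0 < w ^ 3 := by positivity
  refine le_of_mul_le_mul_right ?_ hw3
  linarith

theorem one_le_of_fourth_moment {V : Ω₀ → ℝ} (h : MemLp V 4 P₀) {σ B : ℝ} (hσ : 0 < σ)
    (hB0 : 0 ≤ B) (hσ2 : ∫ ω, V ω ^ 2 ∂P₀ = σ ^ 2)
    (hB : ∫ ω, V ω ^ 4 ∂P₀ = (B * σ ^ 2) ^ 2) : 1 ≤ B := by
  have i2 : Integrable (fun ω => V ω ^ 2) P₀ := integrable_pow_of_memLp_four h (by norm_num)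
  have i4 : Integrable (fun ω => V ω ^ 4) P₀ := integrable_pow_of_memLp_four h le_rfl
  have i : Integrable (fun ω => 2 * σ ^ 2 * V ω ^ 2 - σ ^ 4) P₀ :=
    (i2.const_mul _).sub (integrable_const _)
  have : ∫ ω, (2 * σ ^ 2 * V ω ^ 2 - σ ^ 4) ∂P₀ ≤ ∫ ω, V ω ^ 4 ∂P₀ :=
    integral_mono i i4 fun ω => by
      simp only
      linarith [sq_nonneg (V ω ^ 2 - σ ^ 2)]
  rw [integral_sub (i2.const_mul _) (integrable_const _), integral_const_mul, hσ2, hB,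
    integral_const, probReal_univ, one_smul] at this
  have h4 : 0 < σ ^ 4 := by positivity
  have : 1 ≤ B ^ 2 := by
    refine le_of_mul_le_mul_right ?_ h4
    linarith
  exact (one_le_sq_iff₀ hB0).1 this

end Moments

/-- The normalized moments of a centered pair `(x, e)`. -/
structure MomentData {Ω₀ : Type*} [MeasurableSpace Ω₀] (P₀ : Measure Ω₀) (x e : Ω₀ → ℝ)
    (σ s w B H L ρx ρe : ℝ) : Prop where
  memx : MemLp x 6 P₀
  meme : MemLp e 6 P₀
  meanx : ∫ ω, x ω ∂P₀ = 0
  meane : ∫ ω, e ω ∂P₀ = 0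
  meanxe : ∫ ω, x ω * e ω ∂P₀ = 0
  σ_pos : 0 < σ
  s_pos : 0 < s
  w_pos : 0 < w
  B_nonneg : 0 ≤ B
  sq_x : ∫ ω, x ω ^ 2 ∂P₀ = σ ^ 2
  sq_e : ∫ ω, e ω ^ 2 ∂P₀ = s ^ 2
  sq_xe : ∫ ω, (x ω * e ω) ^ 2 ∂P₀ = w ^ 2
  cube_xe : ∫ ω, |x ω * e ω| ^ 3 ∂P₀ = L * w ^ 3
  four_x : ∫ ω, x ω ^ 4 ∂P₀ = (B * σ ^ 2) ^ 2
  six_x : ∫ ω, |x ω ^ 2| ^ 3 ∂P₀ = H * (B * σ ^ 2) ^ 3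
  cube_x : ∫ ω, |x ω| ^ 3 ∂P₀ = ρx * σ ^ 3
  cube_e : ∫ ω, |e ω| ^ 3 ∂P₀ = ρe * s ^ 3

namespace MomentData

variable {Ω₀ Ω : Type*} [MeasurableSpace Ω₀] [MeasurableSpace Ω] {P₀ : Measure Ω₀}
  [IsProbabilityMeasure P₀] {P : Measure Ω} [IsProbabilityMeasure P] {n : ℕ}
  {x e : Ω₀ → ℝ} {σ s w B H L ρx ρe : ℝ} {xs es : Fin n → Ω → ℝ}

set_option linter.unusedSectionVars false

/-- Hölder with `1 / 6 + 1 / 6 = 1 / 3`. This is where moments of order six are spent. -/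
theorem memxe (h : MomentData P₀ x e σ s w B H L ρx ρe) : MemLp (fun ω => x ω * e ω) 3 P₀ :=
  h.meme.mul (r := 3) h.memx (hpqr := ⟨by
    rw [← two_mul, show (6 : ENNReal) = 2 * 3 by norm_num, ENNReal.mul_inv (by simp) (by simp),
      ← mul_assoc, ENNReal.mul_inv_cancel (by simp) (by simp), one_mul]⟩)

theorem memsq (h : MomentData P₀ x e σ s w B H L ρx ρe) : MemLp (fun ω => x ω ^ 2) 3 P₀ := by
  simp_rw [sq]
  exact h.memx.mul (r := 3) h.memx (hpqr := ⟨by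
    rw [← two_mul, show (6 : ENNReal) = 2 * 3 by norm_num, ENNReal.mul_inv (by simp) (by simp),
      ← mul_assoc, ENNReal.mul_inv_cancel (by simp) (by simp), one_mul]⟩)

theorem one_le_B (h : MomentData P₀ x e σ s w B H L ρx ρe) : 1 ≤ B :=
  one_le_of_fourth_moment (h.memx.mono_exponent (by norm_num)) h.σ_pos h.B_nonneg h.sq_x h.four_x

theorem one_le_L (h : MomentData P₀ x e σ s w B H L ρx ρe) : 1 ≤ L :=
  one_le_of_third_moment h.memxe h.w_pos h.sq_xe h.cube_xe

theorem one_le_ρx (h : MomentData P₀ x e σ s w B H L ρx ρe) : 1 ≤ ρx :=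
  one_le_of_third_moment (h.memx.mono_exponent (by norm_num)) h.σ_pos h.sq_x h.cube_x

theorem one_le_ρe (h : MomentData P₀ x e σ s w B H L ρx ρe) : 1 ≤ ρe :=
  one_le_of_third_moment (h.meme.mono_exponent (by norm_num)) h.s_pos h.sq_e h.cube_e

theorem sq_sq_x (h : MomentData P₀ x e σ s w B H L ρx ρe) :
    ∫ ω, (x ω ^ 2) ^ 2 ∂P₀ = (B * σ ^ 2) ^ 2 := by
  rw [← h.four_x]; congr with ω; ring

theorem one_le_H (h : MomentData P₀ x e σ s w B H L ρx ρe) : 1 ≤ H := by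
  have := h.σ_pos
  have := h.one_le_B
  exact one_le_of_third_moment h.memsq (by positivity) h.sq_sq_x h.six_x

theorem sd_eq {Z : Ω₀ → ℝ} {v : ℝ} (hZ : AEMeasurable Z P₀) (h0 : ∫ ω, Z ω ∂P₀ = 0)
    (hv : 0 < v) (h2 : ∫ ω, Z ω ^ 2 ∂P₀ = v ^ 2) : Var[Z; P₀] = v ^ 2 ∧ sd P₀ Z = v := by
  have : Var[Z; P₀] = v ^ 2 := by rw [variance_of_integral_eq_zero hZ h0, h2]
  exact ⟨this, by rw [sd, this, Real.sqrt_sq hv.le]⟩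

/-- A tail bound in terms of normalized moments. -/
theorem tail_le {c : ℝ} (hc : BerryEsseenInequality c) (hn : 0 < n) {W : Fin n → Ω → ℝ}
    {W₀ : Ω₀ → ℝ} (hI : iIndepFun W P) (hD : ∀ i, IdentDistrib (W i) W₀ P P₀)
    (h : MemLp W₀ 3 P₀) (h0 : ∫ ω, W₀ ω ∂P₀ = 0) {v ρ : ℝ} (hv : 0 < v)
    (h2 : ∫ ω, W₀ ω ^ 2 ∂P₀ = v ^ 2) (h3 : ∫ ω, |W₀ ω| ^ 3 ∂P₀ = ρ * v ^ 3) (t : ℝ) :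
    P.real {ω | t < √n * |sampleMean fun i => W i ω| / v}
      ≤ 2 * (1 - stdNormalCDF t) + 2 * c * ρ / √n := by
  obtain ⟨e1, e2⟩ := sd_eq h.aestronglyMeasurable.aemeasurable h0 hv h2
  have := measureReal_abs_sampleMean_gt_le hc hn hI hD h h0 (by rw [e1]; positivity) t
  rw [e2, h3] at this
  refine this.trans (le_of_eq ?_)
  field_simp

/-- With `r = √n` the threshold is `√(log n)`, just high enough for the Gaussian tail to be absorbed
in the `1 / √n` error. -/
theorem two_mul_one_sub_stdNormalCDF_sqrt_log {r : ℝ} (hr : 1 ≤ r) :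
    2 * (1 - stdNormalCDF √(2 * Real.log r)) ≤ 1 / r := by
  have h0 : 0 ≤ 2 * Real.log r := by have := Real.log_nonneg hr; linarith
  have h := one_sub_stdNormalCDF_le (Real.sqrt_nonneg (2 * Real.log r))
  rw [Real.sq_sqrt h0, show -(2 * Real.log r) / 2 = -Real.log r by ring, Real.exp_neg,
    Real.exp_log (by linarith)] at h
  rw [one_div]; linarith

/-- The tail bound shifted by a small `δ`. -/
theorem two_mul_one_sub_stdNormalCDF_sub_le {u δ : ℝ} (hu : 0 ≤ u) (hδ : 0 ≤ δ) :
    2 * (1 - stdNormalCDF (u - δ)) ≤ Real.exp (-(u ^ 2) / 2) + 2 * (δ * (√(2 * Real.pi))⁻¹) := by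
  have h1 := one_sub_stdNormalCDF_le hu
  have h2 := stdNormalCDF_sub_le (by linarith : u - δ ≤ u)
  rw [sub_sub_cancel] at h2
  linarith

/-- The probability that a relevant covariate is not selected, for large samples. -/
theorem failure_le (h : MomentData P₀ x e σ s w B H L ρx ρe) {c : ℝ} (hc0 : 0 < c)
    (hc : BerryEsseenInequality c) (hn : 0 < n)
    (hI : iIndepFun (fun i ω => (xs i ω, es i ω)) P)
    (hD : ∀ i, IdentDistrib (fun ω => (xs i ω, es i ω)) (fun ω => (x ω, e ω)) P P₀)
    {a b τ γ S : ℝ} (hγ : 0 ≤ γ) (hS : S = √n * σ ^ 2 * |τ| / (2 * √2 * w)) (hγS : γ ≤ S)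
    (hlarge : 4 + 90 * L + 18 * B + 1120 * (σ ^ 2 * s ^ 2 / w ^ 2) + 8 * H ≤ √n) :
    P.real {ω | √n * |slopeHat (fun i => a + xs i ω) (fun i => b + τ * xs i ω + es i ω)|
        / √(vHat (fun i => a + xs i ω) (fun i => b + τ * xs i ω + es i ω)) < γ}
      ≤ Real.exp (-(1 / 4) * (S - γ) ^ 2)
        + Real.log n / √n * (2 * (s * σ / (√(2 * Real.pi) * w)))
        + (4 + 2 * c * (L + 2 * ρe + 2 * ρx) + 90 * L + 18 * B
          + 1120 * (σ ^ 2 * s ^ 2 / w ^ 2) + 8 * H) / √n := by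
  have hB1 := h.one_le_B
  have hL1 := h.one_le_L
  have hH1 := h.one_le_H
  have hρx := h.one_le_ρx
  have hρe := h.one_le_ρe
  have hσ := h.σ_pos
  have hs := h.s_pos
  have hw := h.w_pos
  have hB0 : 0 < B := by linarith
  have hn' : (0 : ℝ) < n := by exact_mod_cast hn
  set r := √(n : ℝ) with hr
  set D := σ ^ 2 * s ^ 2 / w ^ 2 with hDdef
  have hD0 : 0 ≤ D := by positivity
  -- `L`, `B` and `H` are at least one, and `4 + 90 + 18 + 8 = 120`.
  have hr120 : 120 ≤ r := by linarith
  have hr0 : 0 < r := by linarith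
  have hrn : r ^ 2 = n := Real.sq_sqrt hn'.le
  set q := Real.log n with hqdef
  have hq : q = 2 * Real.log r := by rw [hqdef, ← hrn, Real.log_pow]; norm_num
  have hq0 : 0 < q := by rw [hq]; have := Real.log_pos (by linarith : 1 < r); linarith
  have hq1 : q ≤ 0.08 * r := by rw [hq]; exact log_le_of_large hr120
  have hq2 : q ^ 2 ≤ 16 * r := by rw [hq]; exact log_sq_le (by linarith)
  -- functions of the sample
  have hDf : ∀ g : ℝ × ℝ → ℝ, Measurable g → ∀ i,
      IdentDistrib (fun ω => g (xs i ω, es i ω)) (fun ω => g (x ω, e ω)) P P₀ :=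
    fun g hg i => (hD i).comp hg
  have hIf : ∀ g : ℝ × ℝ → ℝ, Measurable g → iIndepFun (fun i ω => g (xs i ω, es i ω)) P :=
    fun g hg => hI.comp (fun _ => g) fun _ => hg
  have m1 : Measurable fun p : ℝ × ℝ => p.1 := by fun_prop
  have m2 : Measurable fun p : ℝ × ℝ => p.2 := by fun_prop
  have m3 : Measurable fun p : ℝ × ℝ => p.1 * p.2 := by fun_prop
  have m4 : Measurable fun p : ℝ × ℝ => p.1 ^ 2 := by fun_prop
  have m5 : Measurable fun p : ℝ × ℝ => p.2 ^ 2 := by fun_prop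
  -- The exceptional events: large means of `x` and `e` (`E1`, `E2`), atypical means of `(x e)²` and
  -- `x⁴` (`E3`, `E4`), cruder deviations for `x²`, `x e` and `e²` (`E5` to `E7`), and the main
  -- event `E8`, a large deviation of the mean of `x e`. Outside all of them the covariate is
  -- selected.
  set E1 := {ω | √q < r * |sampleMean fun i => xs i ω| / σ} with hE1
  set E2 := {ω | √q < r * |sampleMean fun i => es i ω| / s} with hE2
  set E3 := {ω | ¬ ((1 - 1 / 8 - L / r) * w ^ 2 ≤ sampleMean (fun i => (xs i ω * es i ω) ^ 2) ∧
    sampleMean (fun i => (xs i ω * es i ω) ^ 2) ≤ (1 + 1 / 8) * w ^ 2)} with hE3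
  set E4 := {ω | ¬ ((1 - 1 / 2 - H / r) * (B * σ ^ 2) ^ 2 ≤ sampleMean (fun i => (xs i ω ^ 2) ^ 2) ∧
    sampleMean (fun i => (xs i ω ^ 2) ^ 2) ≤ (1 + 1 / 2) * (B * σ ^ 2) ^ 2)} with hE4
  set E5 := {ω | σ ^ 2 / 4 ≤ |(sampleMean fun i => xs i ω ^ 2) - σ ^ 2|} with hE5
  set E6 := {ω | w / (10 * B) ≤ |sampleMean fun i => xs i ω * es i ω|} with hE6
  set E7 := {ω | 0.0004 * r ^ 2 * w ^ 2 / (q * σ ^ 2) ≤ sampleMean fun i => es i ω ^ 2} with hE7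
  set δ := q * (σ * s) / (r * w) with hδ
  have hδ0 : 0 ≤ δ := by positivity
  set u := √2 * (S - γ) with hu
  have hu0 : 0 ≤ u := mul_nonneg (Real.sqrt_nonneg _) (by linarith)
  set E8 := {ω | u - δ < r * |sampleMean fun i => xs i ω * es i ω| / w} with hE8
  have p1 : P.real E1 ≤ 1 / r + 2 * c * ρx / r := by
    have h1 := tail_le hc hn (hIf _ m1) (hDf _ m1) (h.memx.mono_exponent (by norm_num)) h.meanx
      hσ h.sq_x h.cube_x √q
    have h2 := two_mul_one_sub_stdNormalCDF_sqrt_log (by linarith : 1 ≤ r)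
    rw [← hq] at h2
    exact h1.trans (by linarith)
  have p2 : P.real E2 ≤ 1 / r + 2 * c * ρe / r := by
    have h1 := tail_le hc hn (hIf _ m2) (hDf _ m2) (h.meme.mono_exponent (by norm_num)) h.meane
      hs h.sq_e h.cube_e √q
    have h2 := two_mul_one_sub_stdNormalCDF_sqrt_log (by linarith : 1 ≤ r)
    rw [← hq] at h2
    exact h1.trans (by linarith)
  have p3 : P.real E3 ≤ 65 * (L / r) := by
    have := measureReal_sampleMean_sq_le hn (hIf _ m3) (hDf _ m3) h.memxe hw h.sq_xe h.cube_xe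
      (by norm_num : (0 : ℝ) < 1 / 8)
    refine this.trans (le_of_eq ?_)
    rw [← hr]; norm_num
  have p4 : P.real E4 ≤ 5 * (H / r) := by
    have := measureReal_sampleMean_sq_le hn (hIf _ m4) (hDf _ m4) h.memsq
      (by positivity : 0 < B * σ ^ 2) h.sq_sq_x h.six_x (by norm_num : (0 : ℝ) < 1 / 2)
    refine this.trans (le_of_eq ?_)
    rw [← hr]; norm_num
  have p5 : P.real E5 ≤ 16 * B ^ 2 / r ^ 2 := by
    have h1 := measureReal_sampleMean_sub_ge_le hn (hIf _ m4) (hDf _ m4)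
      (h.memsq.mono_exponent (by norm_num)) (by positivity : 0 < σ ^ 2 / 4)
    simp only [h.sq_x] at h1
    refine h1.trans ?_
    have h2 := variance_le_expectation_sq (μ := P₀) h.memsq.aestronglyMeasurable
    have h3 : Var[fun ω => x ω ^ 2; P₀] ≤ (B * σ ^ 2) ^ 2 := h2.trans (le_of_eq h.sq_sq_x)
    rw [← hrn, div_le_iff₀ (by positivity)]
    refine h3.trans (le_of_eq ?_)
    field_simp
    norm_num
  have p6 : P.real E6 ≤ 100 * B ^ 2 / r ^ 2 := by
    have h1 := measureReal_sampleMean_sub_ge_le hn (hIf _ m3) (hDf _ m3)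
      (h.memxe.mono_exponent (by norm_num)) (by positivity : 0 < w / (10 * B))
    simp only [h.meanxe, sub_zero] at h1
    rw [(sd_eq h.memxe.aestronglyMeasurable.aemeasurable h.meanxe hw h.sq_xe).1] at h1
    refine h1.trans (le_of_eq ?_)
    rw [← hrn]
    field_simp
    norm_num
  -- The threshold in `E7` grows like `r ^ 2 / q`, so Markov's inequality suffices: it gives `2500 q
  -- D / r²`, and `q ≤ 0.08 r` turns this into `200 D / r`.
  have p7 : P.real E7 ≤ 200 * (D / r) := by
    have h1 := measureReal_sampleMean_ge_le hn (hDf _ m5)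
      (h.meme.mono_exponent (by norm_num : (2 : ENNReal) ≤ 6)).integrable_sq
      (fun i ω => sq_nonneg _) (by positivity : 0 < 0.0004 * r ^ 2 * w ^ 2 / (q * σ ^ 2))
    simp only [h.sq_e] at h1
    refine h1.trans ?_
    have e1 : s ^ 2 / (0.0004 * r ^ 2 * w ^ 2 / (q * σ ^ 2)) = 2500 * q * (D / r ^ 2) := by
      rw [hDdef]; field_simp; norm_num
    have e2 : 200 * (D / r) = 2500 * (0.08 * r) * (D / r ^ 2) := by
      field_simp; norm_num; ring
    rw [e1, e2]
    gcongr
  have p8 : P.real E8 ≤ Real.exp (-(1 / 4) * (S - γ) ^ 2)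
      + q / r * (2 * (s * σ / (√(2 * Real.pi) * w))) + 2 * c * L / r := by
    have h1 := tail_le hc hn (hIf _ m3) (hDf _ m3) h.memxe h.meanxe hw h.sq_xe h.cube_xe (u - δ)
    have h2 := two_mul_one_sub_stdNormalCDF_sub_le hu0 hδ0
    -- As `u = √2 (S - γ)`, the left side is `exp (-(S - γ) ^ 2)`; a factor four in the exponent is
    -- given away.
    have h3 : Real.exp (-(u ^ 2) / 2) ≤ Real.exp (-(1 / 4) * (S - γ) ^ 2) := by
      rw [Real.exp_le_exp, hu, mul_pow, Real.sq_sqrt (by norm_num)]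
      linarith [sq_nonneg (S - γ)]
    have h4 : 2 * (δ * (√(2 * Real.pi))⁻¹) = q / r * (2 * (s * σ / (√(2 * Real.pi) * w))) := by
      rw [hδ]; field_simp
    rw [h4] at h2
    exact h1.trans (by linarith)
  have hsub : {ω | r * |slopeHat (fun i => a + xs i ω) (fun i => b + τ * xs i ω + es i ω)|
        / √(vHat (fun i => a + xs i ω) (fun i => b + τ * xs i ω + es i ω)) < γ}
      ⊆ E1 ∪ (E2 ∪ (E3 ∪ (E4 ∪ (E5 ∪ (E6 ∪ (E7 ∪ E8)))))) := by
    intro ω hω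
    by_contra hcon
    simp only [Set.mem_union, not_or] at hcon
    obtain ⟨n1, n2, n3, n4, n5, n6, n7, n8⟩ := hcon
    have n1 : r * |sampleMean fun i => xs i ω| / σ ≤ √q := not_lt.1 n1
    have n2 : r * |sampleMean fun i => es i ω| / s ≤ √q := not_lt.1 n2
    have n3 := not_not.1 n3
    have n4 := not_not.1 n4
    have n5 : |(sampleMean fun i => xs i ω ^ 2) - σ ^ 2| < σ ^ 2 / 4 := not_le.1 n5
    have n6 : |sampleMean fun i => xs i ω * es i ω| < w / (10 * B) := not_le.1 n6
    have n7 : (sampleMean fun i => es i ω ^ 2) < 0.0004 * r ^ 2 * w ^ 2 / (q * σ ^ 2) :=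
      not_le.1 n7
    have n8 : r * |sampleMean fun i => xs i ω * es i ω| / w ≤ u - δ := not_lt.1 n8
    have hDw : 1120 * (σ ^ 2 * s ^ 2) ≤ w ^ 2 * r := by
      have : D * w ^ 2 = σ ^ 2 * s ^ 2 := by rw [hDdef]; field_simp
      rw [← this]
      have : 1120 * D ≤ r := by linarith
      linarith [mul_le_mul_of_nonneg_right this (sq_nonneg w)]
    obtain ⟨b1, b2, b3, b4⟩ := scoreHat_bounds (x := fun i => xs i ω) (e := fun i => es i ω) hn
      hr120 hq0 hq1 hq2 hσ hs hw hB1 (by linarith) (by linarith : 90 * L ≤ r) hDw n1 n2 n3.1 n3.2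
      n4.2 n5 n6 n7
    have := lt_of_statistic_lt (x := fun i => xs i ω) (e := fun i => es i ω) hn hr hσ hw hγ b1
      b2 b3 hω
    rw [← hS, ← hu] at this
    linarith
  have hunion := measureReal_mono (μ := P) hsub
  have u1 := measureReal_union_le (μ := P) E1 (E2 ∪ (E3 ∪ (E4 ∪ (E5 ∪ (E6 ∪ (E7 ∪ E8))))))
  have u2 := measureReal_union_le (μ := P) E2 (E3 ∪ (E4 ∪ (E5 ∪ (E6 ∪ (E7 ∪ E8)))))
  have u3 := measureReal_union_le (μ := P) E3 (E4 ∪ (E5 ∪ (E6 ∪ (E7 ∪ E8))))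
  have u4 := measureReal_union_le (μ := P) E4 (E5 ∪ (E6 ∪ (E7 ∪ E8)))
  have u5 := measureReal_union_le (μ := P) E5 (E6 ∪ (E7 ∪ E8))
  have u6 := measureReal_union_le (μ := P) E6 (E7 ∪ E8)
  have u7 := measureReal_union_le (μ := P) E7 E8
  -- The two Chebyshev bounds have `16 + 100 = 116`. One factor `B / r ≤ 1 / 18` is spent to reach
  -- the order `1 / r`.
  have hBB : 116 * (B ^ 2 / r ^ 2) ≤ 18 * (B / r) := by
    have e1 : B ^ 2 / r ^ 2 = (B / r) * (B / r) := by ring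
    have e2 : B / r ≤ 1 / 18 := by rw [div_le_div_iff₀ hr0 (by norm_num)]; linarith
    have e3 : (B / r) * (B / r) ≤ (B / r) * (1 / 18) := by gcongr
    rw [e1]
    have : 0 ≤ B / r := by positivity
    linarith
  have hfin : (4 + 2 * c * (L + 2 * ρe + 2 * ρx) + 90 * L + 18 * B + 1120 * D + 8 * H) / r
      = 4 * (1 / r) + 2 * c * L / r + 2 * (2 * c * ρe / r) + 2 * (2 * c * ρx / r)
        + 90 * (L / r) + 18 * (B / r) + 1120 * (D / r) + 8 * (H / r) := by ring
  rw [hfin]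
  have z1 : 0 ≤ 1 / r := by positivity
  have z2 : 0 ≤ 2 * c * ρe / r := by positivity
  have z3 : 0 ≤ 2 * c * ρx / r := by positivity
  have z4 : 0 ≤ L / r := by positivity
  have z5 : 0 ≤ D / r := by positivity
  have z6 : 0 ≤ H / r := by positivity
  rw [mul_div_assoc] at p5 p6
  linarith

end MomentData

/-! ### Population moments, domination by the Lyapunov ratios, and failure of one covariate. -/

section Population

variable {Ω₀ : Type*} [MeasurableSpace Ω₀] {P₀ : Measure Ω₀} [IsProbabilityMeasure P₀]
  {X Y : Ω₀ → ℝ}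

set_option linter.unusedSectionVars false

theorem sd_nonneg (Z : Ω₀ → ℝ) : 0 ≤ sd P₀ Z := Real.sqrt_nonneg _

theorem memLp_centered {r : ENNReal} (h : MemLp X r P₀) : MemLp (centered P₀ X) r P₀ :=
  h.sub (memLp_const _)

theorem integral_centered (h : Integrable X P₀) : ∫ ω, centered P₀ X ω ∂P₀ = 0 := by
  simp only [centered]
  rw [integral_sub h (integrable_const _)]
  simp

theorem integral_centered_sq (h : AEMeasurable X P₀) :
    ∫ ω, centered P₀ X ω ^ 2 ∂P₀ = sd P₀ X ^ 2 := by
  rw [sd, Real.sq_sqrt (variance_nonneg _ _), variance_eq_integral h]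
  rfl

theorem integral_centered_mul : ∫ ω, centered P₀ X ω * centered P₀ Y ω ∂P₀ = cov[X, Y; P₀] := rfl

theorem memLp_regError {r : ENNReal} (hX : MemLp X r P₀) (hY : MemLp Y r P₀) :
    MemLp (regError P₀ X Y) r P₀ :=
  (memLp_centered hY).sub ((memLp_centered hX).const_mul _)

theorem lnorm_natCast_pow_eq {k : ℕ} (hk : k ≠ 0) (Z : Ω₀ → ℝ) {r : ℝ} (hr : r = k) :
    lnorm P₀ r Z ^ k = ∫ ω, |Z ω| ^ k ∂P₀ := by
  rw [hr]; exact lnorm_pow P₀ k hk Z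

theorem integral_regError (hX : MemLp X 2 P₀) (hY : MemLp Y 2 P₀) :
    ∫ ω, regError P₀ X Y ω ∂P₀ = 0 := by
  have i1 : Integrable X P₀ := hX.integrable (by norm_num)
  have i2 : Integrable Y P₀ := hY.integrable (by norm_num)
  simp only [regError]
  rw [integral_sub ((memLp_centered hY).integrable (by norm_num))
    (((memLp_centered hX).integrable (by norm_num)).const_mul _), integral_const_mul,
    integral_centered i1, integral_centered i2]
  simp

theorem integral_centered_mul_regError (hX : MemLp X 2 P₀) (hY : MemLp Y 2 P₀)
    (hv : 0 < Var[X; P₀]) : ∫ ω, centered P₀ X ω * regError P₀ X Y ω ∂P₀ = 0 := by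
  have hx := memLp_centered hX
  have hy := memLp_centered hY
  have e : ∀ ω, centered P₀ X ω * regError P₀ X Y ω
      = centered P₀ X ω * centered P₀ Y ω - slope P₀ X Y * centered P₀ X ω ^ 2 := fun ω => by
    rw [regError]; ring
  simp_rw [e]
  have i1 : Integrable (fun ω => centered P₀ X ω * centered P₀ Y ω) P₀ := hx.integrable_mul hy
  rw [integral_sub i1 (hx.integrable_sq.const_mul _), integral_const_mul,
    integral_centered_mul, integral_centered_sq hX.aestronglyMeasurable.aemeasurable, sd,
    Real.sq_sqrt hv.le, slope]
  field_simp
  ring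

theorem sd_regError_sq (hX : MemLp X 2 P₀) (hY : MemLp Y 2 P₀) :
    ∫ ω, regError P₀ X Y ω ^ 2 ∂P₀ = sd P₀ (regError P₀ X Y) ^ 2 := by
  rw [sd, Real.sq_sqrt (variance_nonneg _ _), variance_of_integral_eq_zero
    (memLp_regError hX hY).aestronglyMeasurable.aemeasurable (integral_regError hX hY)]

/-- Pythagoras: `σ_Y² = τ² σ_X² + σ_ε²`. -/
theorem sd_regError_sq_le (hX : MemLp X 2 P₀) (hY : MemLp Y 2 P₀) (hv : 0 < Var[X; P₀]) :
    sd P₀ (regError P₀ X Y) ^ 2 ≤ sd P₀ Y ^ 2 := by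
  have hx := memLp_centered hX
  have he := memLp_regError hX hY
  have e : ∀ ω, centered P₀ Y ω ^ 2 = slope P₀ X Y ^ 2 * centered P₀ X ω ^ 2
      + 2 * slope P₀ X Y * (centered P₀ X ω * regError P₀ X Y ω) + regError P₀ X Y ω ^ 2 :=
    fun ω => by rw [regError]; ring
  have i1 : Integrable (fun ω => slope P₀ X Y ^ 2 * centered P₀ X ω ^ 2) P₀ :=
    hx.integrable_sq.const_mul _
  have i2 : Integrable (fun ω => 2 * slope P₀ X Y * (centered P₀ X ω * regError P₀ X Y ω)) P₀ :=
    (hx.integrable_mul he).const_mul _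
  rw [← integral_centered_sq hY.aestronglyMeasurable.aemeasurable, ← sd_regError_sq hX hY]
  simp_rw [e]
  rw [integral_add (i1.fun_add i2) he.integrable_sq, integral_add i1 i2, integral_const_mul,
    integral_const_mul, integral_centered_mul_regError hX hY hv,
    integral_centered_sq hX.aestronglyMeasurable.aemeasurable]
  have : 0 ≤ slope P₀ X Y ^ 2 * sd P₀ X ^ 2 := by positivity
  linarith

theorem integral_sq_pos {Z : Ω₀ → ℝ} (h : MemLp Z 2 P₀) (h0 : ¬ Z =ᵐ[P₀] 0) :
    0 < ∫ ω, Z ω ^ 2 ∂P₀ := by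
  refine lt_of_le_of_ne (integral_nonneg fun ω => sq_nonneg _) fun heq => h0 ?_
  have := (integral_eq_zero_iff_of_nonneg (fun ω => sq_nonneg (Z ω)) h.integrable_sq).1 heq.symm
  filter_upwards [this] with ω hω
  exact pow_eq_zero_iff (two_ne_zero) |>.1 hω

/-- The normalized moments of a relevant covariate and its regression error. -/
theorem momentData (hX : MemLp X 6 P₀) (hY : MemLp Y 6 P₀) (hv : 0 < Var[X; P₀])
    (hne : ¬ centered P₀ X * regError P₀ X Y =ᵐ[P₀] 0) :
    MomentData P₀ (centered P₀ X) (regError P₀ X Y) (sd P₀ X) (sd P₀ (regError P₀ X Y))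
      (lnorm P₀ 2 (centered P₀ X * regError P₀ X Y))
      (lnorm P₀ 4 (centered P₀ X) ^ 2 / sd P₀ X ^ 2)
      (lnorm P₀ 6 (centered P₀ X) ^ 6 / lnorm P₀ 4 (centered P₀ X) ^ 6)
      (lnorm P₀ 3 (centered P₀ X * regError P₀ X Y) ^ 3
        / lnorm P₀ 2 (centered P₀ X * regError P₀ X Y) ^ 3)
      (lnorm P₀ 3 (centered P₀ X) ^ 3 / sd P₀ X ^ 3)
      (lnorm P₀ 3 (regError P₀ X Y) ^ 3 / sd P₀ (regError P₀ X Y) ^ 3) := by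
  have hX2 : MemLp X 2 P₀ := hX.mono_exponent (by norm_num)
  have hY2 : MemLp Y 2 P₀ := hY.mono_exponent (by norm_num)
  have hx := memLp_centered hX
  have he := memLp_regError hX hY
  set x := centered P₀ X with hxdef
  set e := regError P₀ X Y with hedef
  have hσ : 0 < sd P₀ X := Real.sqrt_pos.2 hv
  -- A vanishing standard deviation would make the centered error, and with it the product, almost
  -- surely zero.
  have hs : 0 < sd P₀ e := by
    refine lt_of_le_of_ne (sd_nonneg _) fun h0 => ?_
    have h1 := integral_sq_pos (he.mono_exponent (by norm_num)) (fun h => hne ?_)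
    · rw [sd_regError_sq hX2 hY2, ← h0] at h1; norm_num at h1
    · filter_upwards [h] with ω hω
      rw [Pi.mul_apply, hω]; simp
  have hxe : MemLp (x * e) 2 P₀ := by
    have h3 : MemLp (x * e) 3 P₀ := he.mul (r := 3) hx (hpqr := ⟨by
      rw [← two_mul, show (6 : ENNReal) = 2 * 3 by norm_num, ENNReal.mul_inv (by simp) (by simp),
        ← mul_assoc, ENNReal.mul_inv_cancel (by simp) (by simp), one_mul]⟩)
    exact h3.mono_exponent (by norm_num)
  have hw2 : ∫ ω, (x ω * e ω) ^ 2 ∂P₀ = lnorm P₀ 2 (x * e) ^ 2 := by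
    rw [lnorm_natCast_pow_eq (k := 2) (by norm_num) _ (by norm_num)]
    simp only [sq_abs, Pi.mul_apply]
  have hw : 0 < lnorm P₀ 2 (x * e) := by
    have h1 := integral_sq_pos hxe hne
    simp only [Pi.mul_apply] at h1
    rw [hw2] at h1
    exact lt_of_le_of_ne (lnorm_nonneg _ _ _) fun h => by rw [← h] at h1; norm_num at h1
  have h4 : ∫ ω, x ω ^ 4 ∂P₀ = lnorm P₀ 4 x ^ 4 := by
    rw [lnorm_natCast_pow_eq (k := 4) (by norm_num) _ (by norm_num)]
    simp only [Even.pow_abs (show Even 4 by decide)]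
  have hσ2 : ∫ ω, x ω ^ 2 ∂P₀ = sd P₀ X ^ 2 :=
    integral_centered_sq hX2.aestronglyMeasurable.aemeasurable
  have hB : ∫ ω, x ω ^ 4 ∂P₀ = (lnorm P₀ 4 x ^ 2 / sd P₀ X ^ 2 * sd P₀ X ^ 2) ^ 2 := by
    rw [h4]; field_simp
  have hBnn : 0 ≤ lnorm P₀ 4 x ^ 2 / sd P₀ X ^ 2 := by positivity
  -- Otherwise the ratio `B` would be zero, against `1 ≤ B`.
  have h4pos : lnorm P₀ 4 x ≠ 0 := fun h => by
    have := one_le_of_fourth_moment (hx.mono_exponent (by norm_num)) hσ hBnn hσ2 hB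
    rw [h] at this; norm_num at this
  exact
    { memx := hx
      meme := he
      meanx := integral_centered (hX2.integrable (by norm_num))
      meane := integral_regError hX2 hY2
      meanxe := integral_centered_mul_regError hX2 hY2 hv
      σ_pos := hσ
      s_pos := hs
      w_pos := hw
      B_nonneg := hBnn
      sq_x := hσ2
      sq_e := sd_regError_sq hX2 hY2
      sq_xe := hw2
      cube_xe := by
        rw [lnorm_natCast_pow_eq (k := 3) (by norm_num) _ (by norm_num)]
        simp only [Pi.mul_apply]
        field_simp
      four_x := hB
      six_x := by
        have : ∀ ω, |x ω ^ 2| ^ 3 = |x ω| ^ 6 := fun ω => by rw [abs_pow, ← pow_mul]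
        simp_rw [this]
        rw [← lnorm_natCast_pow_eq (k := 6) (r := 6) (by norm_num) x (by norm_num)]
        field_simp
      cube_x := by
        rw [lnorm_natCast_pow_eq (k := 3) (by norm_num) _ (by norm_num)]
        field_simp
      cube_e := by
        rw [lnorm_natCast_pow_eq (k := 3) (by norm_num) _ (by norm_num)]
        field_simp }

/-- The terms of `G₁` that enter the argument. -/
theorem le_G1 (X Y : Ω₀ → ℝ) :
    1120 * lnorm P₀ 3 (centered P₀ X) ^ 3 * sd P₀ Y ^ 2
        / (lnorm P₀ 2 (centered P₀ X * regError P₀ X Y) ^ 2 * sd P₀ X)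
      + 64 * √2 * lnorm P₀ 3 (centered P₀ X * regError P₀ X Y) ^ 3
        / lnorm P₀ 2 (centered P₀ X * regError P₀ X Y) ^ 3
      + 16 * lnorm P₀ 4 (centered P₀ X) ^ 2 / sd P₀ X ^ 2
      + 8 * lnorm P₀ 6 (centered P₀ X) ^ 6 / lnorm P₀ 4 (centered P₀ X) ^ 6 ≤ G1 P₀ X Y := by
  have hN : ∀ r Z, 0 ≤ lnorm P₀ r Z := lnorm_nonneg P₀
  unfold G1
  simp only
  have hX := sd_nonneg (P₀ := P₀) X
  have hY := sd_nonneg (P₀ := P₀) Y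
  have := hN 1 (centered P₀ Y ^ 2 * centered P₀ X)
  have := hN 2 (centered P₀ Y ^ 2 * centered P₀ X)
  have := hN 1 (centered P₀ X ^ 2 * centered P₀ Y)
  have := hN 2 (centered P₀ X ^ 2 * centered P₀ Y)
  have := hN 1 (centered P₀ X ^ 3 * centered P₀ Y)
  have := hN (3 / 2) (centered P₀ X ^ 3 * centered P₀ Y)
  have := hN 2 (centered P₀ X * centered P₀ Y)
  have := hN 2 (centered P₀ X * regError P₀ X Y)
  have := hN 3 (centered P₀ X)
  have := hN 4 (centered P₀ X)
  have := hN 6 (centered P₀ X)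
  have := hN 4 (centered P₀ Y)
  -- Zeros are inserted in the places of the other summands of `G1`, so that `gcongr` compares term
  -- by term.
  rw [show ∀ a b c d : ℝ, a + b + c + d
    = 0 + a + b + 0 + 0 + 0 + 0 + 0 + 0 + 0 + 0 + 0 + 0 + 0 + 0 + c + 0 + 0 + d + 0 from
    fun a b c d => by ring]
  gcongr <;> positivity

theorem K1_nonneg (X Y : Ω₀ → ℝ) : 0 ≤ K1 P₀ X Y := by
  have := lnorm_nonneg P₀ 2 (centered P₀ X * regError P₀ X Y)
  have := sd_nonneg (P₀ := P₀) X
  have := sd_nonneg (P₀ := P₀) (regError P₀ X Y)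
  unfold K1
  simp only
  positivity

theorem G2_nonneg (c : ℝ) (X Y : Ω₀ → ℝ) : 0 ≤ G2 c P₀ X Y := by
  have := lnorm_nonneg P₀ 1 (centered P₀ X ^ 3 * centered P₀ Y)
  have := lnorm_nonneg P₀ 1 (centered P₀ Y ^ 2 * centered P₀ X)
  have := lnorm_nonneg P₀ 2 (centered P₀ X * regError P₀ X Y)
  have := lnorm_nonneg P₀ 4 (centered P₀ X)
  have := lnorm_nonneg P₀ 3 (centered P₀ X)
  have := sd_nonneg (P₀ := P₀) X
  have := sd_nonneg (P₀ := P₀) Y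
  have := sd_nonneg (P₀ := P₀) (regError P₀ X Y)
  unfold G2
  simp only
  positivity

theorem G3_nonneg (c : ℝ) (X Y : Ω₀ → ℝ) : 0 ≤ G3 c P₀ X Y := by
  have := lnorm_nonneg P₀ 1 (centered P₀ Y ^ 2 * centered P₀ X)
  have := lnorm_nonneg P₀ 4 (centered P₀ X)
  have := lnorm_nonneg P₀ 4 (centered P₀ Y)
  have := lnorm_nonneg P₀ 3 (centered P₀ X)
  have := sd_nonneg (P₀ := P₀) X
  unfold G3
  simp only
  positivity

variable {Ω : Type*} [MeasurableSpace Ω] {P : Measure Ω} [IsProbabilityMeasure P] {n : ℕ}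
  {xs ys : Fin n → Ω → ℝ}

/-- The probability that a single relevant covariate is not selected. -/
theorem failure_prob_le {c : ℝ} (c₁ c₂ : ℝ) (hc0 : 0 < c) (hc : BerryEsseenInequality c)
    (hn : 0 < n) (hX : MemLp X 6 P₀) (hY : MemLp Y 6 P₀) (hv : 0 < Var[X; P₀])
    (hne : ¬ centered P₀ X * regError P₀ X Y =ᵐ[P₀] 0)
    (hI : iIndepFun (fun i ω => (xs i ω, ys i ω)) P)
    (hD : ∀ i, IdentDistrib (fun ω => (xs i ω, ys i ω)) (fun ω => (X ω, Y ω)) P P₀)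
    {γ : ℝ} (hγ : 0 ≤ γ) :
    P.real {ω | ¬ γ ≤ √n * |slopeHat (fun i => xs i ω) (fun i => ys i ω)|
        / √(vHat (fun i => xs i ω) (fun i => ys i ω))}
      ≤ Real.exp (-(1 / 4) * (max (signal P₀ n X Y - γ) 0) ^ 2)
        + Real.log n / √n * (2 * K1 P₀ X Y)
        + 1 / √n * (2 * K2 c P₀ X Y + 2 * lnorm P₀ 4 (centered P₀ X) ^ 2 / sd P₀ X ^ 2
          + G1 P₀ X Y)
        + 1 / n * (4 * G2 c₁ P₀ X Y + 2) + 1 / (n : ℝ) ^ (3 / 2 : ℝ) * G3 c₂ P₀ X Y := by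
  have hM := momentData hX hY hv hne
  have hX2 : MemLp X 2 P₀ := hX.mono_exponent (by norm_num)
  have hY2 : MemLp Y 2 P₀ := hY.mono_exponent (by norm_num)
  have hn' : (1 : ℝ) ≤ n := by exact_mod_cast hn
  have hr0 : 0 < √(n : ℝ) := Real.sqrt_pos.2 (by linarith)
  have k1 := K1_nonneg (P₀ := P₀) X Y
  have z1 : 0 ≤ Real.log n / √n * (2 * K1 P₀ X Y) :=
    mul_nonneg (div_nonneg (Real.log_nonneg hn') hr0.le) (by linarith)
  have z2 : 0 ≤ 1 / (n : ℝ) * (4 * G2 c₁ P₀ X Y + 2) :=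
    mul_nonneg (by positivity) (by linarith [G2_nonneg (P₀ := P₀) c₁ X Y])
  have z3 : 0 ≤ 1 / (n : ℝ) ^ (3 / 2 : ℝ) * G3 c₂ P₀ X Y :=
    mul_nonneg (by positivity) (G3_nonneg c₂ X Y)
  have hL1 := hM.one_le_L
  have hB1 := hM.one_le_B
  have hH1 := hM.one_le_H
  have hρx1 := hM.one_le_ρx
  have hρe1 := hM.one_le_ρe
  have hσ := hM.σ_pos
  have hw := hM.w_pos
  set x := centered P₀ X with hxdef
  set e := regError P₀ X Y with hedef
  set w := lnorm P₀ 2 (x * e) with hwdef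
  set σ := sd P₀ X with hσdef
  set s := sd P₀ e with hsdef
  set B := lnorm P₀ 4 x ^ 2 / σ ^ 2 with hB
  set H := lnorm P₀ 6 x ^ 6 / lnorm P₀ 4 x ^ 6 with hH
  set L := lnorm P₀ 3 (x * e) ^ 3 / w ^ 3 with hL
  set ρx := lnorm P₀ 3 x ^ 3 / σ ^ 3 with hρx
  set ρe := lnorm P₀ 3 e ^ 3 / s ^ 3 with hρe
  set D := σ ^ 2 * s ^ 2 / w ^ 2 with hDdef
  have hD0 : 0 ≤ D := by positivity
  -- the constants dominate the normalized moments
  have hK2 : 2 * K2 c P₀ X Y = 4 + 2 * c * (L + 2 * ρe + 2 * ρx) := by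
    rw [K2, hL, hρe, hρx]
    simp only [← hxdef, ← hedef, ← hwdef, ← hσdef, ← hsdef]
    ring
  have hG1 : 1120 * D + 90 * L + 16 * B + 8 * H ≤ G1 P₀ X Y := by
    refine le_trans ?_ (le_G1 X Y)
    rw [← hxdef, ← hedef, ← hwdef, ← hσdef]
    -- The right side is `1120 ρx σ² σ_Y² / w²`; now `ρx ≥ 1` and `σ_ε ≤ σ_Y`.
    have g1 : 1120 * D ≤ 1120 * lnorm P₀ 3 x ^ 3 * sd P₀ Y ^ 2 / (w ^ 2 * σ) := by
      have e1 : 1120 * lnorm P₀ 3 x ^ 3 * sd P₀ Y ^ 2 / (w ^ 2 * σ)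
          = 1120 * (ρx * (σ ^ 2 * sd P₀ Y ^ 2 / w ^ 2)) := by
        rw [hρx]; field_simp
      rw [e1]
      refine mul_le_mul_of_nonneg_left ?_ (by norm_num)
      refine le_trans ?_ (le_mul_of_one_le_left (by positivity) hρx1)
      rw [hDdef]
      gcongr ?_ / _
      exact mul_le_mul_of_nonneg_left (sd_regError_sq_le hX2 hY2 hv) (sq_nonneg _)
    have g2 : 90 * L ≤ 64 * √2 * lnorm P₀ 3 (x * e) ^ 3 / w ^ 3 := by
      rw [mul_div_assoc]
      have : (1.41 : ℝ) ≤ √2 := Real.le_sqrt_of_sq_le (by norm_num)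
      exact mul_le_mul_of_nonneg_right (by linarith) (by linarith)
    have g3 : 16 * B = 16 * lnorm P₀ 4 x ^ 2 / σ ^ 2 := by rw [hB, mul_div_assoc]
    have g4 : 8 * H = 8 * lnorm P₀ 6 x ^ 6 / lnorm P₀ 4 x ^ 6 := by rw [hH, mul_div_assoc]
    linarith
  -- The `18 B` is `16 B` from `G1` plus `2 B` from the separate fourth moment term.
  have hfac : 4 + 2 * c * (L + 2 * ρe + 2 * ρx) + 90 * L + 18 * B + 1120 * D + 8 * H
      ≤ 2 * K2 c P₀ X Y + 2 * lnorm P₀ 4 x ^ 2 / σ ^ 2 + G1 P₀ X Y := by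
    rw [hK2, mul_div_assoc, ← hB]; linarith
  have hfac' := mul_le_mul_of_nonneg_left hfac (by positivity : 0 ≤ 1 / √(n : ℝ))
  have hcpos : 0 ≤ 2 * c * (L + 2 * ρe + 2 * ρx) := by positivity
  -- For small `n` the `1 / √n` term is at least one, so any probability satisfies the bound. In the
  -- next split, a signal below `γ` makes the exponential equal to one.
  rcases lt_or_ge (√(n : ℝ)) (4 + 90 * L + 18 * B + 1120 * D + 8 * H) with hsmall | hlarge
  · refine measureReal_le_one.trans ?_
    have h1 : 1 ≤ 1 / √(n : ℝ) * (4 + 2 * c * (L + 2 * ρe + 2 * ρx) + 90 * L + 18 * B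
        + 1120 * D + 8 * H) := by
      rw [one_div_mul_eq_div, le_div_iff₀ hr0]; linarith
    have h2 := Real.exp_pos (-(1 / 4) * (max (signal P₀ n X Y - γ) 0) ^ 2)
    linarith
  rcases lt_or_ge (signal P₀ n X Y) γ with hS | hS
  · refine measureReal_le_one.trans ?_
    rw [max_eq_right (by linarith)]
    have h1 : 0 ≤ 1 / √(n : ℝ) * (4 + 2 * c * (L + 2 * ρe + 2 * ρx) + 90 * L + 18 * B
        + 1120 * D + 8 * H) := by positivity
    norm_num
    norm_num at z1 z2 z3 h1 hfac'
    linarith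
  rw [max_eq_left (by linarith)]
  set a := ∫ ω, X ω ∂P₀ with ha
  set b := ∫ ω, Y ω ∂P₀ with hb
  set τ := slope P₀ X Y with hτ
  have hg : Measurable fun p : ℝ × ℝ => (p.1 - a, p.2 - b - τ * (p.1 - a)) := by fun_prop
  have key := hM.failure_le (n := n) (P := P) (a := a) (b := b) (τ := τ) (γ := γ)
    (S := signal P₀ n X Y) (xs := fun i ω => xs i ω - a)
    (es := fun i ω => ys i ω - b - τ * (xs i ω - a)) hc0 hc hn
    (hI.comp (fun _ p => (p.1 - a, p.2 - b - τ * (p.1 - a))) fun _ => hg)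
    (fun i => (hD i).comp hg) hγ rfl hS hlarge
  have ex : ∀ ω i, a + (xs i ω - a) = xs i ω := fun ω i => by ring
  have ey : ∀ ω i, b + τ * (xs i ω - a) + (ys i ω - b - τ * (xs i ω - a)) = ys i ω :=
    fun ω i => by ring
  simp only [ex, ey] at key
  simp only [not_le]
  refine key.trans ?_
  have hK1 : s * σ / (√(2 * Real.pi) * w) = K1 P₀ X Y := rfl
  have hdiv : (4 + 2 * c * (L + 2 * ρe + 2 * ρx) + 90 * L + 18 * B + 1120 * D + 8 * H) / √(n : ℝ)
      = 1 / √(n : ℝ) * (4 + 2 * c * (L + 2 * ρe + 2 * ρx) + 90 * L + 18 * B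
        + 1120 * D + 8 * H) := by ring
  rw [hK1, hdiv]
  linarith

end Population

/-! ### The union bound over relevant covariates and the limit. -/

section Screening

variable {Ω₀ Ω : Type*} [MeasurableSpace Ω₀] [MeasurableSpace Ω]
  {P₀ : Measure Ω₀} [IsProbabilityMeasure P₀] {P : Measure Ω} [IsProbabilityMeasure P]
  {p : ℕ} {X : Fin p → Ω₀ → ℝ} {Y : Ω₀ → ℝ}

theorem sum_le_card_mul_iSup {ι : Type*} (M : Finset ι) (f : ι → ℝ) :
    ∑ j ∈ M, f j ≤ (M.card : ℝ) * ⨆ j : M, f j := by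
  rw [← nsmul_eq_mul]
  exact Finset.sum_le_card_nsmul _ _ _ fun j hj =>
    le_ciSup (f := fun j : M => f j) (Set.finite_range _).bddAbove ⟨j, hj⟩

/-- The union bound over the relevant covariates. -/
theorem screeningBound_le {c : ℝ} (c₁ c₂ : ℝ) (hc0 : 0 < c) (hc : BerryEsseenInequality c)
    (hVar : ∀ j, 0 < Var[X j; P₀]) (hY : MemLp Y 6 P₀)
    (hX6 : ∀ j ∈ relevant P₀ X Y, MemLp (X j) 6 P₀)
    (hne : ∀ j ∈ relevant P₀ X Y, ¬ centered P₀ (X j) * regError P₀ (X j) Y =ᵐ[P₀] 0)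
    {γ : ℝ} (hγ : 0 ≤ γ) {n : ℕ} (hn : 1 ≤ n)
    {Xs : Fin n → Fin p → Ω → ℝ} {Ys : Fin n → Ω → ℝ} (h : IsIIDCopies P₀ X Y P Xs Ys) :
    screeningBound c c₁ c₂ P₀ X Y n
        (fun j => Real.exp (-(1 / 4) * (max (signal P₀ n (X j) Y - γ) 0) ^ 2))
      ≤ P.real {ω | (relevant P₀ X Y : Set (Fin p)) ⊆
          selected γ (fun j i => Xs i j ω) (fun i => Ys i ω)} := by
  set M := relevant P₀ X Y with hM
  set good := {ω | (M : Set (Fin p)) ⊆ selected γ (fun j i => Xs i j ω) (fun i => Ys i ω)}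
  let fail : Fin p → Set Ω := fun j => {ω | ¬ γ ≤ √n * |slopeHat (fun i => Xs i j ω)
    (fun i => Ys i ω)| / √(vHat (fun i => Xs i j ω) (fun i => Ys i ω))}
  -- Covering the whole space and using subadditivity, rather than passing to a complement, avoids
  -- measurability of the selection event.
  have hcover : Set.univ ⊆ good ∪ ⋃ j ∈ M, fail j := fun ω _ => by
    by_cases hω : ω ∈ good
    · exact Or.inl hω
    · obtain ⟨j, hj, hj'⟩ := Set.not_subset.1 hω
      exact Or.inr (Set.mem_biUnion (Finset.mem_coe.1 hj) hj')
  have h1 : 1 ≤ P.real good + ∑ j ∈ M, P.real (fail j) := by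
    calc (1 : ℝ) = P.real Set.univ := by simp
      _ ≤ P.real (good ∪ ⋃ j ∈ M, fail j) := measureReal_mono hcover
      _ ≤ P.real good + P.real (⋃ j ∈ M, fail j) := measureReal_union_le _ _
      _ ≤ _ := by gcongr; exact measureReal_biUnion_finset_le _ _
  have hg : ∀ j : Fin p, Measurable fun z : ℝ × (Fin p → ℝ) => (z.2 j, z.1) := fun j => by
    fun_prop
  have h2 := Finset.sum_le_sum fun j (hj : j ∈ M) =>
    failure_prob_le (P := P) (n := n) (xs := fun i => Xs i j) (ys := Ys) c₁ c₂ hc0 hc hn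
      (hX6 j hj) hY (hVar j) (hne j hj) (h.1.comp (fun _ z => (z.2 j, z.1)) fun _ => hg j)
      (fun i => (h.2 i).comp (hg j)) hγ
  simp only [Finset.sum_add_distrib, ← Finset.mul_sum] at h2
  have hn' : (1 : ℝ) ≤ n := by exact_mod_cast hn
  have a1 : 0 ≤ Real.log n / √n := div_nonneg (Real.log_nonneg hn') (Real.sqrt_nonneg _)
  have b1 := mul_le_mul_of_nonneg_left
    (sum_le_card_mul_iSup M fun j => 2 * K1 P₀ (X j) Y) a1
  have b2 := mul_le_mul_of_nonneg_left
    (sum_le_card_mul_iSup M fun j => 2 * K2 c P₀ (X j) Y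
      + 2 * lnorm P₀ 4 (centered P₀ (X j)) ^ 2 / sd P₀ (X j) ^ 2 + G1 P₀ (X j) Y)
    (by positivity : 0 ≤ 1 / √(n : ℝ))
  have b3 := mul_le_mul_of_nonneg_left
    (sum_le_card_mul_iSup M fun j => 4 * G2 c₁ P₀ (X j) Y + 2)
    (by positivity : 0 ≤ 1 / (n : ℝ))
  have b4 := mul_le_mul_of_nonneg_left
    (sum_le_card_mul_iSup M fun j => G3 c₂ P₀ (X j) Y)
    (by positivity : 0 ≤ 1 / (n : ℝ) ^ (3 / 2 : ℝ))
  simp only [← mul_assoc] at b1 b2 b3 b4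
  simp only [Finset.sum_add_distrib, ← Finset.mul_sum, ← mul_assoc] at b1 b2 b3 b4 h2
  simp only [screeningBound, ← hM]
  linarith

set_option linter.unusedSectionVars false in
theorem slope_ne_zero_of_mem_relevant (hVar : ∀ j, 0 < Var[X j; P₀]) {j : Fin p}
    (hj : j ∈ relevant P₀ X Y) : slope P₀ (X j) Y ≠ 0 := by
  classical
  simp only [relevant, Finset.mem_filter, Finset.mem_univ, true_and] at hj
  exact div_ne_zero hj (hVar j).ne'

theorem tendsto_signal {x y : Ω₀ → ℝ} (hx : MemLp x 6 P₀) (hy : MemLp y 6 P₀)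
    (hv : 0 < Var[x; P₀]) (hne : ¬ centered P₀ x * regError P₀ x y =ᵐ[P₀] 0)
    (hs : slope P₀ x y ≠ 0) : Tendsto (fun n : ℕ => signal P₀ n x y) atTop atTop := by
  have hM := momentData hx hy hv hne
  have hσ := hM.σ_pos
  have hw := hM.w_pos
  have e : ∀ n : ℕ, signal P₀ n x y = √(n : ℝ) * (sd P₀ x ^ 2 * |slope P₀ x y|
      / (2 * √2 * lnorm P₀ 2 (centered P₀ x * regError P₀ x y))) := fun n => by
    rw [signal]; ring
  simp_rw [e]
  have hs' := abs_pos.2 hs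
  exact (Real.tendsto_sqrt_atTop.comp tendsto_natCast_atTop_atTop).atTop_mul_const (by positivity)

/-- The maxima depend only on the population, so each error term is a null sequence times a
constant, and each exponential vanishes because the signal diverges. -/
theorem tendsto_screeningBound (c c₁ c₂ γ : ℝ)
    (hVar : ∀ j, 0 < Var[X j; P₀]) (hY : MemLp Y 6 P₀)
    (hX6 : ∀ j ∈ relevant P₀ X Y, MemLp (X j) 6 P₀)
    (hne : ∀ j ∈ relevant P₀ X Y, ¬ centered P₀ (X j) * regError P₀ (X j) Y =ᵐ[P₀] 0) :
    Tendsto (fun n : ℕ => screeningBound c c₁ c₂ P₀ X Y n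
      (fun j => Real.exp (-(1 / 4) * (max (signal P₀ n (X j) Y - γ) 0) ^ 2))) atTop (𝓝 1) := by
  have hsum : Tendsto (fun n : ℕ => ∑ j ∈ relevant P₀ X Y,
      Real.exp (-(1 / 4) * (max (signal P₀ n (X j) Y - γ) 0) ^ 2)) atTop (𝓝 0) := by
    have key := tendsto_finsetSum (relevant P₀ X Y)
      (f := fun j (n : ℕ) => Real.exp (-(1 / 4) * (max (signal P₀ n (X j) Y - γ) 0) ^ 2))
      (a := fun _ => 0) (x := atTop) fun j hj => Real.tendsto_exp_atBot.comp ?_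
    · simpa only [Finset.sum_const_zero] using key
    have h1 := tendsto_atTop_add_const_right _ (-γ) (tendsto_signal (hX6 j hj) hY (hVar j)
      (hne j hj) (slope_ne_zero_of_mem_relevant hVar hj))
    have h2 : Tendsto (fun n : ℕ => max (signal P₀ n (X j) Y - γ) 0) atTop atTop :=
      tendsto_atTop_mono (fun n => le_max_left _ _) h1
    exact ((tendsto_pow_atTop two_ne_zero).comp h2).const_mul_atTop_of_neg (by norm_num)
  have hcast : Tendsto (fun n : ℕ => (n : ℝ)) atTop atTop := tendsto_natCast_atTop_atTop
  have t1 : Tendsto (fun n : ℕ => Real.log n / √(n : ℝ)) atTop (𝓝 0) := by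
    have := (isLittleO_log_rpow_atTop (r := 1 / 2) (by norm_num)).tendsto_div_nhds_zero.comp hcast
    refine this.congr fun n => ?_
    simp [Real.sqrt_eq_rpow]
  have t2 : Tendsto (fun n : ℕ => 1 / √(n : ℝ)) atTop (𝓝 0) :=
    tendsto_const_nhds.div_atTop (Real.tendsto_sqrt_atTop.comp hcast)
  have t3 : Tendsto (fun n : ℕ => 1 / (n : ℝ)) atTop (𝓝 0) := tendsto_const_nhds.div_atTop hcast
  have t4 : Tendsto (fun n : ℕ => 1 / (n : ℝ) ^ (3 / 2 : ℝ)) atTop (𝓝 0) :=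
    tendsto_const_nhds.div_atTop ((tendsto_rpow_atTop (by norm_num)).comp hcast)
  have := ((((tendsto_const_nhds (x := (1 : ℝ))).sub hsum).sub
    ((t1.mul_const ((relevant P₀ X Y).card : ℝ)).mul_const
      (⨆ j : relevant P₀ X Y, 2 * K1 P₀ (X j) Y))).sub
    ((t2.mul_const ((relevant P₀ X Y).card : ℝ)).mul_const
      (⨆ j : relevant P₀ X Y, (2 * K2 c P₀ (X j) Y
        + 2 * lnorm P₀ 4 (centered P₀ (X j)) ^ 2 / sd P₀ (X j) ^ 2 + G1 P₀ (X j) Y)))).sub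
    ((t3.mul_const ((relevant P₀ X Y).card : ℝ)).mul_const
      (⨆ j : relevant P₀ X Y, (4 * G2 c₁ P₀ (X j) Y + 2))) |>.sub
    ((t4.mul_const ((relevant P₀ X Y).card : ℝ)).mul_const
      (⨆ j : relevant P₀ X Y, G3 c₂ P₀ (X j) Y))
  simp only [zero_mul, sub_zero] at this
  exact this

end Screening

end Screening

theorem mainTheorem2 {Ω₀ Ω : Type*} [MeasurableSpace Ω₀] [MeasurableSpace Ω]
    (P₀ : Measure Ω₀) [IsProbabilityMeasure P₀] (P : Measure Ω) [IsProbabilityMeasure P]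
    {p : ℕ} (X : Fin p → Ω₀ → ℝ) (Y : Ω₀ → ℝ)
    (hX : ∀ j, MemLp (X j) 2 P₀) (hVar : ∀ j, 0 < Var[X j; P₀]) (hY : MemLp Y 6 P₀)
    (hX6 : ∀ j ∈ relevant P₀ X Y, MemLp (X j) 6 P₀)
    (hne : ∀ j ∈ relevant P₀ X Y, ¬ centered P₀ (X j) * regError P₀ (X j) Y =ᵐ[P₀] 0)
    (q : ℝ) (hq0 : 0 < q) (hq1 : q < 1) :
    -- numerical constants as in the Berry-Esseen and Rosenthal inequalities exist,
    (∃ cBE : ℝ, 0 < cBE ∧ BerryEsseenInequality cBE) ∧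
    (∃ c₁ c₂ : ℝ, 0 < c₁ ∧ 0 < c₂ ∧ RosenthalInequality 4 (c₁ * √4) (c₂ * 4)) ∧
    -- for all such constants and every sample size the bound holds,
    (∀ cBE c₁ c₂ : ℝ, 0 < cBE → 0 < c₁ → 0 < c₂ → BerryEsseenInequality cBE →
      RosenthalInequality 4 (c₁ * √4) (c₂ * 4) →
      ∀ n : ℕ, 1 ≤ n → ∀ (Xs : Fin n → Fin p → Ω → ℝ) (Ys : Fin n → Ω → ℝ),
        IsIIDCopies P₀ X Y P Xs Ys →
        P.real {ω | (relevant P₀ X Y : Set (Fin p)) ⊆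
            selected (stdNormalQuantile (1 - q / 2)) (fun j i => Xs i j ω) (fun i => Ys i ω)}
          ≥ screeningBound cBE c₁ c₂ P₀ X Y n (fun j => Real.exp (-(1 / 4) *
              (max (signal P₀ n (X j) Y - stdNormalQuantile (1 - q / 2)) 0) ^ 2)) ∧
        ((∀ j ∈ relevant P₀ X Y, stdNormalQuantile (1 - q / 2) ≤ signal P₀ n (X j) Y) →
          P.real {ω | (relevant P₀ X Y : Set (Fin p)) ⊆
            selected (stdNormalQuantile (1 - q / 2)) (fun j i => Xs i j ω) (fun i => Ys i ω)}
          ≥ screeningBound cBE c₁ c₂ P₀ X Y n (fun j => Real.exp (-(1 / 4) *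
              (signal P₀ n (X j) Y - stdNormalQuantile (1 - q / 2)) ^ 2)))) ∧
    -- and the sure screening property follows.
    (∀ (Xs : ℕ → Fin p → Ω → ℝ) (Ys : ℕ → Ω → ℝ), IsIIDCopies P₀ X Y P Xs Ys →
      Tendsto (fun n : ℕ => P.real {ω | (relevant P₀ X Y : Set (Fin p)) ⊆
          selected (stdNormalQuantile (1 - q / 2)) (fun j (i : Fin n) => Xs i j ω)
            (fun i : Fin n => Ys i ω)}) atTop (𝓝 1)) := by
  -- The level `1 - q / 2` exceeds `1 / 2`. Nonnegativity is the only property of the quantile that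
  -- enters.
  have hγ : 0 ≤ stdNormalQuantile (1 - q / 2) := stdNormalQuantile_nonneg (by linarith)
  refine ⟨exists_berryEsseenInequality, ⟨1, 1, one_pos, one_pos, rosenthalInequality_four⟩,
    fun cBE c₁ c₂ hc0 _ _ hc _ n hn Xs Ys h => ?_, fun Xs Ys h => ?_⟩
  · have hb := screeningBound_le c₁ c₂ hc0 hc hVar hY hX6 hne hγ hn h
    refine ⟨hb, fun hS => le_trans (le_of_eq ?_) hb⟩
    have hsum := Finset.sum_congr rfl fun j (hj : j ∈ relevant P₀ X Y) =>
      congrArg (fun t : ℝ => Real.exp (-(1 / 4) * t ^ 2)) (max_eq_left (sub_nonneg.2 (hS j hj)))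
    simp only [screeningBound, hsum]
  · obtain ⟨c, hc0, hc⟩ := exists_berryEsseenInequality
    -- Squeeze between the lower bound, for one fixed choice of constants, and `1`. The lower bound
    -- applies to the first `n` terms of the sequence, obtained by restricting the index along `Fin
    -- n → ℕ`.
    refine tendsto_of_tendsto_of_tendsto_of_le_of_le' (tendsto_screeningBound c 1 1
      (stdNormalQuantile (1 - q / 2)) hVar hY hX6 hne) tendsto_const_nhds ?_
      (Eventually.of_forall fun n => measureReal_le_one)
    filter_upwards [eventually_ge_atTop 1] with n hn
    exact screeningBound_le 1 1 hc0 hc hVar hY hX6 hne hγ hn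
      ⟨h.1.precomp Fin.val_injective, fun i => h.2 i⟩
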